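/- **Model.** Let $n\ge 3$ robots be closed disks of diameter $1$ in the Euclidean plane, with pairwise disjoint interiors (touching is allowed); the position of a robot is its centre. Each robot carries a light with one of the colors off, terminal, interior, failed, symmetry, ready, move, switch off, leader, done. Robot $r$ sees robot $r'$ if some segment from a boundary point of $r$ to a boundary point of $r'$ meets no third robot. The robots work asynchronously, each through infinitely many cycles, finitely many in bounded time: *Look* (instantaneous snapshot of the positions and lights of the visible robots in the local coordinate system centred at the robot; all local systems have the same unit and the same direction and orientation of the $X$-axis, but each robot has its own upward direction), *Compute* (a color and a destination are computed from the snapshot and the own light alone), *Move* (the light is set, then the robot moves on a straight line towards the destination, which it reaches unless it stops earlier after travelling at least a distance $\delta$; $\delta>0$ is fixed and unknown to the robots). All delays are finite and arbitrary. A robot is *stable* at time $t$ if it is stationary and has no pending move or change of light. A configuration is *final* if every robot is stable and no robot taking a snapshot of it would decide to move or to change its light. A *leader configuration* is a configuration in which every robot is stable, exactly one robot $r_l$ has light leader, all others have light off, all others lie strictly to the right of the vertical line through $r_l$ and strictly on one side of the horizontal line $\mathcal L$ through $r_l$, and all others have distance at least $2$ from $\mathcal L$. **Algorithm.** The input is a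 list $\mathbb P$ of $n$ distinct points of $\mathbb R^2_{\ge 0}$. Multiply it by the least factor $c\ge 1$ for which distinct points have distance at least $1$, and order the resulting target points as $t_0,\dots,t_{n-1}$ from top to bottom, and from right to left on the same horizontal line. A robot that sees a light leader (possibly its own) executes Stage 2. Agreed coordinates: $r_l$ is at $(0,-2)$, the $X$-axis is the common one, and up is the side of $\mathcal L$ on which robots are seen (the robot's own up, if all visible robots lie on $\mathcal L$). Stage 2 for a robot $r$ with light off is as follows. (a) Suppose that $r$ is above $\mathcal L$, sees no robot strictly between $\mathcal L$ and its own horizontal line, and is leftmost on that line. If it sees no other robots than $r_l$ on $\mathcal L$, then: if it sees a light done, it sets its light to done if it is at $t_{n-2}$ and moves to $t_{n-2}$ otherwise; if it sees no light done, it moves to $(1,-2)$. If the other robots on $\mathcal L$ are $i\ge1$ robots at $(1,-2),\dots,(i,-2)$, it moves to $(i+1,-2)$. If they are $i\ge 1$ robots at $(n-i,-2),\dots,(n-1,-2)$, it sets its light to done if it is at $t_{n-i-2}$ and moves to $t_{n-i-2}$ otherwise. (b) If (a) does not apply, $r$ is on $\mathcal L$ at $(i,-2)$, $i\ge1$, and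 it sees no light off above $\mathcal L$, it moves to $t_{i-1}$. If the leader sees no light off, it sets its light to done if it is at $t_{n-1}$ and moves to $t_{n-1}$ otherwise; here it recovers the coordinates from the fact that the lowest, and among these the leftmost, other robot is at $t_{n-2}$. In all other cases a robot does nothing. "Move to $a$" means: straight to $a$ if no visible robot is in the way, and otherwise vertically to height $-1$, horizontally at height $-1$, and vertically to $a$ (one segment per cycle, recomputed in every cycle). A robot that sees no light leader executes the leader election (Stage 1). It enters Phase 2 if the first visible batch (robots on the leftmost vertical line) has two robots with light terminal, the second batch has only one color, and their horizontal distance is at least $\frac{n+3}2$, or if there is a light failed, symmetry, ready, move or switch off; otherwise it executes Phase 1. In Phase 1, a robot with light off in the first batch executes a procedure BecomeLeader if it is alone in its batch, and otherwise sets its light to terminal or interior according to whether it is an end robot of its batch or not; a robot with light off outside the first batch does nothing unless there is a light interior on its vertical line; robots with light terminal move left by prescribed rules; robots with other lights do nothing. Phase 2 and BecomeLeader may be arbitrary. **Theorem.** Consider any execution whose configuration at time $T_1$ is a leader configuration. Then there is a time $T_2>T_1$ such that the configuration at time $T_2$ is final and similar to $\mathbb P$, and during $[T_1,T_2]$ the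 interiors of the robots never overlap. Moreover, let $r_0=r_l,r_1,\dots,r_{n-1}$ be the robots in the configuration at time $T_1$ ordered from bottom to top (up being the side of $\mathcal L$ on which the non-leaders lie), and from left to right on the same horizontal line. Then, within $[T_1,T_2]$, first $r_1,\dots,r_{n-1}$ move one by one, in this order, to the points $(1,-2),\dots,(n-1,-2)$ of $\mathcal L$; then $r_1,\dots,r_{n-1}$ move one by one, in this order, to the target points $t_0,\dots,t_{n-2}$ (in the coordinates with $r_l$ at $(0,-2)$ and the upward direction of $r_1$), each setting its light to done; and finally $r_l$ moves to $t_{n-1}$ and sets its light to done. While one of these robots is doing so, no other robot moves or changes its light. -/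

import Mathlib

open Filter Set

namespace FatRobots

noncomputable section

/-! Geometry: the plane, opaque unit-diameter disks, and visibility. -/

/-- The Euclidean plane. -/
abbrev Plane : Type := EuclideanSpace ℝ (Fin 2)

/-- The point with the given coordinates. -/
def pt (a b : ℝ) : Plane := !₂[a, b]

/-- The lights of the robots. -/
inductive Color where
  | off | terminal | interior | failed | symmetry | ready | move | switchOff | leader | done

/-- Robots are closed disks of diameter `1`; distinct ones have disjoint interiors. -/
def NonOverlapping {n : ℕ} (p : Fin n → Plane) : Prop :=
  ∀ i j, i ≠ j → 1 ≤ dist (p i) (p j)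

/-- Robot `i` sees robot `j`: some segment from the boundary of `i` to the boundary of `j`
contains no point of any third robot. -/
def Sees {n : ℕ} (p : Fin n → Plane) (i j : Fin n) : Prop :=
  ∃ x ∈ Metric.sphere (p i) (1 / 2), ∃ y ∈ Metric.sphere (p j) (1 / 2),
    ∀ k, k ≠ i → k ≠ j → Disjoint (segment ℝ x y) (Metric.closedBall (p k) (1 / 2))

/-! Snapshots and actions. -/

/-- A snapshot: the own light, and the positions and lights of the other visible robots, in the
local coordinate system, whose origin is the centre of the observing robot. -/
structure View where
  light : Color
  seen : Set (Plane × Color)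

/-- The result of a computation: the new light and the destination in local coordinates. -/
structure Decision where
  light : Color
  dest : Plane

/-- All robots of the snapshot, the observing robot included. -/
def View.robots (v : View) : Set (Plane × Color) := insert (0, v.light) v.seen

/-- Keep the light and do not move. -/
def stay (v : View) : Decision := ⟨v.light, 0⟩

/-- Change the light and do not move. -/
def recolor (c : Color) : Decision := ⟨c, 0⟩

/-- Keep the light and move horizontally to the left. -/
def moveLeft (v : View) (d : ℝ) : Decision := ⟨v.light, pt (-d) 0⟩

/-- Change of the orientation of the vertical axis. The map is its own inverse. -/
def orient (s : ℤˣ) (q : Plane) : Plane := pt (q 0) (((s : ℤ) : ℝ) * q 1)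

/-- The snapshot of robot `i`. Its local horizontal axis is the common one; its local `up` is the
global `up` if `s = 1`, and the global `down` if `s = -1`. -/
def snapshot {n : ℕ} (p : Fin n → Plane) (c : Fin n → Color) (s : ℤˣ) (i : Fin n) : View where
  light := c i
  seen := {q | ∃ j, j ≠ i ∧ Sees p i j ∧ q = (orient s (p j - p i), c j)}

/-! The target points. -/

section Targets

variable {n : ℕ}

/-- The factor by which the pattern is enlarged so that unit-diameter robots fit on it: the least
factor `≥ 1` that brings all distances between distinct pattern points up to at least `1`. -/
def patternScale (P : Fin n → Plane) : ℝ :=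
  max 1 (⨆ k : Fin n × Fin n, (dist (P k.1) (P k.2))⁻¹)

/-- Sorting key: from top to bottom, and from right to left on the same horizontal line. -/
def targetKey (P : Fin n → Plane) (k : Fin n) : ℝ ×ₗ ℝ := toLex (-(P k 1), -(P k 0))

/-- The target points `t_0, ..., t_{n-1}`, in agreed coordinates (indices `≥ n` are unused). -/
def target (P : Fin n → Plane) (k : ℕ) : Plane :=
  if h : k < n then patternScale P • P (Tuple.sort (targetKey P) ⟨k, h⟩) else 0

end Targets

/-! The agreed coordinate system as computed by a robot from its snapshot. -/

/-- A coordinate system given by a point `anchor` (in local coordinates), the agreed coordinates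
`coord` of that point, and the agreed upward direction (`1` or `-1` in local coordinates). -/
structure Frame where
  anchor : Plane
  coord : Plane
  up : ℝ

def Frame.toAgreed (F : Frame) (q : Plane) : Plane :=
  pt (F.coord 0 + (q 0 - F.anchor 0)) (F.coord 1 + F.up * (q 1 - F.anchor 1))

def Frame.toLocal (F : Frame) (a : Plane) : Plane :=
  pt (F.anchor 0 + (a 0 - F.coord 0)) (F.anchor 1 + F.up * (a 1 - F.coord 1))

open Classical in
/-- `Up` is the side of the leader's horizontal line (at local height `h`) on which there are
robots; if all visible robots are on the line, it is the robot's own `up`. -/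
def upSign (v : View) (h : ℝ) : ℝ :=
  if (∃ q ∈ v.robots, q.1 1 < h) ∧ ¬ ∃ q ∈ v.robots, h < q.1 1 then -1 else 1

/-- The position of the visible leader. -/
def leaderPos (v : View) : Plane := Classical.epsilon fun l => (l, Color.leader) ∈ v.seen

/-- The agreed coordinates as seen by a robot other than the leader: the leader is at `(0,-2)`. -/
def frameOf (v : View) : Frame := ⟨leaderPos v, pt 0 (-2), upSign v (leaderPos v 1)⟩

/-- The lowest visible other robot, and the leftmost one of these. -/
def lowestLeftmost (v : View) (up : ℝ) : Plane :=
  Classical.epsilon fun w => (∃ c, (w, c) ∈ v.seen) ∧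
    ∀ q ∈ v.seen, up * w 1 < up * q.1 1 ∨ (w 1 = q.1 1 ∧ w 0 ≤ q.1 0)

/-- The agreed coordinates as recovered by the leader when it moves last: the lowest, leftmost
other robot is at `t_{n-2}`. -/
def leaderFrame {n : ℕ} (P : Fin n → Plane) (v : View) : Frame :=
  ⟨lowestLeftmost v (upSign v 0), target P (n - 2), upSign v 0⟩

/-! The instruction `Move to a`. -/

/-- A robot can travel from `m` to `a` in a straight line without overlapping a robot of `O`. -/
def FreeRoute (O : Set Plane) (m a : Plane) : Prop :=
  ∀ q ∈ O, ∀ z ∈ segment ℝ m a, 1 ≤ dist z q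

open Classical in
/-- The next point to go to on the way from `m` to `a` (agreed coordinates): straight to `a` if
that is possible, and otherwise along a path of three segments, vertically to height `-1`,
horizontally at that height, and vertically to `a`. -/
def nextStop (O : Set Plane) (m a : Plane) : Plane :=
  if FreeRoute O m a then a
  else if m 0 = a 0 then a
  else if m 1 = -1 then pt (a 0) (-1)
  else pt (m 0) (-1)

/-- `Move to a`, where `a` is given in agreed coordinates. -/
def moveTo (F : Frame) (v : View) (a : Plane) : Decision :=
  ⟨v.light, F.toLocal (nextStop {z | ∃ q ∈ v.seen, z = F.toAgreed q.1} (F.toAgreed 0) a)⟩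

open Classical in
/-- `If I am at a, set the light to done, else move to a`. -/
def finishAt (F : Frame) (v : View) (a : Plane) : Decision :=
  if F.toAgreed 0 = a then recolor Color.done else moveTo F v a

/-! Pattern formation from a leader configuration (stage 2). -/

/-- The visible robots on the leader's horizontal line, other than the leader and the observing
robot, in agreed coordinates. -/
def lineRobots (F : Frame) (v : View) : Set Plane :=
  {z | (∃ q ∈ v.seen, z = F.toAgreed q.1) ∧ z 1 = -2 ∧ z ≠ pt 0 (-2)}

/-- I am above the leader's line, no robot is strictly between this line and my horizontal line,
and I am leftmost on my horizontal line. -/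
def MyTurn (F : Frame) (v : View) : Prop :=
  -2 < F.toAgreed 0 1 ∧
  (∀ q ∈ v.seen, ¬ (-2 < F.toAgreed q.1 1 ∧ F.toAgreed q.1 1 < F.toAgreed 0 1)) ∧
  (∀ q ∈ v.seen, F.toAgreed q.1 1 = F.toAgreed 0 1 → F.toAgreed 0 0 ≤ F.toAgreed q.1 0)

open Classical in
/-- Stage 2 for a robot with light `off` that sees the leader. -/
def stage2Off {n : ℕ} (P : Fin n → Plane) (v : View) : Decision :=
  let F := frameOf v
  let L := lineRobots F v
  if MyTurn F v then
    if L = ∅ then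
      if ∃ q ∈ v.seen, q.2 = Color.done then finishAt F v (target P (n - 2))
      else moveTo F v (pt 1 (-2))
    else if L = {z | ∃ k : ℕ, 1 ≤ k ∧ k ≤ L.ncard ∧ z = pt k (-2)} then
      moveTo F v (pt (L.ncard + 1) (-2))
    else if L = {z | ∃ k : ℕ, n - L.ncard ≤ k ∧ k ≤ n - 1 ∧ z = pt k (-2)} then
      finishAt F v (target P (n - L.ncard - 2))
    else stay v
  else if F.toAgreed 0 1 = -2 ∧
      ∀ q ∈ v.seen, -2 < F.toAgreed q.1 1 → q.2 ≠ Color.off then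
    if 1 ≤ ⌊F.toAgreed 0 0⌋₊ ∧ F.toAgreed 0 0 = ⌊F.toAgreed 0 0⌋₊ then
      moveTo F v (target P (⌊F.toAgreed 0 0⌋₊ - 1))
    else stay v
  else stay v

open Classical in
/-- Stage 2 for the leader. -/
def stage2Leader {n : ℕ} (P : Fin n → Plane) (v : View) : Decision :=
  if ∀ q ∈ v.seen, q.2 ≠ Color.off then
    finishAt (leaderFrame P v) v (target P (n - 1))
  else stay v

/-- Stage 2. -/
def stage2 {n : ℕ} (P : Fin n → Plane) (v : View) : Decision :=
  match v.light with
  | Color.off => stage2Off P v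
  | Color.leader => stage2Leader P v
  | _ => stay v

/-! Stage 1, as far as a robot can enter it, and the complete algorithm. -/

/-- I am in the first (leftmost) batch. -/
def InFirstBatch (v : View) : Prop := ∀ q ∈ v.seen, 0 ≤ q.1 0

/-- I am not between two robots of my batch. -/
def AmTerminal (v : View) : Prop :=
  ¬ ((∃ q ∈ v.seen, q.1 0 = 0 ∧ 0 < q.1 1) ∧ (∃ q ∈ v.seen, q.1 0 = 0 ∧ q.1 1 < 0))

/-- A robot of light `c` is on my vertical line. -/
def OnMyVertical (v : View) (c : Color) : Prop := ∃ q ∈ v.seen, q.1 0 = 0 ∧ q.2 = c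

open Classical in
/-- Phase 1 of the leader election. -/
def phase1 (n : ℕ) (becomeLeader : View → Decision) (v : View) : Decision :=
  match v.light with
  | Color.off =>
    if InFirstBatch v ∧ ∀ q ∈ v.seen, q.1 0 ≠ 0 then becomeLeader v
    else if InFirstBatch v then
      if AmTerminal v then recolor Color.terminal else recolor Color.interior
    else if OnMyVertical v Color.interior then
      if ¬ AmTerminal v then recolor Color.interior
      else if ∃ q ∈ v.seen, q.1 0 < 0 ∧ q.2 = Color.terminal ∧
          ∀ q' ∈ v.seen, q'.1 0 < 0 → q' = q then
        ⟨Color.terminal, pt (-((n + 3) / 2)) 0⟩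
      else stay v
    else stay v
  | Color.terminal =>
    if OnMyVertical v Color.interior then moveLeft v ((n + 3) / 2)
    else if OnMyVertical v Color.terminal then
      if h : ∃ q ∈ v.seen, 0 < q.1 0 ∧ q.1 0 < (n + 3) / 2 ∧
          ∀ q' ∈ v.seen, 0 < q'.1 0 → q.1 0 ≤ q'.1 0 then
        moveLeft v ((n + 3) / 2 - h.choose.1 0)
      else stay v
    else if h : ∃ q ∈ v.seen, q.1 0 < 0 ∧ q.2 = Color.terminal then
      moveLeft v (-(h.choose.1 0))
    else stay v
  | _ => stay v

/-- `q` is in the first visible batch. -/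
def View.First (v : View) (q : Plane × Color) : Prop :=
  q ∈ v.robots ∧ ∀ q' ∈ v.robots, q.1 0 ≤ q'.1 0

/-- `q` is in the second visible batch. -/
def View.Second (v : View) (q : Plane × Color) : Prop :=
  q ∈ v.robots ∧ ¬ v.First q ∧ ∀ q' ∈ v.robots, ¬ v.First q' → q.1 0 ≤ q'.1 0

/-- The conditions under which a robot that sees no leader enters phase 2. -/
def EntersPhase2 (n : ℕ) (v : View) : Prop :=
  ((∃ a b, a ≠ b ∧ v.First a ∧ v.First b ∧ a.2 = Color.terminal ∧ b.2 = Color.terminal) ∧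
    (∃ c, ∀ q, v.Second q → q.2 = c) ∧
    (∀ f q, v.First f → v.Second q → ((n : ℝ) + 3) / 2 ≤ q.1 0 - f.1 0)) ∨
  (∃ q ∈ v.robots, q.2 = Color.failed ∨ q.2 = Color.symmetry ∨ q.2 = Color.ready ∨
    q.2 = Color.move ∨ q.2 = Color.switchOff)

open Classical in
/-- The complete algorithm with input pattern `P`. The procedures `phase2` and `becomeLeader` of
the leader election are parameters, on which nothing will be assumed. -/
def patternFormation {n : ℕ} (P : Fin n → Plane) (phase2 becomeLeader : View → Decision)
    (v : View) : Decision :=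
  if ∃ q ∈ v.robots, q.2 = Color.leader then stage2 P v
  else if EntersPhase2 n v then phase2 v
  else phase1 n becomeLeader v

/-! Asynchronous executions with non-rigid movements. -/

/-- An execution of the algorithm `alg` from time `0` on, for `n` robots with local orientations
`σ`, under an asynchronous scheduler. In its `k`-th cycle robot `i` takes a snapshot at time
`look i k`, sets its light at time `lit i k`, and moves during `[depart i k, arrive i k]`. -/
structure Execution (n : ℕ) (alg : View → Decision) (σ : Fin n → ℤˣ) (δ : ℝ) where
  /-- positions -/
  pos : ℝ → Fin n → Plane
  /-- lights -/
  light : ℝ → Fin n → Color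
  look : Fin n → ℕ → ℝ
  lit : Fin n → ℕ → ℝ
  depart : Fin n → ℕ → ℝ
  arrive : Fin n → ℕ → ℝ
  look_nonneg : ∀ i, 0 ≤ look i 0
  look_lt_lit : ∀ i k, look i k < lit i k
  lit_le_depart : ∀ i k, lit i k ≤ depart i k
  depart_le_arrive : ∀ i k, depart i k ≤ arrive i k
  arrive_le_look : ∀ i k, arrive i k ≤ look i (k + 1)
  /-- every robot is activated again and again, finitely often in bounded time -/
  fair : ∀ i, Tendsto (look i) atTop atTop
  light_init : ∀ i t, 0 ≤ t → t < lit i 0 → light t i = light 0 i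
  light_set : ∀ i k t, lit i k ≤ t → t < lit i (k + 1) →
    light t i = (alg (snapshot (pos (look i k)) (light (look i k)) (σ i) i)).light
  pos_init : ∀ i t, 0 ≤ t → t ≤ depart i 0 → pos t i = pos 0 i
  pos_rest : ∀ i k t, arrive i k ≤ t → t ≤ depart i (k + 1) → pos t i = pos (arrive i k) i
  /-- the robot travels continuously, without turning back, on the segment from its position to
  the computed destination; it reaches it or travels at least the distance `δ` -/
  travel : ∀ i k, ∃ d : Plane, ∃ f : ℝ → ℝ,
    d = pos (look i k) i +
      orient (σ i) (alg (snapshot (pos (look i k)) (light (look i k)) (σ i) i)).dest ∧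
    ContinuousOn f (Icc (depart i k) (arrive i k)) ∧
    MonotoneOn f (Icc (depart i k) (arrive i k)) ∧
    f (depart i k) = 0 ∧ f (arrive i k) ≤ 1 ∧
    (∀ t ∈ Icc (depart i k) (arrive i k),
      pos t i = AffineMap.lineMap (pos (look i k) i) d (f t)) ∧
    min δ (dist (pos (look i k) i) d) ≤ dist (pos (look i k) i) (pos (arrive i k) i)

section Configurations

variable {n : ℕ} {alg : View → Decision} {σ : Fin n → ℤˣ} {δ : ℝ}

/-- Robot `i` is stable at time `t`: it is stationary and has no pending move or change of light,
that is, it neither moves nor changes its light before its next snapshot. (Nothing happens before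
the first snapshot.) -/
def Execution.StableRobot (E : Execution n alg σ δ) (t : ℝ) (i : Fin n) : Prop :=
  ∀ k, E.look i k < t → t ≤ E.look i (k + 1) → ∀ t' ∈ Icc t (E.look i (k + 1)),
    E.pos t' i = E.pos t i ∧ E.light t' i = E.light t i

/-- All robots are stable. -/
def Execution.Stable (E : Execution n alg σ δ) (t : ℝ) : Prop := ∀ i, E.StableRobot t i

/-- A final configuration: stable, and no robot taking a snapshot decides to move or to change its
light. -/
def Execution.IsFinal (E : Execution n alg σ δ) (t : ℝ) : Prop :=
  E.Stable t ∧ ∀ i, alg (snapshot (E.pos t) (E.light t) (σ i) i) = ⟨E.light t i, 0⟩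

/-- The configuration at time `t` is a leader configuration with leader `l`; the side of the
leader's horizontal line on which the other robots lie is the upper one if `τ = 1`, and the
lower one if `τ = -1`. -/
structure Execution.IsLeaderConfiguration (E : Execution n alg σ δ) (t : ℝ) (l : Fin n)
    (τ : ℤˣ) : Prop where
  stable : E.Stable t
  leader : E.light t l = Color.leader
  off : ∀ i, i ≠ l → E.light t i = Color.off
  right : ∀ i, i ≠ l → E.pos t l 0 < E.pos t i 0
  side : ∀ i, i ≠ l → 0 < ((τ : ℤ) : ℝ) * (E.pos t i 1 - E.pos t l 1)
  far : ∀ i, i ≠ l → 2 ≤ |E.pos t i 1 - E.pos t l 1|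

/-- The point of the plane with coordinates `a` in the system in which the robot at `l` has
coordinates `(0,-2)`, with the common horizontal axis and the upward direction `s`. -/
def agreedPoint (l : Plane) (s : ℤˣ) (a : Plane) : Plane :=
  pt (l 0 + a 0) (l 1 + ((s : ℤ) : ℝ) * (a 1 + 2))

/-- During `[a, b]` no robot except possibly `i` moves or changes its light. -/
def Execution.OnlyActive (E : Execution n alg σ δ) (i : Fin n) (a b : ℝ) : Prop :=
  ∀ j, j ≠ i → ∀ t ∈ Icc a b, E.pos t j = E.pos a j ∧ E.light t j = E.light a j

/-- The course of events between the leader configuration at time `T₁` and time `T₂`. Let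
`r 0 = l, r 1, ..., r (n-1)` be the robots from bottom to top, and from left to right on the same
horizontal line. One after the other, `r 1, ..., r (n-1)` move to `(1,-2), ..., (n-1,-2)` (at the
times `s 1, ..., s (n-1)`). Then, one after the other, they move to `t_0, ..., t_{n-2}` and set
their lights to `done` (at the times `u 1, ..., u (n-1)`), and finally the leader does so at
`t_{n-1}`. In the second part the upward direction is that of `r 1`. -/
def Execution.Course (E : Execution n alg σ δ) (P : Fin n → Plane) (T₁ T₂ : ℝ) (l : Fin n)
    (τ : ℤˣ) : Prop :=
  ∃ r : Equiv.Perm (Fin n), ∃ τ' : ℤˣ, ∃ s u : ℕ → ℝ,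
    StrictMono (fun k => (toLex (((τ : ℤ) : ℝ) * E.pos T₁ (r k) 1, E.pos T₁ (r k) 0) : ℝ ×ₗ ℝ)) ∧
    (∀ k, k.val = 0 → r k = l) ∧
    (∀ k, k.val = 1 → τ' = σ (r k)) ∧
    s 0 = T₁ ∧
    (∀ k, 1 ≤ k.val →
      s (k.val - 1) < s k.val ∧
      E.OnlyActive (r k) (s (k.val - 1)) (s k.val) ∧
      (∀ t ∈ Icc (s (k.val - 1)) (s k.val), E.light t (r k) = Color.off) ∧
      E.pos (s k.val) (r k) = agreedPoint (E.pos T₁ l) τ (pt k.val (-2))) ∧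
    u 0 = s (n - 1) ∧
    (∀ k, 1 ≤ k.val →
      u (k.val - 1) < u k.val ∧
      E.OnlyActive (r k) (u (k.val - 1)) (u k.val) ∧
      E.light (u k.val) (r k) = Color.done ∧
      E.pos (u k.val) (r k) = agreedPoint (E.pos T₁ l) τ' (target P (k.val - 1))) ∧
    u (n - 1) < T₂ ∧
    E.OnlyActive l (u (n - 1)) T₂ ∧
    E.light T₂ l = Color.done ∧
    E.pos T₂ l = agreedPoint (E.pos T₁ l) τ' (target P (n - 1))

end Configurations

end

end FatRobots

open FatRobots

/-!
The difficulty is that a robot acts on what it sees, disks hide one another, and snapshots are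
taken at arbitrary times while another robot is moving. The proof shows that nevertheless at most
one robot is active at any time.

Everything is computed in the agreed coordinates, with the leader at `(0,-2)`; `snapshot_agreed`
says that snapshots do not depend on this choice. In the beginning the other robots are at heights
`≥ 0`. Number them from bottom to top and from left to right. The execution passes through the
configurations `lineUp q₀ ρ k` (the robots of rank at most `k` are on the leader's line, the others
have not moved) and then `placed t ρ k` (the robots of rank from `1` to `k` are at their targets, the
others are still on the line). Between two of them, one robot `i` is on its way. Its possible
positions form a convex region, and in this region the robots on the leader's line are not above
`i`, and all the others are not below it (`Corridor`). This has three consequences.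

* The route of `Move to a` is safe: at height `-1` the robot is at distance at least `1` from all
  others, and a vertical segment is safe if its endpoints are (`Corridor.segment_subset_clear`).
  The straight route is taken if it is free of the *visible* robots, but then it is free of all
  robots, because the first one to be touched is visible (`freeRoute_of_visible`). In every cycle the
  robot saves a turn or at least the length `δ` of the rest of its route, so that it arrives
  (`Corridor.effort_lt`).
* Robot `i` sees all robots on the leader's line and is seen by them as soon as it is above this
  line (`sees_of_hanging`). Hence it recognizes the stage of the algorithm from the occupied points
  of the line, while the leader and the robots on the line see a light `off` above the line, or in
  the case of the leader anywhere, and do nothing.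
* A robot `j` that waits above the line comes after `i` in the order from bottom to top and from left
  to right. It sees some robot above the line that comes before itself (`exists_sees_preceding`),
  although not necessarily `i`, and does nothing.

The basic fact about visibility is `exists_sees_on_segment`: the first disk that is met on a segment
which starts in a disk belongs to a visible robot. It also deals with robots that do not see
the leader and might therefore start the leader election. Such a robot sees some robot to its left,
since the leader is to its left; so it is not in the first visible batch, and without lights
`interior` it does nothing (`stays_of_not_sees_leader`). In particular, when the robots stand in a
row on the leader's line, each of them hides the leader from the robots to its right, and only the
first one starts to move. If it sees no robot above the line, it takes its own upward direction as
the agreed one. This matters only for the robot of rank `1`: for the later ones a robot that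
is done is above the line and one such robot is visible, and the configuration on the line looks the
same in both orientations.

When all others are done, the leader recovers the coordinates from the robot at `t (n-2)`, which it
sees on its whole way. If in its target position all visible robots are on its own horizontal line,
the orientation is not determined, but it is not needed either (`leader_active_moves`).

Asynchrony is dealt with by an induction on the snapshots (`Execution.snapshot_induction`): as long
as all earlier snapshots show a configuration with only `i` displaced within its region, all
decisions are the expected ones. A robot that is stable and decides to do nothing remains stable
(`Execution.still`), so the next step starts again from a stable configuration.
-/

namespace FatRobots

/-! ### Coordinates in the plane -/

@[simp] lemma pt_zero (a b : ℝ) : pt a b 0 = a := by simp [pt]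

@[simp] lemma pt_one (a b : ℝ) : pt a b 1 = b := by simp [pt]

lemma plane_ext {x y : Plane} (h0 : x 0 = y 0) (h1 : x 1 = y 1) : x = y := by
  ext i; fin_cases i <;> assumption

lemma dist_sq (x y : Plane) : dist x y ^ 2 = (x 0 - y 0) ^ 2 + (x 1 - y 1) ^ 2 := by
  rw [EuclideanSpace.dist_eq, Real.sq_sqrt (by positivity)]
  simp [Fin.sum_univ_two, Real.dist_eq, sq_abs]

lemma one_le_dist_iff {x y : Plane} :
    1 ≤ dist x y ↔ 1 ≤ (x 0 - y 0) ^ 2 + (x 1 - y 1) ^ 2 := by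
  rw [← dist_sq, one_le_sq_iff₀ dist_nonneg]

lemma mem_disk_iff {x c : Plane} :
    x ∈ Metric.closedBall c (1 / 2) ↔ (x 0 - c 0) ^ 2 + (x 1 - c 1) ^ 2 ≤ 1 / 4 := by
  rw [Metric.mem_closedBall, ← dist_sq, ← sq_le_sq₀ dist_nonneg (by norm_num)]
  norm_num

lemma dist_le_abs_add (x y : Plane) : dist x y ≤ |x 0 - y 0| + |x 1 - y 1| := by
  refine le_of_sq_le_sq ?_ (by positivity)
  rw [dist_sq, add_sq, sq_abs, sq_abs]
  nlinarith [mul_nonneg (abs_nonneg (x 0 - y 0)) (abs_nonneg (x 1 - y 1))]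

lemma lineMap_coord (x y : Plane) (t : ℝ) (i : Fin 2) :
    AffineMap.lineMap x y t i = x i + t * (y i - x i) := by
  simp [AffineMap.lineMap_apply]; ring

lemma mem_segment_iff {x y w : Plane} :
    w ∈ segment ℝ x y ↔ ∃ t : ℝ, 0 ≤ t ∧ t ≤ 1 ∧ w = AffineMap.lineMap x y t := by
  rw [segment_eq_image_lineMap]
  constructor
  · rintro ⟨t, ht, rfl⟩; exact ⟨t, ht.1, ht.2, rfl⟩
  · rintro ⟨t, h0, h1, rfl⟩; exact ⟨t, ⟨h0, h1⟩, rfl⟩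

lemma exists_coord_of_mem_segment {x y w : Plane} (h : w ∈ segment ℝ x y) :
    ∃ t : ℝ, 0 ≤ t ∧ t ≤ 1 ∧ w 0 = x 0 + t * (y 0 - x 0) ∧ w 1 = x 1 + t * (y 1 - x 1) := by
  obtain ⟨t, h0, h1, rfl⟩ := mem_segment_iff.1 h
  exact ⟨t, h0, h1, lineMap_coord .., lineMap_coord ..⟩

lemma sq_le_imp {a b : ℝ} (h : a ^ 2 + b ^ 2 ≤ 1 / 4) : |a| ≤ 1 / 2 ∧ |b| ≤ 1 / 2 := by
  constructor <;> refine abs_le_of_sq_le_sq ?_ (by norm_num) <;> nlinarith [sq_nonneg a, sq_nonneg b]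

lemma disk_coord {x c : Plane} (h : x ∈ Metric.closedBall c (1 / 2)) :
    (-(1 / 2) ≤ x 0 - c 0 ∧ x 0 - c 0 ≤ 1 / 2) ∧ (-(1 / 2) ≤ x 1 - c 1 ∧ x 1 - c 1 ≤ 1 / 2) := by
  have := sq_le_imp (mem_disk_iff.1 h)
  exact ⟨abs_le.1 this.1, abs_le.1 this.2⟩

/-! ### Visibility -/

section Visibility

variable {n : ℕ} {p : Fin n → Plane}

lemma Sees.symm {i j : Fin n} (h : Sees p i j) : Sees p j i := by
  obtain ⟨x, hx, y, hy, h⟩ := h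
  exact ⟨y, hy, x, hx, fun k h1 h2 => segment_symm ℝ x y ▸ h k h2 h1⟩

lemma half_le_dist_of_mem_disk {x c c' : Plane} (h : 1 ≤ dist c c')
    (hx : x ∈ Metric.closedBall c (1 / 2)) : 1 / 2 ≤ dist x c' := by
  have := dist_triangle_left c c' x
  rw [Metric.mem_closedBall] at hx
  linarith

lemma exists_mem_segment_sphere {x y c : Plane} (hx : dist x c ≤ 1 / 2) (hy : 1 / 2 ≤ dist y c) :
    ∃ z ∈ segment ℝ x y, z ∈ Metric.sphere c (1 / 2) := by
  have hc : IsPreconnected (segment ℝ x y) := (convex_segment x y).isPreconnected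
  obtain ⟨z, hz, h⟩ := hc.intermediate_value (left_mem_segment ℝ x y) (right_mem_segment ℝ x y)
    (f := fun z => dist z c) (by fun_prop) ⟨hx, hy⟩
  exact ⟨z, hz, h⟩

/-- Visibility may be tested with segments between arbitrary points of the two disks, because such
a segment can be shortened until its endpoints are boundary points. -/
lemma sees_of_segment (hp : NonOverlapping p) {i j : Fin n} (hij : i ≠ j) {x y : Plane}
    (hx : x ∈ Metric.closedBall (p i) (1 / 2)) (hy : y ∈ Metric.closedBall (p j) (1 / 2))
    (h : ∀ k, k ≠ i → k ≠ j → ∀ w ∈ segment ℝ x y, w ∉ Metric.closedBall (p k) (1 / 2)) :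
    Sees p i j := by
  obtain ⟨x', hx', hxi⟩ := exists_mem_segment_sphere (y := y) (Metric.mem_closedBall.1 hx)
    (half_le_dist_of_mem_disk (hp j i hij.symm) hy)
  obtain ⟨y', hy', hyj⟩ := exists_mem_segment_sphere (y := x') (Metric.mem_closedBall.1 hy)
    (half_le_dist_of_mem_disk (hp i j hij) (Metric.sphere_subset_closedBall hxi))
  have hs : segment ℝ x' y' ⊆ segment ℝ x y := by
    have h1 : y' ∈ segment ℝ x y :=
      (convex_segment x y).segment_subset (right_mem_segment ℝ x y) hx' hy'
    exact (convex_segment x y).segment_subset hx' h1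
  exact ⟨x', hxi, y', hyj, fun k h1 h2 => Set.disjoint_left.2 fun w hw => h k h1 h2 w (hs hw)⟩

/-- Three pairwise non-overlapping disks have no common point. -/
lemma no_triple_point {a b c x : Plane} (hab : 1 ≤ dist a b) (hac : 1 ≤ dist a c)
    (hbc : 1 ≤ dist b c) (ha : x ∈ Metric.closedBall a (1 / 2))
    (hb : x ∈ Metric.closedBall b (1 / 2)) (hc : x ∈ Metric.closedBall c (1 / 2)) : False := by
  rw [one_le_dist_iff] at hab hac hbc
  rw [mem_disk_iff] at ha hb hc
  nlinarith [sq_nonneg (x 0 - a 0 + (x 0 - b 0) + (x 0 - c 0)),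
    sq_nonneg (x 1 - a 1 + (x 1 - b 1) + (x 1 - c 1))]

lemma midpoint_of_common {a b x : Plane} (hab : 1 ≤ dist a b)
    (ha : x ∈ Metric.closedBall a (1 / 2)) (hb : x ∈ Metric.closedBall b (1 / 2)) :
    (∀ i, b i - x i = -(a i - x i)) ∧ (a 0 - x 0) ^ 2 + (a 1 - x 1) ^ 2 = 1 / 4 := by
  rw [one_le_dist_iff] at hab
  rw [mem_disk_iff] at ha hb
  have h : (x 0 - a 0 + (x 0 - b 0)) ^ 2 + (x 1 - a 1 + (x 1 - b 1)) ^ 2 ≤ 0 := by nlinarith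
  have h0 : x 0 - a 0 + (x 0 - b 0) = 0 := by
    nlinarith [sq_nonneg (x 0 - a 0 + (x 0 - b 0)), sq_nonneg (x 1 - a 1 + (x 1 - b 1))]
  have h1 : x 1 - a 1 + (x 1 - b 1) = 0 := by
    nlinarith [sq_nonneg (x 0 - a 0 + (x 0 - b 0)), sq_nonneg (x 1 - a 1 + (x 1 - b 1))]
  refine ⟨fun i => ?_, ?_⟩
  · fin_cases i
    · show b 0 - x 0 = _; simp; linarith
    · show b 1 - x 1 = _; simp; linarith
  · have e0 : b 0 = 2 * x 0 - a 0 := by linarith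
    have e1 : b 1 = 2 * x 1 - a 1 := by linarith
    rw [e0, e1] at hab
    nlinarith

/-- A segment that avoids a closed set still does after its endpoint has been shifted a little. -/
lemma eventually_avoids {C : Set Plane} (hC : IsClosed C) {x y v : Plane}
    (h : ∀ w ∈ segment ℝ x y, w ∉ C) :
    ∀ᶠ e : ℝ in nhds 0, ∀ w ∈ segment ℝ x (y + e • v), w ∉ C := by
  have key : ∀ᶠ e : ℝ in nhds 0, ∀ t ∈ Icc (0 : ℝ) 1,
      AffineMap.lineMap x (y + e • v) t ∉ C := by
    refine isCompact_Icc.eventually_forall_of_forall_eventually fun t ht => ?_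
    have hc : Continuous fun z : ℝ × ℝ => (AffineMap.lineMap x (y + z.1 • v) z.2 : Plane) := by
      simp only [AffineMap.lineMap_apply, vsub_eq_sub, vadd_eq_add]
      fun_prop
    have h0 : (AffineMap.lineMap x (y + (0 : ℝ) • v) t : Plane) ∈ Cᶜ := by
      rw [zero_smul, add_zero]
      exact h _ (mem_segment_iff.2 ⟨t, ht.1, ht.2, rfl⟩)
    exact hc.continuousAt.eventually_mem (x := ((0 : ℝ), t)) (hC.isOpen_compl.mem_nhds h0)
  filter_upwards [key] with e he w hw
  obtain ⟨t, h0, h1, rfl⟩ := mem_segment_iff.1 hw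
  exact he t ⟨h0, h1⟩

/-- Follow a segment that starts in the disk of robot `i` and ends in the disk of another robot.
The first disk on the way belongs to a robot that is seen by `i`. If the segment reaches two disks
simultaneously, it can be turned a little towards one of the two. -/
lemma exists_sees_on_segment (hp : NonOverlapping p) {i m : Fin n} (him : m ≠ i) {x y : Plane}
    (hx : x ∈ Metric.closedBall (p i) (1 / 2)) (hy : y ∈ Metric.closedBall (p m) (1 / 2))
    (S : Fin n → Prop)
    (hS : ∀ k, k ≠ i → ∀ w ∈ segment ℝ x y, w ∈ Metric.closedBall (p k) (1 / 2) → S k) :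
    ∃ k, k ≠ i ∧ S k ∧ Sees p i k := by
  -- the first parameter at which a disk is reached
  let B : Set Plane := ⋃ k ∈ {k | k ≠ i}, Metric.closedBall (p k) (1 / 2)
  have hB : IsClosed B := (Set.toFinite _).isClosed_biUnion fun k _ => Metric.isClosed_closedBall
  have hcont : Continuous fun t : ℝ => (AffineMap.lineMap x y t : Plane) :=
    AffineMap.lineMap_continuous
  obtain ⟨t, ⟨⟨ht0, ht1⟩, htB⟩, hmin⟩ :=
    (isCompact_Icc.inter_right (hB.preimage hcont)).exists_isLeast (s := Icc (0 : ℝ) 1 ∩ _)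
      ⟨1, ⟨zero_le_one, le_rfl⟩, by
        simp only [Set.mem_preimage, AffineMap.lineMap_apply_one]
        exact Set.mem_biUnion (x := m) him hy⟩
  set z : Plane := AffineMap.lineMap x y t with hz
  have hzs : z ∈ segment ℝ x y := mem_segment_iff.2 ⟨t, ht0, ht1, rfl⟩
  have hfirst : ∀ k, k ≠ i → ∀ w ∈ segment ℝ x z, w ∈ Metric.closedBall (p k) (1 / 2) → w = z := by
    intro k hk w hw hwk
    obtain ⟨s, h0, h1, rfl⟩ := mem_segment_iff.1 hw
    have e : (AffineMap.lineMap x z s : Plane) = AffineMap.lineMap x y (s * t) := by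
      rw [hz, AffineMap.lineMap_lineMap_right]
    have hst : t ≤ s * t := hmin ⟨⟨by positivity, by nlinarith⟩, by
      simp only [Set.mem_preimage, ← e]; exact Set.mem_biUnion (x := k) hk hwk⟩
    have : s * t = t := le_antisymm (by nlinarith) hst
    rw [e, this]
  obtain ⟨k, hk, hzk⟩ : ∃ k, k ≠ i ∧ z ∈ Metric.closedBall (p k) (1 / 2) := by
    simpa [B] using htB
  by_cases htie : ∃ k', k' ≠ i ∧ k' ≠ k ∧ z ∈ Metric.closedBall (p k') (1 / 2)
  swap
  · refine ⟨k, hk, hS k hk z hzs hzk, sees_of_segment hp hk.symm hx hzk ?_⟩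
    intro k' h1 h2 w hw hwk
    have := hfirst k' h1 w hw hwk
    exact htie ⟨k', h1, h2, this ▸ hwk⟩
  obtain ⟨k', hk', hkk, hzk'⟩ := htie
  -- of the two disks, the first one is on the side from which the segment comes
  have main : ∀ k k' : Fin n, k ≠ i → k' ≠ i → k' ≠ k → z ∈ Metric.closedBall (p k) (1 / 2) →
      z ∈ Metric.closedBall (p k') (1 / 2) →
      0 ≤ (x 0 - z 0) * (p k 0 - z 0) + (x 1 - z 1) * (p k 1 - z 1) →
      ∃ k, k ≠ i ∧ S k ∧ Sees p i k := by
    intro k k' hk hk' hkk hzk hzk' hside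
    refine ⟨k, hk, hS k hk z hzs hzk, ?_⟩
    obtain ⟨hmid, hrad⟩ := midpoint_of_common (hp k k' hkk.symm) hzk hzk'
    have hother : ∀ j, j ≠ i → j ≠ k → j ≠ k' → ∀ᶠ e : ℝ in nhds 0,
        ∀ w ∈ segment ℝ x (z + e • (p k - z)), w ∉ Metric.closedBall (p j) (1 / 2) := by
      intro j h1 h2 h3
      refine eventually_avoids Metric.isClosed_closedBall fun w hw hwj => ?_
      have := hfirst j h1 w hw hwj
      exact no_triple_point (hp k k' hkk.symm) (hp k j h2.symm) (hp k' j h3.symm) hzk hzk'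
        (this ▸ hwj)
    have hall : ∀ᶠ e : ℝ in nhds 0, ∀ j, j ≠ i → j ≠ k → j ≠ k' →
        ∀ w ∈ segment ℝ x (z + e • (p k - z)), w ∉ Metric.closedBall (p j) (1 / 2) := by
      simp only [Filter.eventually_all]
      exact hother
    have hsmall : ∀ᶠ e : ℝ in nhdsWithin 0 (Ioi 0), e ∈ Ioo (0 : ℝ) 1 :=
      Ioo_mem_nhdsGT zero_lt_one
    obtain ⟨e, ⟨he0, he1⟩, he⟩ := (hsmall.and (hall.filter_mono nhdsWithin_le_nhds)).exists
    refine sees_of_segment hp hk.symm hx (y := z + e • (p k - z)) ?_ ?_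
    · rw [mem_disk_iff]
      simp only [PiLp.add_apply, PiLp.smul_apply, PiLp.sub_apply, smul_eq_mul]
      calc _ = (1 - e) ^ 2 * ((p k 0 - z 0) ^ 2 + (p k 1 - z 1) ^ 2) := by ring
        _ ≤ 1 / 4 := by rw [hrad]; nlinarith
    · intro j h1 h2 w hw hwj
      by_cases h3 : j = k'
      · subst h3
        obtain ⟨s, hs0, hs1, e0, e1⟩ := exists_coord_of_mem_segment hw
        simp only [PiLp.add_apply, PiLp.smul_apply, PiLp.sub_apply, smul_eq_mul] at e0 e1
        rcases hs0.eq_or_lt with rfl | hs0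
        · have hwx : w = x := plane_ext (by linarith) (by linarith)
          subst hwx
          rw [hfirst j h1 w (left_mem_segment ℝ _ _) hwj] at hx
          exact no_triple_point (hp k j hkk.symm) (hp k i hk) (hp j i h1) hzk hzk' hx
        · rw [mem_disk_iff] at hwj
          have m0 := hmid 0
          have m1 := hmid 1
          obtain ⟨a0, ha0⟩ : ∃ a, a = p k 0 - z 0 := ⟨_, rfl⟩
          obtain ⟨a1, ha1⟩ : ∃ a, a = p k 1 - z 1 := ⟨_, rfl⟩
          rw [← ha0] at e0 hrad hside m0
          rw [← ha1] at e1 hrad hside m1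
          have f0 : w 0 - p j 0 = (w 0 - z 0) + a0 := by linarith
          have f1 : w 1 - p j 1 = (w 1 - z 1) + a1 := by linarith
          rw [f0, f1] at hwj
          have hin : (w 0 - z 0) * a0 + (w 1 - z 1) * a1 =
              (1 - s) * ((x 0 - z 0) * a0 + (x 1 - z 1) * a1) + s * e * (1 / 4) := by
            rw [e0, e1, ← hrad]; ring
          have : 0 < (w 0 - z 0) * a0 + (w 1 - z 1) * a1 := by
            rw [hin]
            have := mul_nonneg (sub_nonneg.2 hs1) hside
            have := mul_pos hs0 he0
            linarith
          nlinarith [sq_nonneg (w 0 - z 0), sq_nonneg (w 1 - z 1)]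
      · exact he j h1 h2 h3 w hw hwj
  rcases le_total 0 ((x 0 - z 0) * (p k 0 - z 0) + (x 1 - z 1) * (p k 1 - z 1)) with h | h
  · exact main k k' hk hk' hkk hzk hzk' h
  · refine main k' k hk' hk hkk.symm hzk' hzk ?_
    have hmid := (midpoint_of_common (hp k k' hkk.symm) hzk hzk').1
    rw [hmid 0, hmid 1]; linarith

lemma eq_zero_of_sq_add_sq_nonpos {a b : ℝ} (h : a ^ 2 + b ^ 2 ≤ 0) : a = 0 ∧ b = 0 := by
  constructor <;> nlinarith [sq_nonneg a, sq_nonneg b]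

lemma NonOverlapping.eq_of_coord (hp : NonOverlapping p) {i j : Fin n} (h0 : p i 0 = p j 0)
    (h1 : p i 1 = p j 1) : i = j := by
  by_contra h
  have := hp i j h
  rw [plane_ext h0 h1, dist_self] at this
  linarith

/-- If there is a robot strictly ahead in the direction `u`, then such a robot is visible: look
along a segment that starts at the foremost point of the own disk. -/
lemma exists_sees_in_direction (hp : NonOverlapping p) {i m : Fin n} (a b : ℝ)
    (hu : a ^ 2 + b ^ 2 = 1) (h : 0 < a * (p m 0 - p i 0) + b * (p m 1 - p i 1)) :
    ∃ k, k ≠ i ∧ 0 < a * (p k 0 - p i 0) + b * (p k 1 - p i 1) ∧ Sees p i k := by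
  have him : m ≠ i := by rintro rfl; simp at h
  refine exists_sees_on_segment hp him (x := pt (p i 0 + a / 2) (p i 1 + b / 2))
    (y := pt (p m 0 + a / 2) (p m 1 + b / 2)) ?_ ?_ _ ?_
  · rw [mem_disk_iff]; simp only [pt_zero, pt_one]; nlinarith
  · rw [mem_disk_iff]; simp only [pt_zero, pt_one]; nlinarith
  intro k hk w hw hwk
  obtain ⟨t, h0, h1, e0, e1⟩ := exists_coord_of_mem_segment hw
  simp only [pt_zero, pt_one] at e0 e1
  rw [mem_disk_iff] at hwk
  have hki := one_le_dist_iff.1 (hp k i hk)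
  have hcs : a * (w 0 - p k 0) + b * (w 1 - p k 1) ≤ 1 / 2 := by
    nlinarith [sq_nonneg (w 0 - p k 0 - a / 2), sq_nonneg (w 1 - p k 1 - b / 2)]
  have hw' : a * (w 0 - p i 0) + b * (w 1 - p i 1) =
      1 / 2 + t * (a * (p m 0 - p i 0) + b * (p m 1 - p i 1)) := by
    rw [e0, e1]; linear_combination (1 / 2) * hu
  rcases h0.eq_or_lt with rfl | h0
  · by_contra hneg
    have f0 : w 0 = p i 0 + a / 2 := by linarith
    have f1 : w 1 = p i 1 + b / 2 := by linarith
    rw [f0, f1] at hwk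
    nlinarith
  · have := mul_pos h0 h
    linarith

/-- The configurations that occur around a robot `m` on its way: every other robot is on the
leader's line, or it is at a nonnegative height and not below `m`. -/
def Hanging (p : Fin n → Plane) (m : Fin n) : Prop :=
  ∀ k, k ≠ m → p k 1 = -2 ∨ (0 ≤ p k 1 ∧ p m 1 ≤ p k 1)

/-- A robot `m` above the leader's line sees all robots on the line if the others above the line
are not below `m`: the segment from the top of the robot on the line to a low point of `m` avoids
all other disks. -/
lemma sees_of_hanging (hp : NonOverlapping p) {m b : Fin n} (hb : p b 1 = -2) (hm : -2 < p m 1)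
    (h : Hanging p m) : Sees p b m := by
  have hbm : b ≠ m := by rintro rfl; linarith
  obtain ⟨y, hy, hy1, hy2, hy0⟩ : ∃ y : ℝ, (p m 1 - y) ^ 2 ≤ 1 / 4 ∧ -(3 / 2) < y ∧
      y ≤ p m 1 + 1 / 2 ∧ (y ≤ -1 ∨ y = p m 1 - 1 / 2) := by
    rcases le_or_gt (p m 1) (-1) with h1 | h1
    · exact ⟨(p m 1 - 1) / 2, by nlinarith, by linarith, by linarith, Or.inl (by linarith)⟩
    · exact ⟨p m 1 - 1 / 2, by norm_num, by linarith, by linarith, Or.inr rfl⟩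
  refine sees_of_segment hp hbm (x := pt (p b 0) (-(3 / 2))) (y := pt (p m 0) y) ?_ ?_ ?_
  · rw [mem_disk_iff, hb]; simp; norm_num
  · rw [mem_disk_iff]; simp only [pt_zero, pt_one]; nlinarith
  intro k hkb hkm w hw hwk
  obtain ⟨t, h0, h1, e0, e1⟩ := exists_coord_of_mem_segment hw
  simp only [pt_zero, pt_one] at e0 e1
  have hc := disk_coord hwk
  rcases h k hkm with hk | ⟨hk0, hk⟩
  · have ht : t = 0 := by
      by_contra ht
      have : 0 < t := lt_of_le_of_ne h0 (Ne.symm ht)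
      nlinarith
    subst ht
    rw [mem_disk_iff, hk] at hwk
    have : w 0 = p k 0 := by nlinarith
    exact hkb (hp.eq_of_coord (by linarith) (by linarith))
  · have hwy : w 1 ≤ y := by nlinarith
    rcases hy0 with hy0 | hy0
    · linarith
    · have ht : t = 1 := by
        by_contra ht
        have : t < 1 := lt_of_le_of_ne h1 ht
        nlinarith
      subst ht
      have h1k : p k 1 = p m 1 := by linarith
      rw [mem_disk_iff, e1, h1k] at hwk
      have : w 0 = p k 0 := by nlinarith
      exact hkm (hp.eq_of_coord (by linarith) h1k)

/-- A robot that is lower than all others (leftmost in case of equality) sees the next robot in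
this order, along the segment between the lowest points of the two disks. -/
lemma sees_of_lowest (hp : NonOverlapping p) {m w : Fin n} (hmw : m ≠ w)
    (hm : p m 1 < p w 1 ∨ (p m 1 = p w 1 ∧ p m 0 ≤ p w 0))
    (hk : ∀ k, k ≠ m → k ≠ w → p w 1 < p k 1 ∨ (p w 1 = p k 1 ∧ p w 0 ≤ p k 0)) :
    Sees p m w := by
  have hm1 : p m 1 ≤ p w 1 := by rcases hm with h | h <;> linarith [h]
  refine sees_of_segment hp hmw (x := pt (p m 0) (p m 1 - 1 / 2))
    (y := pt (p w 0) (p w 1 - 1 / 2)) ?_ ?_ ?_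
  · rw [mem_disk_iff]; simp; norm_num
  · rw [mem_disk_iff]; simp; norm_num
  intro k hkm hkw v hv hvk
  obtain ⟨t, h0, h1, e0, e1⟩ := exists_coord_of_mem_segment hv
  simp only [pt_zero, pt_one] at e0 e1
  have hc := disk_coord hvk
  have hprod : 0 ≤ (1 - t) * (p w 1 - p m 1) := mul_nonneg (by linarith) (by linarith)
  rcases hk k hkm hkw with h | ⟨h, h'⟩
  · nlinarith
  have hv1 : v 1 = p k 1 - 1 / 2 := by nlinarith
  have hv0 : v 0 = p k 0 := by rw [mem_disk_iff, hv1] at hvk; nlinarith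
  have hz : (1 - t) * (p w 1 - p m 1) = 0 := by nlinarith
  refine hkw (hp.eq_of_coord ?_ h.symm)
  rcases mul_eq_zero.1 hz with hz | hz
  · have : t = 1 := by linarith
    subst this; linarith
  · rcases hm with hm | hm
    · linarith
    · nlinarith

/-- On the leader's line, a robot sees the next robot to the left. -/
lemma sees_along_line (hp : NonOverlapping p) {i l : Fin n} (hil : i ≠ l) (hi : p i 1 = -2)
    (hl : p l 1 = -2) (hli : p l 0 ≤ p i 0)
    (hk : ∀ k, k ≠ i → k ≠ l → 0 ≤ p k 1 ∨ p i 0 + 1 ≤ p k 0) : Sees p i l := by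
  refine sees_of_segment hp hil (x := p i) (y := p l) (by simp) (by simp) ?_
  intro k hki hkl w hw hwk
  obtain ⟨t, h0, h1, e0, e1⟩ := exists_coord_of_mem_segment hw
  have hc := disk_coord hwk
  rcases hk k hki hkl with h | h
  · rw [hi, hl] at e1; linarith
  · nlinarith

/-- On the leader's line, robots block the view. -/
lemma not_sees_of_between {i b l : Fin n} (hbi : b ≠ i) (hbl : b ≠ l)
    (hi : p i 1 = -2) (hb : p b 1 = -2) (hl : p l 1 = -2) (hlb : p l 0 + 1 ≤ p b 0)
    (hib : p b 0 + 1 ≤ p i 0) : ¬ Sees p i l := by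
  rintro ⟨x, hx, y, hy, h⟩
  have hcx := disk_coord (Metric.sphere_subset_closedBall hx)
  have hcy := disk_coord (Metric.sphere_subset_closedBall hy)
  rw [hi] at hcx
  rw [hl] at hcy
  have hpos : 0 < x 0 - y 0 := by linarith
  set t := (x 0 - p b 0) / (x 0 - y 0) with ht
  have h0 : 0 ≤ t := div_nonneg (by linarith) hpos.le
  have h1 : t ≤ 1 := by rw [ht, div_le_one hpos]; linarith
  have hmul : t * (x 0 - y 0) = x 0 - p b 0 := div_mul_cancel₀ _ hpos.ne'
  refine Set.disjoint_left.1 (h b hbi hbl) (mem_segment_iff.2 ⟨t, h0, h1, rfl⟩) ?_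
  rw [mem_disk_iff, lineMap_coord, lineMap_coord, hb]
  have e0 : x 0 + t * (y 0 - x 0) - p b 0 = 0 := by linarith
  rw [e0]
  have e1 : x 1 + t * (y 1 - x 1) - -2 = (1 - t) * (x 1 + 2) + t * (y 1 + 2) := by ring
  have hle : |x 1 + t * (y 1 - x 1) - -2| ≤ 1 / 2 := by
    rw [e1, abs_le]; constructor <;> nlinarith
  have := abs_le.1 hle
  nlinarith

/-- If a robot `m` above the leader's line precedes robot `i` in the order from bottom to top and
from left to right, then `i` sees a robot that is above the line and precedes it. -/
lemma exists_sees_preceding (hp : NonOverlapping p) {i m : Fin n} (hi : 0 ≤ p i 1)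
    (hm : -2 < p m 1) (hmi : p m 1 < p i 1 ∨ (p m 1 = p i 1 ∧ p m 0 < p i 0)) :
    ∃ k, k ≠ i ∧ (-2 < p k 1 ∧ (p k 1 < p i 1 ∨ (p k 1 = p i 1 ∧ p k 0 < p i 0))) ∧
      Sees p i k := by
  have him : m ≠ i := by rintro rfl; rcases hmi with h | h <;> linarith [h]
  -- look along a segment below the height of the lowest point of the disk of `i`
  obtain ⟨y, hy, hy1, hy2⟩ : ∃ y : ℝ, (y - p m 1) ^ 2 ≤ 1 / 4 ∧ -(3 / 2) < y ∧
      (y < p i 1 - 1 / 2 ∨ (y = p i 1 - 1 / 2 ∧ p m 0 < p i 0)) := by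
    rcases hmi with h | h
    · have hlt : max (-(3 / 2)) (p m 1 - 1 / 2) < min (p m 1 + 1 / 2) (p i 1 - 1 / 2) := by
        simp only [max_lt_iff, lt_min_iff]
        refine ⟨⟨?_, ?_⟩, ?_, ?_⟩ <;> linarith
      obtain ⟨y, hy1, hy2⟩ := exists_between hlt
      simp only [max_lt_iff, lt_min_iff] at hy1 hy2
      exact ⟨y, by nlinarith, hy1.1, Or.inl hy2.2⟩
    · exact ⟨p i 1 - 1 / 2, by rw [h.1]; norm_num, by linarith, Or.inr ⟨rfl, h.2⟩⟩
  refine exists_sees_on_segment hp him (x := pt (p i 0) (p i 1 - 1 / 2)) (y := pt (p m 0) y)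
    ?_ ?_ _ ?_
  · rw [mem_disk_iff]; simp; norm_num
  · rw [mem_disk_iff]; simpa using hy
  intro k hki w hw hwk
  obtain ⟨t, h0, h1, e0, e1⟩ := exists_coord_of_mem_segment hw
  simp only [pt_zero, pt_one] at e0 e1
  have hc := disk_coord hwk
  have hy2' : y ≤ p i 1 - 1 / 2 := by rcases hy2 with h | h <;> linarith [h]
  have hw2 : -(3 / 2) < w 1 := by
    rcases h1.eq_or_lt with rfl | h1
    · linarith
    · nlinarith
  have hw1 : w 1 ≤ p i 1 - 1 / 2 := by nlinarith
  refine ⟨by linarith, ?_⟩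
  rcases (show p k 1 ≤ p i 1 by linarith).lt_or_eq with h | h
  · exact Or.inl h
  · refine Or.inr ⟨h, ?_⟩
    have hw1' : w 1 = p i 1 - 1 / 2 := by linarith
    have hw0 : w 0 = p k 0 := by rw [mem_disk_iff, hw1', h] at hwk; nlinarith
    have hle : p k 0 ≤ p i 0 := by
      rcases hy2 with h' | h'
      · have : t = 0 := by nlinarith
        subst this; linarith
      · nlinarith [h'.2]
    exact hle.lt_of_ne fun h' => hki (hp.eq_of_coord h' h)

/-- A straight route that is free of the visible robots is free of all other robots, since the
first robot that would be touched on the way is visible. -/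
lemma freeRoute_of_visible (hp : NonOverlapping p) {i : Fin n} {a : Plane}
    (h : ∀ j, j ≠ i → Sees p i j → ∀ z ∈ segment ℝ (p i) a, 1 ≤ dist z (p j)) :
    ∀ j, j ≠ i → ∀ z ∈ segment ℝ (p i) a, 1 ≤ dist z (p j) := by
  classical
  by_contra hcon
  push Not at hcon
  set d0 := a 0 - p i 0 with hd0
  set d1 := a 1 - p i 1 with hd1
  -- `φ j t` is the squared distance to `p j` after a fraction `t` of the way
  let φ : Fin n → ℝ → ℝ := fun j t => (p i 0 + t * d0 - p j 0) ^ 2 + (p i 1 + t * d1 - p j 1) ^ 2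
  have hφ : ∀ j t, dist (AffineMap.lineMap (p i) a t : Plane) (p j) ^ 2 = φ j t := by
    intro j t
    rw [dist_sq, lineMap_coord, lineMap_coord]
  -- the time at which robot `j` is touched, if the route is not free of it
  have hentry : ∀ j, (j ≠ i ∧ ∃ t, 0 ≤ t ∧ t ≤ 1 ∧ φ j t < 1) →
      ∃ t, 0 ≤ t ∧ t ≤ 1 ∧ φ j t = 1 ∧
        0 < (p j 0 - (p i 0 + t * d0)) * d0 + (p j 1 - (p i 1 + t * d1)) * d1 := by
    rintro j ⟨hj, t1, h0, h1, hlt⟩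
    have hc : ContinuousOn (φ j) (Icc 0 t1) := by fun_prop
    have hstart : 1 ≤ φ j 0 := by
      have := one_le_dist_iff.1 (hp i j hj.symm)
      simpa [φ] using this
    obtain ⟨t, ht, hte⟩ := intermediate_value_Icc' h0 hc ⟨hlt.le, hstart⟩
    refine ⟨t, ht.1, ht.2.trans h1, hte, ?_⟩
    have hne : t ≠ t1 := by rintro rfl; linarith
    have hpos : 0 < t1 - t := sub_pos.2 (lt_of_le_of_ne ht.2 hne)
    obtain ⟨X, hX⟩ : ∃ X, X = (p j 0 - (p i 0 + t * d0)) * d0 +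
        (p j 1 - (p i 1 + t * d1)) * d1 := ⟨_, rfl⟩
    have hexp : φ j t1 = φ j t - 2 * ((t1 - t) * X) + (t1 - t) ^ 2 * (d0 ^ 2 + d1 ^ 2) := by
      rw [hX]; simp only [φ]; ring
    have h4 : 0 ≤ (t1 - t) ^ 2 * (d0 ^ 2 + d1 ^ 2) := by positivity
    rw [← hX]
    exact pos_of_mul_pos_right (by linarith : 0 < (t1 - t) * X) hpos.le
  choose! T hT0 hT1 hTe hTd using hentry
  obtain ⟨j0, hj0, z, hz, hzd⟩ := hcon
  have hov : ∃ t, 0 ≤ t ∧ t ≤ 1 ∧ φ j0 t < 1 := by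
    obtain ⟨t, h0, h1, rfl⟩ := mem_segment_iff.1 hz
    refine ⟨t, h0, h1, ?_⟩
    rw [← hφ]
    exact pow_lt_one₀ dist_nonneg hzd two_ne_zero
  -- the robot that is touched first
  obtain ⟨k, hk, hkmin⟩ := Finset.exists_min_image
    (Finset.univ.filter fun j => j ≠ i ∧ ∃ t, 0 ≤ t ∧ t ≤ 1 ∧ φ j t < 1) T
    ⟨j0, by simp only [Finset.mem_filter, Finset.mem_univ, true_and]; exact ⟨hj0, hov⟩⟩
  simp only [Finset.mem_filter, Finset.mem_univ, true_and] at hk hkmin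
  have hTk0 := hT0 k hk
  have hTk1 := hT1 k hk
  have hTke := hTe k hk
  have hTkd := hTd k hk
  set t := T k with ht
  obtain ⟨e0, he0⟩ : ∃ e, e = p k 0 - (p i 0 + t * d0) := ⟨_, rfl⟩
  obtain ⟨e1, he1⟩ : ∃ e, e = p k 1 - (p i 1 + t * d1) := ⟨_, rfl⟩
  rw [← he0, ← he1] at hTkd
  have he : e0 ^ 2 + e1 ^ 2 = 1 := by rw [← hTke, he0, he1]; simp only [φ]; ring
  have hsee : Sees p i k := by
    refine sees_of_segment hp hk.1.symm (x := pt (p i 0 + e0 / 2) (p i 1 + e1 / 2))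
      (y := pt (p i 0 + t * d0 + e0 / 2) (p i 1 + t * d1 + e1 / 2)) ?_ ?_ ?_
    · rw [mem_disk_iff]; simp only [pt_zero, pt_one]; linarith
    · have f0 : p i 0 + t * d0 + e0 / 2 - p k 0 = -(e0 / 2) := by linarith
      have f1 : p i 1 + t * d1 + e1 / 2 - p k 1 = -(e1 / 2) := by linarith
      rw [mem_disk_iff]; simp only [pt_zero, pt_one, f0, f1]; linarith
    intro k' hk'i hk'k w hw hwk
    obtain ⟨s, hs0, hs1, f0, f1⟩ := exists_coord_of_mem_segment hw
    simp only [pt_zero, pt_one] at f0 f1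
    rw [mem_disk_iff] at hwk
    -- before the time `t` no robot is overlapped
    have hbefore : ∀ r, 0 ≤ r → r ≤ t → 1 ≤ φ k' r := by
      intro r hr0 hrt
      by_contra! hlt
      have hov' : k' ≠ i ∧ ∃ t, 0 ≤ t ∧ t ≤ 1 ∧ φ k' t < 1 := ⟨hk'i, r, hr0, by linarith, hlt⟩
      have hle := hkmin k' hov'
      have h1 := hTe k' hov'
      have h2 := hTd k' hov'
      obtain ⟨X, hX⟩ : ∃ X, X = (p k' 0 - (p i 0 + T k' * d0)) * d0 +
          (p k' 1 - (p i 1 + T k' * d1)) * d1 := ⟨_, rfl⟩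
      have hexp : φ k' r = φ k' (T k') + 2 * ((T k' - r) * X) +
          (r - T k') ^ 2 * (d0 ^ 2 + d1 ^ 2) := by rw [hX]; simp only [φ]; ring
      rw [← hX] at h2
      have h3 : 0 ≤ (T k' - r) * X := mul_nonneg (by linarith) h2.le
      have h4 : 0 ≤ (r - T k') ^ 2 * (d0 ^ 2 + d1 ^ 2) := by positivity
      linarith
    have hst0 : 0 ≤ s * t := by positivity
    have hst1 : s * t ≤ t := by nlinarith
    -- the disk of `k'` would be touched at the time `s * t`, in the same direction `e`
    have hs := hbefore (s * t) hst0 hst1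
    have hw0 : w 0 = p i 0 + s * t * d0 + e0 / 2 := by rw [f0]; ring
    have hw1 : w 1 = p i 1 + s * t * d1 + e1 / 2 := by rw [f1]; ring
    obtain ⟨g0, hg0⟩ : ∃ g, g = p k' 0 - (p i 0 + s * t * d0) := ⟨_, rfl⟩
    obtain ⟨g1, hg1⟩ : ∃ g, g = p k' 1 - (p i 1 + s * t * d1) := ⟨_, rfl⟩
    have hs' : 1 ≤ g0 ^ 2 + g1 ^ 2 := by
      have e : φ k' (s * t) = g0 ^ 2 + g1 ^ 2 := by rw [hg0, hg1]; simp only [φ]; ring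
      linarith
    have hwk' : (e0 / 2 - g0) ^ 2 + (e1 / 2 - g1) ^ 2 ≤ 1 / 4 := by
      refine le_trans (le_of_eq ?_) hwk
      rw [hw0, hw1, hg0, hg1]; ring
    have hge : (g0 - e0) ^ 2 + (g1 - e1) ^ 2 ≤ 0 := by linarith
    have hge0 : g0 = e0 := sub_eq_zero.1 (eq_zero_of_sq_add_sq_nonpos hge).1
    have hge1 : g1 = e1 := sub_eq_zero.1 (eq_zero_of_sq_add_sq_nonpos hge).2
    rcases hst1.lt_or_eq with hlt | heq
    · -- shortly after that time it would be overlapped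
      set D := d0 ^ 2 + d1 ^ 2 with hD
      have hDpos : 0 < D := by
        have : 0 ≤ D := by positivity
        rcases this.lt_or_eq with h | h
        · exact h
        · obtain ⟨z0, z1⟩ := eq_zero_of_sq_add_sq_nonpos h.symm.le
          rw [z0, z1] at hTkd; simp at hTkd
      set c := e0 * d0 + e1 * d1 with hc
      obtain ⟨r, hr0, hr1⟩ := exists_between (lt_min (sub_pos.2 hlt) (div_pos hTkd hDpos))
      have hr2 := hr1.trans_le (min_le_left _ _)
      have hr3 := hr1.trans_le (min_le_right _ _)
      rw [lt_div_iff₀ hDpos] at hr3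
      have := hbefore (s * t + r) (by linarith) (by linarith)
      have e : φ k' (s * t + r) = 1 - 2 * r * c + r * (r * D) := by
        have : φ k' (s * t + r) = (g0 - r * d0) ^ 2 + (g1 - r * d1) ^ 2 := by
          rw [hg0, hg1]; simp only [φ]; ring
        rw [this, hge0, hge1, hc, hD]
        linear_combination he
      have h5 : r * (r * D) < r * c := mul_lt_mul_of_pos_left hr3 hr0
      have h6 : 0 < r * c := mul_pos hr0 hTkd
      linarith
    · refine hk'k (hp.eq_of_coord ?_ ?_)
      · rw [heq] at hg0; linarith
      · rw [heq] at hg1; linarith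
  obtain ⟨t', h0, h1, hlt⟩ := hk.2
  have := h k hk.1 hsee _ (mem_segment_iff.2 ⟨t', h0, h1, rfl⟩)
  rw [← hφ] at hlt
  exact absurd hlt (not_lt.2 (one_le_pow₀ this))

end Visibility

/-! ### Routes -/

/-- A convex region `K` in which a robot can carry out `Move to a` among the obstacles `O`: it
allows the detour at height `-1`, and while the robot is in `K`, the obstacles on the leader's line
are not above it and the others are not below it. -/
structure Corridor (O K : Set Plane) (a : Plane) : Prop where
  convex : Convex ℝ K
  target_mem : a ∈ K
  level_mem : ∀ z ∈ K, pt (z 0) (-1) ∈ K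
  order : ∀ z ∈ K, ∀ q ∈ O, (q 1 = -2 ∧ -2 ≤ z 1) ∨ (0 ≤ q 1 ∧ z 1 ≤ q 1)
  target_free : ∀ q ∈ O, 1 ≤ dist a q

/-- The positions in `K` at which a robot does not overlap an obstacle. -/
def clear (O K : Set Plane) : Set Plane := {z | z ∈ K ∧ ∀ q ∈ O, 1 ≤ dist z q}

section Route

variable {O K : Set Plane} {a z w : Plane}

lemma Corridor.target_clear (C : Corridor O K a) : a ∈ clear O K := ⟨C.target_mem, C.target_free⟩

lemma Corridor.level_clear (C : Corridor O K a) {z : Plane} (hz : z ∈ K) :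
    pt (z 0) (-1) ∈ clear O K := by
  refine ⟨C.level_mem z hz, fun q hq => ?_⟩
  rw [one_le_dist_iff]
  simp only [pt_zero, pt_one]
  rcases C.order _ (C.level_mem z hz) q hq with h | h
  · rw [h.1]; nlinarith [sq_nonneg (z 0 - q 0)]
  · nlinarith [sq_nonneg (z 0 - q 0), h.1]

/-- Vertical movements are safe if their endpoints are. -/
lemma Corridor.vertical (C : Corridor O K a) {z z' : Plane} (hz : z ∈ clear O K)
    (hz' : z' ∈ clear O K) (h : z 0 = z' 0) : segment ℝ z z' ⊆ clear O K := by
  intro w hw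
  refine ⟨C.convex.segment_subset hz.1 hz'.1 hw, fun q hq => ?_⟩
  have h1 := one_le_dist_iff.1 (hz.2 q hq)
  have h2 := one_le_dist_iff.1 (hz'.2 q hq)
  obtain ⟨t, ht0, ht1, e0, e1⟩ := exists_coord_of_mem_segment hw
  rw [one_le_dist_iff]
  have f0 : w 0 = z 0 := by rw [e0, ← h]; ring
  rw [← h] at h2
  rw [f0]
  have hA := mul_nonneg ht0 (sub_nonneg.2 ht1)
  rcases C.order z hz.1 q hq with o | o <;> rcases C.order z' hz'.1 q hq with o' | o'
  · rw [o.1] at h1 h2 ⊢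
    have hw1 : w 1 - -2 = (1 - t) * (z 1 + 2) + t * (z' 1 + 2) := by rw [e1]; ring
    rcases le_total (z 1) (z' 1) with hle | hle
    · have : z 1 + 2 ≤ w 1 - -2 := by rw [hw1]; nlinarith
      nlinarith [o.2]
    · have : z' 1 + 2 ≤ w 1 - -2 := by rw [hw1]; nlinarith
      nlinarith [o'.2]
  · linarith [o.1, o'.1]
  · linarith [o.1, o'.1]
  · have hw1 : q 1 - w 1 = (1 - t) * (q 1 - z 1) + t * (q 1 - z' 1) := by rw [e1]; ring
    rcases le_total (z 1) (z' 1) with hle | hle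
    · have : q 1 - z' 1 ≤ q 1 - w 1 := by rw [hw1]; nlinarith
      nlinarith [o'.2]
    · have : q 1 - z 1 ≤ q 1 - w 1 := by rw [hw1]; nlinarith
      nlinarith [o.2]

lemma Corridor.freeRoute_of_vertical (C : Corridor O K a) (hz : z ∈ clear O K) (h : z 0 = a 0) :
    FreeRoute O z a := fun q hq _ hw => (C.vertical hz C.target_clear h hw).2 q hq

lemma FreeRoute.mono_left (h : FreeRoute O z a) (hw : w ∈ segment ℝ z a) : FreeRoute O w a :=
  fun q hq v hv => h q hq v
    ((convex_segment z a).segment_subset hw (right_mem_segment ℝ z a) hv)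

lemma Corridor.segment_subset_clear (C : Corridor O K a) (hz : z ∈ clear O K) :
    segment ℝ z (nextStop O z a) ⊆ clear O K := by
  unfold nextStop
  split_ifs with h1 h2 h3
  · exact fun w hw => ⟨C.convex.segment_subset hz.1 C.target_mem hw, fun q hq => h1 q hq w hw⟩
  · exact C.vertical hz C.target_clear h2
  · intro w hw
    obtain ⟨t, ht0, ht1, e0, e1⟩ := exists_coord_of_mem_segment hw
    have hwK := C.convex.segment_subset hz.1 (C.level_mem a C.target_mem) hw
    have : pt (w 0) (-1) = w := plane_ext (by simp) (by rw [e1, h3]; simp)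
    exact this ▸ C.level_clear hwK
  · exact C.vertical hz (C.level_clear hz.1) (by simp)

lemma Corridor.nextStop_eq (C : Corridor O K a) (hz : z ∈ clear O K)
    (h : a ∈ segment ℝ z (nextStop O z a)) : nextStop O z a = a := by
  by_cases h1 : FreeRoute O z a
  · simp [nextStop, h1]
  have h2 : z 0 ≠ a 0 := fun h => h1 (C.freeRoute_of_vertical hz h)
  obtain ⟨t, ht0, ht1, e0, e1⟩ := exists_coord_of_mem_segment h
  by_cases h3 : z 1 = -1
  · simp only [nextStop, h1, h2, h3, if_true, if_false] at e0 e1 ⊢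
    exact plane_ext (by simp) (by rw [e1]; simp)
  · simp only [nextStop, h1, h2, h3, if_false] at e0 e1 ⊢
    simp only [pt_zero, sub_self, mul_zero, add_zero] at e0
    exact absurd e0.symm h2

open Classical in
/-- The number of turns that remain on the route. -/
noncomputable def turns (O : Set Plane) (a z : Plane) : ℕ :=
  if FreeRoute O z a then 0 else if z 1 = -1 then 1 else 2

open Classical in
/-- The length of the remaining route. -/
noncomputable def remaining (O : Set Plane) (a z : Plane) : ℝ :=
  if FreeRoute O z a then dist z a else |z 1 + 1| + |z 0 - a 0| + |a 1 + 1|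

/-- A bound for the number of cycles that a robot at `z` still needs to get to `a`. -/
noncomputable def effort (δ : ℝ) (O : Set Plane) (a z : Plane) : ℕ :=
  turns O a z + ⌈remaining O a z / δ⌉₊

lemma remaining_le : remaining O a z ≤ |z 1 + 1| + |z 0 - a 0| + |a 1 + 1| := by
  unfold remaining
  split_ifs
  · have h1 := dist_le_abs_add z a
    have h2 : |z 1 - a 1| ≤ |z 1 + 1| + |a 1 + 1| := by
      have := abs_sub (z 1 + 1) (a 1 + 1)
      rwa [add_sub_add_right_eq_sub] at this
    linarith
  · exact le_rfl

lemma remaining_nonneg : 0 ≤ remaining O a z := by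
  unfold remaining; split_ifs <;> positivity

lemma effort_lt {δ : ℝ} (hδ : 0 < δ)
    (h : (turns O a w ≤ turns O a z ∧ remaining O a w ≤ remaining O a z - δ) ∨
      (turns O a w < turns O a z ∧ remaining O a w ≤ remaining O a z)) :
    effort δ O a w < effort δ O a z := by
  unfold effort
  rcases h with ⟨h1, h2⟩ | ⟨h1, h2⟩
  · have h3 : remaining O a w / δ + 1 ≤ remaining O a z / δ := by
      rw [div_add_one hδ.ne']
      gcongr
      linarith
    have h4 : ⌈remaining O a w / δ⌉₊ + 1 ≤ ⌈remaining O a z / δ⌉₊ := by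
      rw [← Nat.ceil_add_one (div_nonneg remaining_nonneg hδ.le)]
      exact Nat.ceil_mono h3
    omega
  · have h4 : ⌈remaining O a w / δ⌉₊ ≤ ⌈remaining O a z / δ⌉₊ := Nat.ceil_mono (by gcongr)
    omega

lemma dist_of_mem_segment {x y v : Plane} (h : v ∈ segment ℝ x y) :
    dist x v + dist v y = dist x y := dist_add_dist_of_mem_segment h

lemma eq_of_dist_le {x y v : Plane} (h : v ∈ segment ℝ x y) (hd : dist x y ≤ dist x v) : v = y := by
  have := dist_of_mem_segment h
  exact dist_le_zero.1 (by linarith)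

lemma abs_add_dist_vertical {x y v : Plane} (h : v ∈ segment ℝ x y) (h0 : x 0 = y 0) :
    v 0 = x 0 ∧ |v 1 - y 1| + dist x v = |x 1 - y 1| := by
  obtain ⟨t, ht0, ht1, e0, e1⟩ := exists_coord_of_mem_segment h
  have f0 : v 0 = x 0 := by rw [e0, h0]; ring
  refine ⟨f0, ?_⟩
  have hd : dist x v = t * |x 1 - y 1| := by
    rw [← sq_eq_sq₀ dist_nonneg (by positivity), dist_sq, f0, e1, mul_pow, sq_abs]; ring
  have : v 1 - y 1 = (1 - t) * (x 1 - y 1) := by rw [e1]; ring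
  rw [hd, this, abs_mul, abs_of_nonneg (sub_nonneg.2 ht1)]; ring

lemma abs_add_dist_horizontal {x y v : Plane} (h : v ∈ segment ℝ x y) (h1 : x 1 = y 1) :
    v 1 = x 1 ∧ |v 0 - y 0| + dist x v = |x 0 - y 0| := by
  obtain ⟨t, ht0, ht1, e0, e1⟩ := exists_coord_of_mem_segment h
  have f1 : v 1 = x 1 := by rw [e1, h1]; ring
  refine ⟨f1, ?_⟩
  have hd : dist x v = t * |x 0 - y 0| := by
    rw [← sq_eq_sq₀ dist_nonneg (by positivity), dist_sq, f1, e0, mul_pow, sq_abs]; ring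
  have : v 0 - y 0 = (1 - t) * (x 0 - y 0) := by rw [e0]; ring
  rw [hd, this, abs_mul, abs_of_nonneg (sub_nonneg.2 ht1)]; ring

/-- A cycle in which the robot reaches the next stop saves a turn; any other one saves the
length `δ`. -/
lemma Corridor.effort_lt (C : Corridor O K a) {δ : ℝ} (hδ : 0 < δ) (hz : z ∈ clear O K)
    (hw : w ∈ segment ℝ z (nextStop O z a)) (hd : min δ (dist z (nextStop O z a)) ≤ dist z w)
    (hwa : w ≠ a) : effort δ O a w < effort δ O a z := by
  apply FatRobots.effort_lt hδ
  have hstep : w ≠ nextStop O z a → δ ≤ dist z w := by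
    intro hne
    rcases min_le_iff.1 hd with h | h
    · exact h
    · exact absurd (eq_of_dist_le hw h) hne
  have hwc := C.segment_subset_clear hz hw
  by_cases h1 : FreeRoute O z a
  · have hn : nextStop O z a = a := by simp [nextStop, h1]
    rw [hn] at hw hstep
    have hw1 := h1.mono_left hw
    have := dist_of_mem_segment hw
    have := hstep hwa
    left
    simp only [turns, remaining, h1, hw1, if_true]
    exact ⟨le_rfl, by linarith⟩
  have h2 : z 0 ≠ a 0 := fun h => h1 (C.freeRoute_of_vertical hz h)
  have hwr := remaining_le (O := O) (a := a) (z := w)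
  have hzr : remaining O a z = |z 1 + 1| + |z 0 - a 0| + |a 1 + 1| := by simp [remaining, h1]
  by_cases h3 : z 1 = -1
  · have hn : nextStop O z a = pt (a 0) (-1) := by simp [nextStop, h1, h2, h3]
    rw [hn] at hw hstep
    obtain ⟨f1, f0⟩ := abs_add_dist_horizontal hw (by simp [h3])
    simp only [pt_zero] at f0
    have hzt : turns O a z = 1 := by simp [turns, h1, h3]
    have hnn : 0 ≤ dist z w := dist_nonneg
    by_cases hwn : w = pt (a 0) (-1)
    · right
      have hwt : turns O a w = 0 := by
        simp [turns, C.freeRoute_of_vertical hwc (by rw [hwn]; simp)]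
      refine ⟨by omega, ?_⟩
      rw [f1] at hwr
      linarith
    · left
      refine ⟨?_, ?_⟩
      · rw [hzt]; unfold turns; rw [f1]; split_ifs <;> omega
      · have := hstep hwn
        rw [f1] at hwr
        linarith
  · have hn : nextStop O z a = pt (z 0) (-1) := by simp [nextStop, h1, h2, h3]
    rw [hn] at hw hstep
    obtain ⟨f0, f1⟩ := abs_add_dist_vertical hw (by simp)
    simp only [pt_one, sub_neg_eq_add] at f1
    have hzt : turns O a z = 2 := by simp [turns, h1, h3]
    have hnn : 0 ≤ dist z w := dist_nonneg
    by_cases hwn : w = pt (z 0) (-1)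
    · right
      have hwt : turns O a w ≤ 1 := by
        unfold turns; rw [hwn]; simp only [pt_one, if_true]; split_ifs <;> omega
      refine ⟨by omega, ?_⟩
      rw [f0] at hwr
      linarith
    · left
      refine ⟨?_, ?_⟩
      · rw [hzt]; unfold turns; split_ifs <;> omega
      · have := hstep hwn
        rw [f0] at hwr
        linarith

end Route

/-! ### Asynchronous executions -/

namespace Execution

variable {n : ℕ} {alg : View → Decision} {σ : Fin n → ℤˣ} {δ : ℝ} (E : Execution n alg σ δ)

/-- The decision of robot `i` in its `k`-th cycle. -/
noncomputable def decision (i : Fin n) (k : ℕ) : Decision :=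
  alg (snapshot (E.pos (E.look i k)) (E.light (E.look i k)) (σ i) i)

/-- The destination of robot `i` in its `k`-th cycle. -/
noncomputable def destination (i : Fin n) (k : ℕ) : Plane :=
  E.pos (E.look i k) i + orient (σ i) (E.decision i k).dest

lemma lit_le_look (i : Fin n) (k : ℕ) : E.lit i k ≤ E.look i (k + 1) :=
  (E.lit_le_depart i k).trans ((E.depart_le_arrive i k).trans (E.arrive_le_look i k))

lemma look_strictMono (i : Fin n) : StrictMono (E.look i) :=
  strictMono_nat_of_lt_succ fun k => (E.look_lt_lit i k).trans_le (E.lit_le_look i k)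

lemma look_lt_depart (i : Fin n) (k : ℕ) : E.look i k < E.depart i k :=
  (E.look_lt_lit i k).trans_le (E.lit_le_depart i k)

/-- The first snapshot from time `t` on. -/
lemma exists_next_look (i : Fin n) (t : ℝ) :
    ∃ k, t ≤ E.look i k ∧ ∀ k', E.look i k' < t ↔ k' < k := by
  have hex : ∃ k, t ≤ E.look i k := ((E.fair i).eventually_ge_atTop t).exists
  classical
  refine ⟨Nat.find hex, Nat.find_spec hex, fun k' => ⟨fun h => ?_, fun h => ?_⟩⟩
  · by_contra! hle
    exact absurd ((Nat.find_spec hex).trans ((E.look_strictMono i).monotone hle)) (not_le.2 h)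
  · exact not_le.1 (Nat.find_min hex h)

lemma cycle_cases (i : Fin n) (t : ℝ) :
    t ≤ E.look i 0 ∨ ∃ k, E.look i k < t ∧ t ≤ E.look i (k + 1) := by
  obtain ⟨k, hk, h⟩ := E.exists_next_look i t
  rcases k with _ | k
  · exact Or.inl hk
  · exact Or.inr ⟨k, (h k).2 (Nat.lt_succ_self k), hk⟩

lemma light_before_lit {i : Fin n} {k : ℕ} {t : ℝ} (h1 : E.look i k ≤ t) (h2 : t < E.lit i k) :
    E.light t i = E.light (E.look i k) i := by
  rcases k with _ | k
  · rw [E.light_init i t ((E.look_nonneg i).trans h1) h2,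
      E.light_init i _ (E.look_nonneg i) (E.look_lt_lit i 0)]
  · rw [E.light_set i k t ((E.lit_le_look i k).trans h1) h2,
      E.light_set i k _ (E.lit_le_look i k) (E.look_lt_lit i (k + 1))]

lemma light_after_lit {i : Fin n} {k : ℕ} {t : ℝ} (h1 : E.lit i k ≤ t)
    (h2 : t ≤ E.look i (k + 1)) : E.light t i = (E.decision i k).light :=
  E.light_set i k t h1 (h2.trans_lt (E.look_lt_lit i (k + 1)))

lemma light_in_cycle {i : Fin n} {k : ℕ} {t : ℝ} (h1 : E.look i k ≤ t)
    (h2 : t ≤ E.look i (k + 1)) (h : (E.decision i k).light = E.light (E.look i k) i) :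
    E.light t i = E.light (E.look i k) i := by
  rcases lt_or_ge t (E.lit i k) with h3 | h3
  · exact E.light_before_lit h1 h3
  · rw [E.light_after_lit h3 h2, h]

lemma pos_before_depart {i : Fin n} {k : ℕ} {t : ℝ} (h1 : E.look i k ≤ t)
    (h2 : t ≤ E.depart i k) : E.pos t i = E.pos (E.look i k) i := by
  rcases k with _ | k
  · rw [E.pos_init i t ((E.look_nonneg i).trans h1) h2,
      E.pos_init i _ (E.look_nonneg i) (E.look_lt_depart i 0).le]
  · rw [E.pos_rest i k t ((E.arrive_le_look i k).trans h1) h2,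
      E.pos_rest i k _ (E.arrive_le_look i k) (E.look_lt_depart i (k + 1)).le]

lemma pos_after_arrive {i : Fin n} {k : ℕ} {t : ℝ} (h1 : E.arrive i k ≤ t)
    (h2 : t ≤ E.look i (k + 1)) : E.pos t i = E.pos (E.arrive i k) i :=
  E.pos_rest i k t h1 (h2.trans (E.look_lt_depart i (k + 1)).le)

lemma pos_mem_segment {i : Fin n} {k : ℕ} {t : ℝ} (h1 : E.look i k ≤ t)
    (h2 : t ≤ E.look i (k + 1)) :
    E.pos t i ∈ segment ℝ (E.pos (E.look i k) i) (E.destination i k) := by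
  obtain ⟨d, f, hd, hfc, hfm, hf0, hf1, hpos, -⟩ := E.travel i k
  have hd' : d = E.destination i k := hd
  rw [← hd']
  have hda := E.depart_le_arrive i k
  have main : ∀ s ∈ Icc (E.depart i k) (E.arrive i k),
      E.pos s i ∈ segment ℝ (E.pos (E.look i k) i) d := by
    intro s hs
    refine mem_segment_iff.2 ⟨f s, ?_, ?_, hpos s hs⟩
    · rw [← hf0]; exact hfm (left_mem_Icc.2 hda) hs hs.1
    · exact (hfm hs (right_mem_Icc.2 hda) hs.2).trans hf1
  rcases le_total t (E.depart i k) with h3 | h3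
  · rw [E.pos_before_depart h1 h3]; exact left_mem_segment ..
  rcases le_total t (E.arrive i k) with h4 | h4
  · exact main t ⟨h3, h4⟩
  · rw [E.pos_after_arrive h4 h2]; exact main _ (right_mem_Icc.2 hda)

lemma min_le_dist (i : Fin n) (k : ℕ) :
    min δ (dist (E.pos (E.look i k) i) (E.destination i k)) ≤
      dist (E.pos (E.look i k) i) (E.pos (E.look i (k + 1)) i) := by
  obtain ⟨d, f, hd, -, -, -, -, -, h⟩ := E.travel i k
  rw [E.pos_after_arrive (E.arrive_le_look i k) le_rfl]
  have hd' : d = E.destination i k := hd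
  rwa [hd'] at h

/-- A robot that travels to `a` and arrives there in the course of a cycle does so at a first
time, and does not move any more in this cycle. -/
lemma exists_first_arrival {i : Fin n} {k : ℕ} {a : Plane} (hdest : E.destination i k = a)
    (hne : E.pos (E.look i k) i ≠ a) {t₀ : ℝ} (h1 : E.look i k ≤ t₀)
    (h2 : t₀ ≤ E.look i (k + 1)) (ht₀ : E.pos t₀ i = a) :
    ∃ t, E.lit i k ≤ t ∧ t ≤ E.look i (k + 1) ∧
      (∀ s, E.look i k ≤ s → s < t → E.pos s i ≠ a) ∧
      ∀ s, t ≤ s → s ≤ E.look i (k + 1) → E.pos s i = a := by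
  obtain ⟨d, f, hd, hfc, hfm, hf0, hf1, hpos, -⟩ := E.travel i k
  have hd' : d = a := hd.trans hdest
  subst hd'
  have hda := E.depart_le_arrive i k
  have hpa : ∀ s ∈ Icc (E.depart i k) (E.arrive i k), E.pos s i = d ↔ f s = 1 := by
    intro s hs
    rw [hpos s hs]
    constructor
    · intro h
      rw [← AffineMap.lineMap_apply_one (k := ℝ) (E.pos (E.look i k) i) d] at h
      have := AffineMap.lineMap_injective ℝ hne
      rw [AffineMap.lineMap_apply_one] at h
      exact this (h.trans (AffineMap.lineMap_apply_one _ _).symm)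
    · intro h; rw [h, AffineMap.lineMap_apply_one]
  have hdep : E.depart i k ≤ t₀ := by
    by_contra! h
    exact hne (by rw [← E.pos_before_depart h1 h.le, ht₀])
  have hfa : f (E.arrive i k) = 1 := by
    rcases le_total t₀ (E.arrive i k) with h | h
    · refine le_antisymm hf1 ?_
      rw [← (hpa t₀ ⟨hdep, h⟩).1 ht₀]
      exact hfm ⟨hdep, h⟩ (right_mem_Icc.2 hda) h
    · rw [← hpa _ (right_mem_Icc.2 hda), ← E.pos_after_arrive h h2, ht₀]
  have hcl : IsCompact (Icc (E.depart i k) (E.arrive i k) ∩ f ⁻¹' {1}) :=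
    isCompact_Icc.of_isClosed_subset
      (hfc.preimage_isClosed_of_isClosed isClosed_Icc isClosed_singleton) inter_subset_left
  obtain ⟨t, ⟨ht, htf⟩, hmin⟩ := hcl.exists_isLeast ⟨_, right_mem_Icc.2 hda, hfa⟩
  refine ⟨t, (E.lit_le_depart i k).trans ht.1, ht.2.trans (E.arrive_le_look i k), ?_, ?_⟩
  · intro s hs1 hs2 hsa
    rcases le_total s (E.depart i k) with h | h
    · exact hne (by rw [← E.pos_before_depart hs1 h, hsa])
    · have hs : s ∈ Icc (E.depart i k) (E.arrive i k) := ⟨h, hs2.le.trans ht.2⟩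
      exact absurd (hmin ⟨hs, (hpa s hs).1 hsa⟩) (not_le.2 hs2)
  · intro s hs1 hs2
    rcases le_total s (E.arrive i k) with h | h
    · have hs : s ∈ Icc (E.depart i k) (E.arrive i k) := ⟨ht.1.trans hs1, h⟩
      refine (hpa s hs).2 (le_antisymm ?_ ?_)
      · rw [← hfa]; exact hfm hs (right_mem_Icc.2 hda) h
      · rw [← show f t = 1 from htf]; exact hfm ht hs hs1
    · rw [E.pos_after_arrive h hs2]
      exact (hpa _ (right_mem_Icc.2 hda)).2 hfa

/-- A robot that is stable at time `T` stays in the set `G` of positions and keeps its light `c`, if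
all decisions that it makes while this is the case let it do so. -/
lemma confined {i : Fin n} {T X : ℝ} (hT : 0 ≤ T) (hst : E.StableRobot T i) {G : Set Plane}
    {c : Color} (h0 : E.pos T i ∈ G) (hc : E.light T i = c)
    (h : ∀ k, T ≤ E.look i k → E.look i k < X → E.pos (E.look i k) i ∈ G →
      E.light (E.look i k) i = c → (E.decision i k).light = c ∧
        segment ℝ (E.pos (E.look i k) i) (E.destination i k) ⊆ G) :
    ∀ t ∈ Icc T X, E.pos t i ∈ G ∧ E.light t i = c := by
  have hbase : ∀ t, T ≤ t → t ≤ E.look i 0 → E.pos t i ∈ G ∧ E.light t i = c := by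
    intro t hTt ht
    have hl := E.look_lt_lit i 0
    have hd := E.look_lt_depart i 0
    rw [E.pos_init i t (hT.trans hTt) (by linarith), ← E.pos_init i T hT (by linarith),
      E.light_init i t (hT.trans hTt) (by linarith), ← E.light_init i T hT (by linarith)]
    exact ⟨h0, hc⟩
  have hstep : ∀ k t, E.look i k < t → t ≤ E.look i (k + 1) → T ≤ t → t ≤ X →
      E.pos t i ∈ G ∧ E.light t i = c := by
    intro k
    induction k with
    | zero =>
      intro t h1 h2 h3 h4
      rcases lt_or_ge (E.look i 0) T with h5 | h5
      · obtain ⟨e1, e2⟩ := hst 0 h5 (h3.trans h2) t ⟨h3, h2⟩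
        rw [e1, e2]; exact ⟨h0, hc⟩
      · obtain ⟨g1, g2⟩ := hbase _ h5 le_rfl
        obtain ⟨d1, d2⟩ := h 0 h5 (h1.trans_le h4) g1 g2
        exact ⟨d2 (E.pos_mem_segment h1.le h2),
          (E.light_in_cycle h1.le h2 (d1.trans g2.symm)).trans g2⟩
    | succ k ih =>
      intro t h1 h2 h3 h4
      rcases lt_or_ge (E.look i (k + 1)) T with h5 | h5
      · obtain ⟨e1, e2⟩ := hst (k + 1) h5 (h3.trans h2) t ⟨h3, h2⟩
        rw [e1, e2]; exact ⟨h0, hc⟩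
      · obtain ⟨g1, g2⟩ := ih _ (E.look_strictMono i (Nat.lt_succ_self k)) le_rfl h5
          (h1.le.trans h4)
        obtain ⟨d1, d2⟩ := h (k + 1) h5 (h1.trans_le h4) g1 g2
        exact ⟨d2 (E.pos_mem_segment h1.le h2),
          (E.light_in_cycle h1.le h2 (d1.trans g2.symm)).trans g2⟩
  intro t ht
  rcases E.cycle_cases i t with h1 | ⟨k, h1, h2⟩
  · exact hbase t ht.1 h1
  · exact hstep k t h1 h2 ht.1 ht.2

/-- A robot that is stable at time `T` and decides in every snapshot to do nothing, does nothing
and is stable at the end. -/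
lemma still {i : Fin n} {T X : ℝ} (hT : 0 ≤ T) (hst : E.StableRobot T i)
    (h : ∀ k, T ≤ E.look i k → E.look i k < X → E.decision i k = ⟨E.light T i, 0⟩) :
    (∀ t ∈ Icc T X, E.pos t i = E.pos T i ∧ E.light t i = E.light T i) ∧
      (T ≤ X → E.StableRobot X i) := by
  have hconf : ∀ Y, (∀ k, E.look i k < Y → E.look i k < X) →
      ∀ t ∈ Icc T Y, E.pos t i = E.pos T i ∧ E.light t i = E.light T i := by
    intro Y hY
    refine E.confined hT hst (G := {E.pos T i}) rfl rfl fun k h1 h2 h3 _ => ?_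
    have hd := h k h1 (hY k h2)
    have h3' : E.pos (E.look i k) i = E.pos T i := h3
    refine ⟨by rw [hd], ?_⟩
    have : E.destination i k = E.pos T i := by
      rw [destination, hd, h3']
      exact plane_ext (by simp [orient]) (by simp [orient])
    rw [this, h3', segment_same]
  refine ⟨hconf X fun _ => id, fun hTX k h1 h2 t ht => ?_⟩
  have hY : ∀ k', E.look i k' < t → E.look i k' < X := by
    intro k' hk'
    have : k' ≤ k := Nat.lt_succ_iff.1 ((E.look_strictMono i).lt_iff_lt.1 (hk'.trans_le ht.2))
    exact ((E.look_strictMono i).monotone this).trans_lt h1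
  have e1 := hconf t hY t ⟨hTX.trans ht.1, le_rfl⟩
  have e2 := hconf t hY X ⟨hTX, ht.1⟩
  exact ⟨e1.1.trans e2.1.symm, e1.2.trans e2.2.symm⟩

/-- Induction on the snapshots. A property `Q j t` of robots `j` and times `t` holds throughout
`[T, X]` if the following is true: it holds for robot `j` up to time `Y`, provided that it
holds for all robots at the times of the snapshots that `j` has taken before. -/
lemma snapshot_induction {T X : ℝ} (Q : Fin n → ℝ → Prop)
    (hQ : ∀ j Y, Y ≤ X → (∀ k, T ≤ E.look j k → E.look j k < Y → ∀ j', Q j' (E.look j k)) →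
      ∀ t ∈ Icc T Y, Q j t) : ∀ t ∈ Icc T X, ∀ j, Q j t := by
  suffices h : ∀ j k, T ≤ E.look j k → E.look j k < X → ∀ j', Q j' (E.look j k) from
    fun t ht j => hQ j X le_rfl (h j) t ht
  by_contra hcon
  push Not at hcon
  -- consider the first snapshot of a configuration without the property
  let B : Set (Fin n × ℕ) :=
    {e | T ≤ E.look e.1 e.2 ∧ E.look e.1 e.2 < X ∧ ∃ j', ¬ Q j' (E.look e.1 e.2)}
  have hfin : B.Finite := by
    have h1 : ∀ j, {k | E.look j k < X}.Finite := by
      intro j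
      obtain ⟨k, -, hk⟩ := E.exists_next_look j X
      exact (Set.finite_lt_nat k).subset fun k' h => (hk k').1 h
    refine (Set.finite_iUnion fun j => (h1 j).image (Prod.mk j)).subset ?_
    rintro ⟨j, k⟩ ⟨-, h, -⟩
    exact Set.mem_iUnion.2 ⟨j, k, h, rfl⟩
  obtain ⟨j, k, h1, h2, j', h3⟩ := hcon
  obtain ⟨⟨i, m⟩, hm, hmin⟩ := Set.exists_min_image B (fun e => E.look e.1 e.2) hfin
    ⟨(j, k), h1, h2, j', h3⟩
  obtain ⟨g1, g2, j', g3⟩ := hm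
  refine g3 (hQ j' (E.look i m) g2.le (fun k' f1 f2 => ?_) _ ⟨g1, le_rfl⟩)
  by_contra hbad
  push Not at hbad
  exact absurd (hmin (j', k') ⟨f1, f2.trans g2, hbad⟩) (not_le.2 f2)

/-- One robot moves. While robot `i` is in the set `G` and has not yet reached `a`, it decides to
go to `d z` from `z` and all others decide to do nothing. The measure `μ` decreases in every cycle
that does not end at `a`. Then `i` arrives at `a`. -/
lemma exists_arrival {T : ℝ} (hT : 0 ≤ T) (hst : E.Stable T) (i : Fin n) (a : Plane)
    (G : Set Plane) (d : Plane → Plane) (μ : Plane → ℕ) (h0 : E.pos T i ∈ G)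
    (hne : E.pos T i ≠ a)
    (hothers : ∀ z ∈ G, z ≠ a → ∀ j, j ≠ i →
      alg (snapshot (Function.update (E.pos T) i z) (E.light T) (σ j) j) = ⟨E.light T j, 0⟩)
    (hlight : ∀ z ∈ G, z ≠ a →
      (alg (snapshot (Function.update (E.pos T) i z) (E.light T) (σ i) i)).light = E.light T i)
    (hdest : ∀ z ∈ G, z ≠ a →
      z + orient (σ i)
        (alg (snapshot (Function.update (E.pos T) i z) (E.light T) (σ i) i)).dest = d z)
    (hseg : ∀ z ∈ G, z ≠ a → segment ℝ z (d z) ⊆ G)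
    (hend : ∀ z ∈ G, z ≠ a → a ∈ segment ℝ z (d z) → d z = a)
    (hμ : ∀ z ∈ G, z ≠ a → ∀ w ∈ segment ℝ z (d z), min δ (dist z (d z)) ≤ dist z w → w ≠ a →
      μ w < μ z) :
    ∃ T', T < T' ∧ E.Stable T' ∧ E.pos T' = Function.update (E.pos T) i a ∧
      E.light T' = E.light T ∧
      ∀ t ∈ Icc T T', ∃ z ∈ G, E.pos t = Function.update (E.pos T) i z ∧
        E.light t = E.light T := by
  -- the properties that are preserved until `i` reaches `a`
  let Q : Fin n → ℝ → Prop := fun j t =>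
    (if j = i then E.pos t j ∈ G else E.pos t j = E.pos T j) ∧ E.light t j = E.light T j
  have hconfig : ∀ t, (∀ j, Q j t) →
      E.pos t i ∈ G ∧ E.pos t = Function.update (E.pos T) i (E.pos t i) ∧
        E.light t = E.light T := by
    intro t ht
    refine ⟨by simpa [Q] using (ht i).1, funext fun j => ?_, funext fun j => (ht j).2⟩
    by_cases hj : j = i
    · subst hj; simp
    · rw [Function.update_of_ne hj]
      simpa [Q, hj] using (ht j).1
  have hdec : ∀ j k, (∀ j', Q j' (E.look j k)) → E.pos (E.look j k) i ≠ a →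
      (j ≠ i → E.decision j k = ⟨E.light T j, 0⟩) ∧
      (j = i → (E.decision j k).light = E.light T j ∧
        E.destination j k = d (E.pos (E.look j k) i)) := by
    intro j k hQ hna
    obtain ⟨g1, g2, g3⟩ := hconfig _ hQ
    refine ⟨fun hj => ?_, ?_⟩
    · rw [decision, g2, g3]; exact hothers _ g1 hna j hj
    · rintro rfl
      have e : E.decision j k = alg (snapshot (Function.update (E.pos T) j
          (E.pos (E.look j k) j)) (E.light T) (σ j) j) := by
        rw [decision, g3, ← g2]
      refine ⟨by rw [e]; exact hlight _ g1 hna, ?_⟩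
      rw [destination, e]; exact hdest _ g1 hna
  have hQ : ∀ X, (∀ t, T ≤ t → t < X → E.pos t i ≠ a) → ∀ t ∈ Icc T X, ∀ j, Q j t := by
    intro X hX
    refine E.snapshot_induction Q fun j Y hY hlook => ?_
    by_cases hj : j = i
    · subst hj
      have := E.confined (X := Y) hT (hst j) h0 rfl (fun k k1 k2 k3 k4 => ?_)
      · intro t ht
        simpa [Q] using this t ht
      · obtain ⟨f1, f2⟩ := (hdec j k (hlook k k1 k2) (hX _ k1 (k2.trans_le hY))).2 rfl
        refine ⟨f1, ?_⟩
        rw [f2]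
        exact hseg _ k3 (hX _ k1 (k2.trans_le hY))
    · have := (E.still (X := Y) hT (hst j) (fun k k1 k2 =>
        (hdec j k (hlook k k1 k2) (hX _ k1 (k2.trans_le hY))).1 hj)).1
      intro t ht
      simpa [Q, hj] using this t ht
  -- the cycles of `i` from time `T` on
  obtain ⟨m, hm, hmlt⟩ := E.exists_next_look i T
  have hTlook : ∀ k, T ≤ E.look i (m + k) := fun k =>
    hm.trans ((E.look_strictMono i).monotone (Nat.le_add_right m k))
  have hinit : ∀ t, T ≤ t → t ≤ E.look i m → E.pos t i = E.pos T i := by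
    intro t h1 h2
    refine ((E.still (X := E.look i m) hT (hst i) (fun k k1 k2 => ?_)).1 t ⟨h1, h2⟩).1
    exact absurd ((hmlt k).2 ((E.look_strictMono i).lt_iff_lt.1 k2)) (not_lt.2 k1)
  have hex : ∃ k, ∃ t, E.look i (m + k) ≤ t ∧ t ≤ E.look i (m + k + 1) ∧ E.pos t i = a := by
    by_contra! hnone
    have hnever : ∀ t, T ≤ t → E.pos t i ≠ a := by
      intro t ht
      rcases le_or_gt t (E.look i m) with h1 | h1
      · rw [hinit t ht h1]; exact hne
      · rcases E.cycle_cases i t with h2 | ⟨k, h2, h3⟩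
        · exact absurd (h1.trans_le h2)
            (not_lt.2 ((E.look_strictMono i).monotone (Nat.zero_le m)))
        · have hmk : m ≤ k :=
            Nat.lt_succ_iff.1 ((E.look_strictMono i).lt_iff_lt.1 (h1.trans_le h3))
          obtain ⟨k', rfl⟩ := Nat.exists_eq_add_of_le hmk
          exact hnone k' t h2.le h3
    have hall : ∀ k, ∀ j, Q j (E.look i (m + k)) := fun k =>
      hQ _ (fun t h1 _ => hnever t h1) _ ⟨hTlook k, le_rfl⟩
    have hdecr : ∀ k, μ (E.pos (E.look i (m + (k + 1))) i) < μ (E.pos (E.look i (m + k)) i) := by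
      intro k
      have f2 := ((hdec i (m + k) (hall k) (hnever _ (hTlook k))).2 rfl).2
      have g1 := (hconfig _ (hall k)).1
      have hmem := E.pos_mem_segment (E.look_strictMono i (Nat.lt_succ_self (m + k))).le le_rfl
      have hmin := E.min_le_dist i (m + k)
      rw [f2] at hmem hmin
      exact hμ _ g1 (hnever _ (hTlook k)) _ hmem hmin (hnever _ (hTlook (k + 1)))
    have hle : ∀ k, μ (E.pos (E.look i (m + k)) i) + k ≤ μ (E.pos (E.look i (m + 0)) i) := by
      intro k
      induction k with
      | zero => simp
      | succ k ih => have := hdecr k; omega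
    have := hle (μ (E.pos (E.look i (m + 0)) i) + 1)
    omega
  -- the cycle in which `i` arrives
  classical
  obtain ⟨K, hK⟩ : ∃ K, K = Nat.find hex := ⟨_, rfl⟩
  obtain ⟨t₀, ht1, ht2, ht3⟩ := hK ▸ Nat.find_spec hex
  have hbefore : ∀ t, T ≤ t → t ≤ E.look i (m + K) → E.pos t i ≠ a := by
    intro t h1 h2
    rcases le_or_gt t (E.look i m) with h3 | h3
    · rw [hinit t h1 h3]; exact hne
    · rcases E.cycle_cases i t with h4 | ⟨k, h4, h5⟩
      · exact absurd (h3.trans_le h4)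
          (not_lt.2 ((E.look_strictMono i).monotone (Nat.zero_le m)))
      · have hmk : m ≤ k :=
          Nat.lt_succ_iff.1 ((E.look_strictMono i).lt_iff_lt.1 (h3.trans_le h5))
        obtain ⟨k', rfl⟩ := Nat.exists_eq_add_of_le hmk
        have hkK : k' < K := by
          have := (E.look_strictMono i).lt_iff_lt.1 (h4.trans_le h2)
          omega
        exact fun h => Nat.find_min hex (hK ▸ hkK) ⟨t, h4.le, h5, h⟩
  have hna := hbefore _ (hTlook K) le_rfl
  have hQK := hQ _ (fun t h1 h2 => hbefore t h1 h2.le) _ ⟨hTlook K, le_rfl⟩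
  obtain ⟨f1, f2⟩ := (hdec i (m + K) hQK hna).2 rfl
  have hda : E.destination i (m + K) = a := by
    rw [f2]
    refine hend _ (hconfig _ hQK).1 hna ?_
    rw [← f2, ← ht3]
    exact E.pos_mem_segment ht1 ht2
  obtain ⟨T', s1, s2, s3, s4⟩ := E.exists_first_arrival hda hna ht1 ht2 ht3
  have hlit := E.look_lt_lit i (m + K)
  have hTT' : T < T' := (hTlook K).trans_lt (hlit.trans_le s1)
  have hX : ∀ t, T ≤ t → t < T' → E.pos t i ≠ a := by
    intro t h1 h2
    rcases le_total t (E.look i (m + K)) with h3 | h3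
    · exact hbefore t h1 h3
    · exact s3 t h3 h2
  have hQT' := hQ T' hX
  have hposT' : E.pos T' i = a := s4 T' le_rfl s2
  refine ⟨T', hTT', fun j => ?_, ?_, (hconfig T' (hQT' T' ⟨hTT'.le, le_rfl⟩)).2.2, ?_⟩
  · by_cases hj : j = i
    · subst hj
      intro k k1 k2 t ht
      have hk : k = m + K := by
        have a1 := (E.look_strictMono j).lt_iff_lt.1 (k1.trans_le s2)
        have a2 := (E.look_strictMono j).lt_iff_lt.1 ((hlit.trans_le s1).trans_le k2)
        omega
      subst hk
      refine ⟨by rw [s4 t ht.1 ht.2, hposT'], ?_⟩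
      rw [E.light_after_lit (s1.trans ht.1) ht.2, E.light_after_lit s1 s2]
    · refine (E.still hT (hst j) (fun k k1 k2 => ?_)).2 hTT'.le
      exact (hdec j k (hQT' _ ⟨k1, k2.le⟩) (hX _ k1 k2)).1 hj
  · rw [(hconfig T' (hQT' T' ⟨hTT'.le, le_rfl⟩)).2.1, hposT']
  · intro t ht
    obtain ⟨g1, g2, g3⟩ := hconfig t (hQT' t ht)
    exact ⟨_, g1, g2, g3⟩

/-- One robot changes its light. All robots are at rest, robot `i` decides to set its light to `c`
and all others decide to do nothing. Then `i` sets its light. -/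
lemma exists_recolor {T : ℝ} (hT : 0 ≤ T) (hst : E.Stable T) (i : Fin n) (c : Color)
    (hothers : ∀ j, j ≠ i → alg (snapshot (E.pos T) (E.light T) (σ j) j) = ⟨E.light T j, 0⟩)
    (hact : alg (snapshot (E.pos T) (E.light T) (σ i) i) = recolor c) :
    ∃ T', T < T' ∧ E.Stable T' ∧ E.pos T' = E.pos T ∧
      E.light T' = Function.update (E.light T) i c ∧
      ∀ t ∈ Icc T T', E.pos t = E.pos T ∧ ∀ j, j ≠ i → E.light t j = E.light T j := by
  obtain ⟨m, hm, hmlt⟩ := E.exists_next_look i T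
  have hlit := E.look_lt_lit i m
  have hiinit := (E.still (X := E.look i m) hT (hst i) (fun k k1 k2 =>
    absurd ((hmlt k).2 ((E.look_strictMono i).lt_iff_lt.1 k2)) (not_lt.2 k1))).1
  have hilook := hiinit _ ⟨hm, le_rfl⟩
  have hi : ∀ t, T ≤ t → t ≤ E.lit i m →
      E.pos t i = E.pos T i ∧ (t < E.lit i m → E.light t i = E.light T i) := by
    intro t h1 h2
    rcases le_total t (E.look i m) with h3 | h3
    · exact ⟨(hiinit t ⟨h1, h3⟩).1, fun _ => (hiinit t ⟨h1, h3⟩).2⟩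
    · exact ⟨(E.pos_before_depart h3 (h2.trans (E.lit_le_depart i m))).trans hilook.1,
        fun h4 => (E.light_before_lit h3 h4).trans hilook.2⟩
  let Q : Fin n → ℝ → Prop := fun j t =>
    E.pos t j = E.pos T j ∧ ((j = i → t < E.lit i m) → E.light t j = E.light T j)
  have hdec : ∀ j k, E.look j k < E.lit i m → (∀ j', Q j' (E.look j k)) →
      E.decision j k = alg (snapshot (E.pos T) (E.light T) (σ j) j) := by
    intro j k hk hQ
    have e1 : E.pos (E.look j k) = E.pos T := funext fun j' => (hQ j').1
    have e2 : E.light (E.look j k) = E.light T := funext fun j' => (hQ j').2 fun _ => hk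
    rw [decision, e1, e2]
  have hQ : ∀ t ∈ Icc T (E.lit i m), ∀ j, Q j t := by
    refine E.snapshot_induction Q fun j Y hY hlook => ?_
    by_cases hj : j = i
    · subst hj
      exact fun t ht => ⟨(hi t ht.1 (ht.2.trans hY)).1,
        fun h => (hi t ht.1 (ht.2.trans hY)).2 (h rfl)⟩
    · have := (E.still (X := Y) hT (hst j) (fun k k1 k2 =>
        (hdec j k (k2.trans_le hY) (hlook k k1 k2)).trans (hothers j hj))).1
      exact fun t ht => ⟨(this t ht).1, fun _ => (this t ht).2⟩
  have hTlit : T < E.lit i m := hm.trans_lt hlit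
  have hd : E.decision i m = recolor c :=
    (hdec i m hlit (hQ _ ⟨hm, hlit.le⟩)).trans hact
  have hdest : E.destination i m = E.pos T i := by
    rw [destination, hd, hilook.1]
    exact plane_ext (by simp [orient, recolor]) (by simp [orient, recolor])
  have hpos : ∀ t ∈ Icc T (E.lit i m), E.pos t = E.pos T := fun t ht =>
    funext fun j => (hQ t ht j).1
  refine ⟨E.lit i m, hTlit, fun j => ?_, hpos _ ⟨hTlit.le, le_rfl⟩, funext fun j => ?_,
    fun t ht => ⟨hpos t ht, fun j hj => (hQ t ht j).2 fun h => absurd h hj⟩⟩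
  · by_cases hj : j = i
    · subst hj
      intro k k1 k2 t ht
      have hk : k = m := by
        have a1 := (E.look_strictMono j).lt_iff_lt.1 (k1.trans_le (E.lit_le_look j m))
        have a2 := (E.look_strictMono j).lt_iff_lt.1 (hlit.trans_le k2)
        omega
      subst hk
      have hmem := E.pos_mem_segment (hlit.le.trans ht.1) ht.2
      rw [hdest, hilook.1, segment_same] at hmem
      refine ⟨(show E.pos t j = E.pos T j from hmem).trans
        (hi _ hTlit.le le_rfl).1.symm, ?_⟩
      rw [E.light_after_lit ht.1 ht.2, E.light_after_lit le_rfl k2]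
    · exact (E.still hT (hst j) (fun k k1 k2 =>
        (hdec j k k2 (hQ _ ⟨k1, k2.le⟩)).trans (hothers j hj))).2 hTlit.le
  · by_cases hj : j = i
    · subst hj
      rw [Function.update_self, E.light_after_lit le_rfl (E.lit_le_look j m), hd]
      rfl
    · rw [Function.update_of_ne hj]
      exact (hQ _ ⟨hTlit.le, le_rfl⟩ j).2 fun h => absurd h hj

end Execution

/-! ### Snapshots in agreed coordinates -/

lemma unit_cast_cases (s : ℤˣ) : ((s : ℤ) : ℝ) = 1 ∨ ((s : ℤ) : ℝ) = -1 := by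
  rcases Int.units_eq_one_or s with rfl | rfl <;> simp

lemma unit_cast_mul_self (s : ℤˣ) : ((s : ℤ) : ℝ) * ((s : ℤ) : ℝ) = 1 := by
  rcases unit_cast_cases s with h | h <;> rw [h] <;> norm_num

@[simp] lemma orient_zero (s : ℤˣ) (x : Plane) : orient s x 0 = x 0 := by simp [orient]

@[simp] lemma orient_one (s : ℤˣ) (x : Plane) : orient s x 1 = ((s : ℤ) : ℝ) * x 1 := by
  simp [orient]

lemma orient_sub_self (s : ℤˣ) (x : Plane) : orient s (x - x) = 0 :=
  plane_ext (by simp) (by simp)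

@[simp] lemma agreedPoint_zero (L : Plane) (s : ℤˣ) (a : Plane) :
    agreedPoint L s a 0 = L 0 + a 0 := by simp [agreedPoint]

@[simp] lemma agreedPoint_one (L : Plane) (s : ℤˣ) (a : Plane) :
    agreedPoint L s a 1 = L 1 + ((s : ℤ) : ℝ) * (a 1 + 2) := by simp [agreedPoint]

lemma dist_agreedPoint (L : Plane) (s : ℤˣ) (a b : Plane) :
    dist (agreedPoint L s a) (agreedPoint L s b) = dist a b := by
  rw [← sq_eq_sq₀ dist_nonneg dist_nonneg, dist_sq, dist_sq]
  simp only [agreedPoint_zero, agreedPoint_one]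
  linear_combination (a 1 - b 1) ^ 2 * unit_cast_mul_self s

lemma agreedPoint_lineMap (L : Plane) (s : ℤˣ) (a b : Plane) (t : ℝ) :
    agreedPoint L s (AffineMap.lineMap a b t) =
      AffineMap.lineMap (agreedPoint L s a) (agreedPoint L s b) t := by
  refine plane_ext ?_ ?_ <;> simp only [agreedPoint_zero, agreedPoint_one, lineMap_coord] <;> ring

lemma agreedPoint_image_segment (L : Plane) (s : ℤˣ) (a b : Plane) :
    segment ℝ (agreedPoint L s a) (agreedPoint L s b) = agreedPoint L s '' segment ℝ a b := by
  ext w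
  rw [Set.mem_image, mem_segment_iff]
  constructor
  · rintro ⟨t, h0, h1, rfl⟩
    exact ⟨_, mem_segment_iff.2 ⟨t, h0, h1, rfl⟩, agreedPoint_lineMap ..⟩
  · rintro ⟨v, hv, rfl⟩
    obtain ⟨t, h0, h1, rfl⟩ := mem_segment_iff.1 hv
    exact ⟨t, h0, h1, agreedPoint_lineMap ..⟩

/-- The base point of the inverse change of coordinates. -/
noncomputable def inverseBase (L : Plane) (s : ℤˣ) : Plane :=
  pt (-L 0) (-(((s : ℤ) : ℝ) * L 1) - 2 - 2 * ((s : ℤ) : ℝ))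

lemma agreedPoint_inverse (L : Plane) (s : ℤˣ) (a : Plane) :
    agreedPoint (inverseBase L s) s (agreedPoint L s a) = a := by
  refine plane_ext (by simp [inverseBase]) ?_
  simp only [agreedPoint_one, inverseBase, pt_one]
  linear_combination (a 1 + 2) * unit_cast_mul_self s

lemma agreedPoint_inverse' (L : Plane) (s : ℤˣ) (a : Plane) :
    agreedPoint L s (agreedPoint (inverseBase L s) s a) = a := by
  refine plane_ext (by simp [inverseBase]) ?_
  simp only [agreedPoint_one, inverseBase, pt_one]
  linear_combination (a 1 - L 1) * unit_cast_mul_self s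

section Views

variable {n : ℕ} {q : Fin n → Plane} {c : Fin n → Color} {ε : ℤˣ} {i : Fin n}

lemma Sees.agreed {j : Fin n} (L : Plane) (s : ℤˣ) (h : Sees q i j) :
    Sees (fun k => agreedPoint L s (q k)) i j := by
  obtain ⟨x, hx, y, hy, h⟩ := h
  refine ⟨agreedPoint L s x, ?_, agreedPoint L s y, ?_, fun k h1 h2 => ?_⟩
  · rwa [Metric.mem_sphere, dist_agreedPoint]
  · rwa [Metric.mem_sphere, dist_agreedPoint]
  · rw [agreedPoint_image_segment, Set.disjoint_left]
    rintro _ ⟨w, hw, rfl⟩ hwk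
    rw [Metric.mem_closedBall, dist_agreedPoint] at hwk
    exact Set.disjoint_left.1 (h k h1 h2) hw hwk

lemma sees_agreed_iff {j : Fin n} (L : Plane) (s : ℤˣ) :
    Sees (fun k => agreedPoint L s (q k)) i j ↔ Sees q i j := by
  refine ⟨fun h => ?_, Sees.agreed L s⟩
  have := h.agreed (inverseBase L s) s
  simpa only [agreedPoint_inverse] using this

/-- Snapshots can be computed in agreed coordinates. -/
lemma snapshot_agreed (L : Plane) (s t : ℤˣ) :
    snapshot (fun j => agreedPoint L s (q j)) c t i = snapshot q c (t * s) i := by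
  have : ∀ j, orient t (agreedPoint L s (q j) - agreedPoint L s (q i)) =
      orient (t * s) (q j - q i) := by
    intro j
    refine plane_ext (by simp) ?_
    simp only [orient_one, PiLp.sub_apply, agreedPoint_one, Units.val_mul, Int.cast_mul]
    ring
  simp only [snapshot, sees_agreed_iff, this]

lemma mem_seen {x : Plane × Color} : x ∈ (snapshot q c ε i).seen ↔
    ∃ j, j ≠ i ∧ Sees q i j ∧ x = (orient ε (q j - q i), c j) := Iff.rfl

lemma mem_robots {x : Plane × Color} : x ∈ (snapshot q c ε i).robots ↔
    ∃ j, (j = i ∨ (j ≠ i ∧ Sees q i j)) ∧ x = (orient ε (q j - q i), c j) := by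
  simp only [View.robots, Set.mem_insert_iff, mem_seen]
  constructor
  · rintro (rfl | ⟨j, h1, h2, rfl⟩)
    · exact ⟨i, Or.inl rfl, by rw [orient_sub_self]; rfl⟩
    · exact ⟨j, Or.inr ⟨h1, h2⟩, rfl⟩
  · rintro ⟨j, rfl | ⟨h1, h2⟩, rfl⟩
    · left; rw [orient_sub_self]; rfl
    · exact Or.inr ⟨j, h1, h2, rfl⟩

/-- The agreed upward direction is recognized if some robot above the line at height `y` is
visible and none is below it. -/
lemma upSign_eq {y : ℝ} (hall : ∀ j, y ≤ q j 1)
    (hex : ∃ j, (j = i ∨ (j ≠ i ∧ Sees q i j)) ∧ y < q j 1) :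
    upSign (snapshot q c ε i) (((ε : ℤ) : ℝ) * (y - q i 1)) = ((ε : ℤ) : ℝ) := by
  obtain ⟨j, hj, hlt⟩ := hex
  have hmem : (orient ε (q j - q i), c j) ∈ (snapshot q c ε i).robots :=
    mem_robots.2 ⟨j, hj, rfl⟩
  unfold upSign
  rcases unit_cast_cases ε with h | h <;> simp only [h]
  · rw [if_neg]
    rintro ⟨-, hno⟩
    refine hno ⟨_, hmem, ?_⟩
    simp only [orient_one, PiLp.sub_apply, h]
    linarith
  · rw [if_pos]
    refine ⟨⟨_, hmem, ?_⟩, ?_⟩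
    · simp only [orient_one, PiLp.sub_apply, h]
      linarith
    · rintro ⟨x, hx, hlt'⟩
      obtain ⟨k, -, rfl⟩ := mem_robots.1 hx
      simp only [orient_one, PiLp.sub_apply, h] at hlt'
      have := hall k
      linarith

/-- If all visible robots are on the line, then the own upward direction is taken. -/
lemma upSign_flat {y : ℝ} (h : ∀ j, (j = i ∨ (j ≠ i ∧ Sees q i j)) → q j 1 = y) :
    upSign (snapshot q c ε i) (((ε : ℤ) : ℝ) * (y - q i 1)) = 1 := by
  unfold upSign
  rw [if_neg]
  rintro ⟨⟨x, hx, hlt⟩, -⟩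
  obtain ⟨k, hk, rfl⟩ := mem_robots.1 hx
  simp only [orient_one, PiLp.sub_apply, h k hk, lt_self_iff_false] at hlt

/-- The coordinate system of robot `i` in which the robot at `b` has the coordinates `b`. -/
noncomputable def frameAt (q : Fin n → Plane) (ε : ℤˣ) (i : Fin n) (b : Plane) : Frame :=
  ⟨orient ε (b - q i), b, ((ε : ℤ) : ℝ)⟩

lemma frameAt_toAgreed (b x : Plane) :
    (frameAt q ε i b).toAgreed (orient ε (x - q i)) = x := by
  refine plane_ext (by simp [frameAt, Frame.toAgreed]) ?_
  simp only [frameAt, Frame.toAgreed, pt_one, orient_one, PiLp.sub_apply]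
  linear_combination (x 1 - b 1) * unit_cast_mul_self ε

lemma frameAt_toAgreed_zero (b : Plane) : (frameAt q ε i b).toAgreed 0 = q i := by
  rw [← orient_sub_self ε (q i), frameAt_toAgreed]

lemma frameAt_toLocal (b a : Plane) :
    (frameAt q ε i b).toLocal a = orient ε (a - q i) := by
  refine plane_ext (by simp [frameAt, Frame.toLocal]) ?_
  simp only [frameAt, Frame.toLocal, pt_one, orient_one, PiLp.sub_apply]
  ring

lemma nextStop_congr {O O' : Set Plane} {m a : Plane} (h : FreeRoute O m a ↔ FreeRoute O' m a) :
    nextStop O m a = nextStop O' m a := by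
  unfold nextStop
  by_cases h' : FreeRoute O m a
  · rw [if_pos h', if_pos (h.1 h')]
  · rw [if_neg h', if_neg (mt h.2 h')]

/-- The positions of all robots but `i`. -/
def others (q : Fin n → Plane) (i : Fin n) : Set Plane := {z | ∃ j, j ≠ i ∧ z = q j}

/-- The decision of robot `i` to take the next step on the way to `a`, keeping its light. -/
noncomputable def stepTo (q : Fin n → Plane) (c : Fin n → Color) (ε : ℤˣ) (i : Fin n) (a : Plane) :
    Decision :=
  ⟨c i, orient ε (nextStop (others q i) (q i) a - q i)⟩

/-- The invisible robots do not matter for the choice of the route. -/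
lemma moveTo_frameAt (hq : NonOverlapping q) (b a : Plane) :
    moveTo (frameAt q ε i b) (snapshot q c ε i) a = stepTo q c ε i a := by
  have hfree : FreeRoute {z | ∃ x ∈ (snapshot q c ε i).seen, z = (frameAt q ε i b).toAgreed x.1}
      (q i) a ↔ FreeRoute (others q i) (q i) a := by
    constructor
    · intro h z hz w hw
      obtain ⟨j, hj, rfl⟩ := hz
      refine freeRoute_of_visible hq (fun k hk hs w hw => h _ ?_ w hw) j hj w hw
      exact ⟨_, ⟨k, hk, hs, rfl⟩, (frameAt_toAgreed b _).symm⟩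
    · intro h z hz w hw
      obtain ⟨x, ⟨j, hj, -, rfl⟩, rfl⟩ := hz
      rw [frameAt_toAgreed]
      exact h _ ⟨j, hj, rfl⟩ w hw
  rw [moveTo, frameAt_toAgreed_zero, frameAt_toLocal, stepTo, nextStop_congr hfree]
  rfl

lemma finishAt_frameAt (hq : NonOverlapping q) (b a : Plane) :
    (q i = a → finishAt (frameAt q ε i b) (snapshot q c ε i) a = recolor Color.done) ∧
    (q i ≠ a → finishAt (frameAt q ε i b) (snapshot q c ε i) a = stepTo q c ε i a) := by
  unfold finishAt
  rw [frameAt_toAgreed_zero]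
  exact ⟨fun h => if_pos h, fun h => (if_neg h).trans (moveTo_frameAt hq b a)⟩

end Views

/-! ### Robots that do nothing -/

/-- A configuration of stage 2 in agreed coordinates: the robot `l` with light `leader` is at
`(0,-2)`, all other lights are `off` or `done`, and no robot is below the leader's line. -/
structure Arrangement {n : ℕ} (q : Fin n → Plane) (c : Fin n → Color) (l : Fin n) : Prop where
  disks : NonOverlapping q
  leader_pos : q l = pt 0 (-2)
  leader_light : c l = Color.leader
  light : ∀ j, j ≠ l → c j = Color.off ∨ c j = Color.done
  above : ∀ j, -2 ≤ q j 1

section Decisions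

variable {n : ℕ} {P : Fin n → Plane} {phase2 becomeLeader : View → Decision}
  {q : Fin n → Plane} {c : Fin n → Color} {ε : ℤˣ} {i l : Fin n}

/-- If the only lights are `off`, `leader` and `done`, nobody enters phase 2 of the leader
election. -/
lemma not_entersPhase2
    (hc : ∀ j, c j = Color.off ∨ c j = Color.leader ∨ c j = Color.done) :
    ¬ EntersPhase2 n (snapshot q c ε i) := by
  rintro (⟨⟨a, -, -, ha, -, hat, -⟩, -⟩ | ⟨x, hx, h⟩)
  · obtain ⟨j, -, rfl⟩ := mem_robots.1 ha.1
    rcases hc j with h | h | h <;> simp [h] at hat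
  · obtain ⟨j, -, rfl⟩ := mem_robots.1 hx
    rcases hc j with h' | h' | h' <;> simp [h'] at h

/-- A robot with light `done` does nothing. -/
lemma stays_of_done (hi : c i = Color.done)
    (hc : ∀ j, c j = Color.off ∨ c j = Color.leader ∨ c j = Color.done) :
    patternFormation P phase2 becomeLeader (snapshot q c ε i) = ⟨c i, 0⟩ := by
  have hv : (snapshot q c ε i).light = Color.done := hi
  unfold patternFormation
  split_ifs with h1 h2
  · simp only [stage2, hv, stay]; rw [hi]
  · exact absurd h2 (not_entersPhase2 hc)
  · simp only [phase1, hv, stay]; rw [hi]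

/-- A robot with light `off` that does not see the leader does nothing, provided that it sees a
robot to its left: this keeps it from executing the first part of the leader election. -/
lemma stays_of_not_sees_leader (hi : c i = Color.off)
    (hc : ∀ j, c j = Color.off ∨ c j = Color.leader ∨ c j = Color.done)
    (hl : ∀ j, j ≠ i → Sees q i j → c j ≠ Color.leader)
    (hleft : ∃ j, j ≠ i ∧ 0 < q i 0 - q j 0 ∧ Sees q i j) :
    patternFormation P phase2 becomeLeader (snapshot q c ε i) = ⟨c i, 0⟩ := by
  have hv : (snapshot q c ε i).light = Color.off := hi
  have h1 : ¬ ∃ x ∈ (snapshot q c ε i).robots, x.2 = Color.leader := by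
    rintro ⟨x, hx, h⟩
    obtain ⟨j, rfl | ⟨hj, hs⟩, rfl⟩ := mem_robots.1 hx
    · rw [hi] at h; cases h
    · exact hl j hj hs h
  have h2 : ¬ InFirstBatch (snapshot q c ε i) := by
    obtain ⟨j, hj, hlt, hs⟩ := hleft
    intro h
    have := h _ (mem_seen.2 ⟨j, hj, hs, rfl⟩)
    simp only [orient_zero, PiLp.sub_apply] at this
    linarith
  have h3 : ¬ OnMyVertical (snapshot q c ε i) Color.interior := by
    rintro ⟨x, hx, -, h⟩
    obtain ⟨j, -, -, rfl⟩ := mem_seen.1 hx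
    rcases hc j with h' | h' | h' <;> simp [h'] at h
  unfold patternFormation
  rw [if_neg h1, if_neg (not_entersPhase2 hc)]
  simp only [phase1, hv, h2, h3, false_and, if_false, stay]
  rw [hi]

namespace Arrangement

lemma calm (A : Arrangement q c l) (j : Fin n) :
    c j = Color.off ∨ c j = Color.leader ∨ c j = Color.done := by
  by_cases hj : j = l
  · subst hj; exact Or.inr (Or.inl A.leader_light)
  · rcases A.light j hj with h | h
    · exact Or.inl h
    · exact Or.inr (Or.inr h)

lemma eq_leader (A : Arrangement q c l) {j : Fin n} (h : c j = Color.leader) : j = l := by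
  by_contra hj
  rcases A.light j hj with h' | h' <;> rw [h'] at h <;> cases h

lemma off_ne_leader (A : Arrangement q c l) (hi : c i = Color.off) : i ≠ l := by
  rintro rfl
  rw [A.leader_light] at hi; cases hi

lemma stays_unseeing (A : Arrangement q c l) (hi : c i = Color.off) (hleft : 0 < q i 0)
    (hns : ¬ Sees q i l) :
    patternFormation P phase2 becomeLeader (snapshot q c ε i) = ⟨c i, 0⟩ := by
  refine stays_of_not_sees_leader hi A.calm (fun j _ hs hj => hns (A.eq_leader hj ▸ hs)) ?_
  have := exists_sees_in_direction A.disks (i := i) (m := l) (-1) 0 (by norm_num)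
    (by rw [A.leader_pos]; simpa using hleft)
  simpa using this

/-- A robot that sees the leader executes stage 2. -/
lemma stage2_of_sees (A : Arrangement q c l) (hil : i ≠ l) (hs : Sees q i l) :
    patternFormation P phase2 becomeLeader (snapshot q c ε i) =
      stage2 P (snapshot q c ε i) :=
  if_pos ⟨_, mem_robots.2 ⟨l, Or.inr ⟨hil.symm, hs⟩, rfl⟩, A.leader_light⟩

lemma leaderPos_eq (A : Arrangement q c l) (hil : i ≠ l) (hs : Sees q i l) :
    leaderPos (snapshot q c ε i) = orient ε (q l - q i) := by
  have hex : ∃ x, (x, Color.leader) ∈ (snapshot q c ε i).seen :=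
    ⟨_, mem_seen.2 ⟨l, hil.symm, hs, by rw [A.leader_light]⟩⟩
  obtain ⟨j, -, -, h⟩ := mem_seen.1 (Classical.epsilon_spec hex)
  rw [Prod.mk.injEq] at h
  have hj := A.eq_leader h.2.symm
  subst hj
  exact h.1

/-- A robot that sees the leader recovers the agreed coordinates if it also sees a robot above the
leader's line (possibly itself), or if its own upward direction is the agreed one. -/
lemma frameOf_eq (A : Arrangement q c l) (hil : i ≠ l) (hs : Sees q i l)
    (hup : (∃ j, (j = i ∨ (j ≠ i ∧ Sees q i j)) ∧ -2 < q j 1) ∨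
      (ε = 1 ∧ ∀ j, (j = i ∨ (j ≠ i ∧ Sees q i j)) → q j 1 = -2)) :
    frameOf (snapshot q c ε i) = frameAt q ε i (pt 0 (-2)) := by
  have hu : upSign (snapshot q c ε i) (((ε : ℤ) : ℝ) * (-2 - q i 1)) = ((ε : ℤ) : ℝ) := by
    rcases hup with h | ⟨h1, h2⟩
    · exact upSign_eq A.above h
    · rw [upSign_flat h2, h1]; simp
  rw [frameOf, A.leaderPos_eq hil hs, A.leader_pos, frameAt]
  simp only [orient_one, PiLp.sub_apply, pt_one, hu]

/-- A robot on the leader's line that sees a robot with light `off` above the line does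
nothing. -/
lemma stays_on_line (A : Arrangement q c l) (hi : c i = Color.off) (hi1 : q i 1 = -2)
    (hleft : 0 < q i 0) (hm : ∃ m, Sees q i m ∧ c m = Color.off ∧ -2 < q m 1) :
    patternFormation P phase2 becomeLeader (snapshot q c ε i) = ⟨c i, 0⟩ := by
  by_cases hs : Sees q i l
  swap
  · exact A.stays_unseeing hi hleft hs
  obtain ⟨m, hsm, hcm, hm1⟩ := hm
  have hmi : m ≠ i := by rintro rfl; linarith
  have hil := A.off_ne_leader hi
  have hv : (snapshot q c ε i).light = Color.off := hi
  have hF := A.frameOf_eq (ε := ε) hil hs (Or.inl ⟨m, Or.inr ⟨hmi, hsm⟩, hm1⟩)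
  rw [A.stage2_of_sees hil hs]
  simp only [stage2, hv, stage2Off]
  rw [if_neg, if_neg]
  · simp only [stay, hv, hi]
  · rintro ⟨-, h⟩
    refine h _ (mem_seen.2 ⟨m, hmi, hsm, rfl⟩) ?_ hcm
    rwa [hF, frameAt_toAgreed]
  · rintro ⟨h, -⟩
    rw [hF, frameAt_toAgreed_zero] at h
    linarith

/-- A robot above the leader's line does nothing if it is not its turn. -/
lemma stays_above (A : Arrangement q c l) (hi : c i = Color.off) (hi1 : 0 ≤ q i 1)
    (hleft : 0 < q i 0)
    (hm : ∃ m, -2 < q m 1 ∧ (q m 1 < q i 1 ∨ (q m 1 = q i 1 ∧ q m 0 < q i 0))) :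
    patternFormation P phase2 becomeLeader (snapshot q c ε i) = ⟨c i, 0⟩ := by
  by_cases hs : Sees q i l
  swap
  · exact A.stays_unseeing hi hleft hs
  obtain ⟨m, hm1, hm⟩ := hm
  obtain ⟨k, hki, ⟨hk1, hk⟩, hsk⟩ := exists_sees_preceding A.disks hi1 hm1 hm
  have hil := A.off_ne_leader hi
  have hv : (snapshot q c ε i).light = Color.off := hi
  have hF := A.frameOf_eq (ε := ε) hil hs (Or.inl ⟨k, Or.inr ⟨hki, hsk⟩, hk1⟩)
  rw [A.stage2_of_sees hil hs]
  simp only [stage2, hv, stage2Off]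
  rw [if_neg, if_neg]
  · simp only [stay, hv, hi]
  · rintro ⟨h, -⟩
    rw [hF, frameAt_toAgreed_zero] at h
    linarith
  · rintro ⟨-, h1, h2⟩
    have h1 := h1 _ (mem_seen.2 ⟨k, hki, hsk, rfl⟩)
    have h2 := h2 _ (mem_seen.2 ⟨k, hki, hsk, rfl⟩)
    rw [hF, frameAt_toAgreed, frameAt_toAgreed_zero] at h1 h2
    rcases hk with hk | hk
    · exact h1 ⟨hk1, hk⟩
    · linarith [h2 hk.1]

/-- The leader does nothing as long as it sees a robot with light `off`. -/
lemma stays_leader (A : Arrangement q c l) (hm : ∃ m, Sees q l m ∧ c m = Color.off) :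
    patternFormation P phase2 becomeLeader (snapshot q c ε l) = ⟨c l, 0⟩ := by
  obtain ⟨m, hsm, hcm⟩ := hm
  have hv : (snapshot q c ε l).light = Color.leader := A.leader_light
  have hml := A.off_ne_leader hcm
  unfold patternFormation
  rw [if_pos ⟨_, mem_robots.2 ⟨l, Or.inl rfl, rfl⟩, A.leader_light⟩]
  simp only [stage2, hv, stage2Leader]
  rw [if_neg]
  · simp only [stay, hv, A.leader_light]
  · intro h
    exact h _ (mem_seen.2 ⟨m, hml, hsm, rfl⟩) hcm

end Arrangement
end Decisions

/-! ### The robot whose turn it is -/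

/-- The points `(a,-2), ..., (b,-2)` of the leader's line. -/
def linePoints (a b : ℕ) : Set Plane := {z | ∃ k : ℕ, a ≤ k ∧ k ≤ b ∧ z = pt k (-2)}

lemma linePoints_def (a b : ℕ) :
    linePoints a b = {z | ∃ k : ℕ, a ≤ k ∧ k ≤ b ∧ z = pt k (-2)} := rfl

lemma linePoints_injective : Function.Injective fun k : ℕ => pt (k : ℝ) (-2) := by
  intro a b h
  have := congrArg (fun z : Plane => z 0) h
  simpa using this

lemma ncard_linePoints (a b : ℕ) : (linePoints a b).ncard = b + 1 - a := by
  have : linePoints a b = (fun k : ℕ => pt (k : ℝ) (-2)) '' (Finset.Icc a b : Finset ℕ) := by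
    ext z
    simp only [linePoints, Set.mem_ofPred_eq, Set.mem_image, Finset.coe_Icc, Set.mem_Icc]
    constructor
    · rintro ⟨k, h1, h2, rfl⟩; exact ⟨k, ⟨h1, h2⟩, rfl⟩
    · rintro ⟨k, ⟨h1, h2⟩, rfl⟩; exact ⟨k, h1, h2, rfl⟩
  rw [this, Set.ncard_image_of_injective _ linePoints_injective, Set.ncard_coe_finset,
    Nat.card_Icc]

lemma linePoints_eq_empty {a b : ℕ} (h : b < a) : linePoints a b = ∅ := by
  ext z
  simp only [linePoints, Set.mem_ofPred_eq, Set.mem_empty_iff_false, iff_false]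
  rintro ⟨k, h1, h2, -⟩; omega

lemma linePoints_ne_empty {a b : ℕ} (h : a ≤ b) : linePoints a b ≠ ∅ :=
  Set.Nonempty.ne_empty ⟨_, a, le_rfl, h, rfl⟩

/-- The positions on the leader's line of the robots other than the leader and robot `i`. -/
def lineOthers {n : ℕ} (q : Fin n → Plane) (i : Fin n) : Set Plane :=
  {z | (∃ j, j ≠ i ∧ z = q j) ∧ z 1 = -2 ∧ z ≠ pt 0 (-2)}

namespace Arrangement

variable {n : ℕ} {P : Fin n → Plane} {phase2 becomeLeader : View → Decision}
  {q : Fin n → Plane} {c : Fin n → Color} {ε : ℤˣ} {i l : Fin n}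

lemma sees_leader (A : Arrangement q c l) (hi1 : -2 < q i 1) (hH : Hanging q i) :
    i ≠ l ∧ Sees q i l := by
  have hl : q l 1 = -2 := by rw [A.leader_pos]; simp
  exact ⟨by rintro rfl; linarith, (sees_of_hanging A.disks hl hi1 hH).symm⟩

lemma lineRobots_eq (A : Arrangement q c l) (hi1 : -2 < q i 1) (hH : Hanging q i) (b : Plane) :
    lineRobots (frameAt q ε i b) (snapshot q c ε i) = lineOthers q i := by
  ext z
  constructor
  · rintro ⟨⟨x, hx, rfl⟩, h1, h2⟩
    obtain ⟨j, hj, -, rfl⟩ := mem_seen.1 hx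
    rw [frameAt_toAgreed] at h1 h2 ⊢
    exact ⟨⟨j, hj, rfl⟩, h1, h2⟩
  · rintro ⟨⟨j, hj, rfl⟩, h1, h2⟩
    exact ⟨⟨_, mem_seen.2 ⟨j, hj, (sees_of_hanging A.disks h1 hi1 hH).symm, rfl⟩,
      (frameAt_toAgreed b _).symm⟩, h1, h2⟩

lemma myTurn (hi1 : -2 < q i 1) (hH : Hanging q i)
    (hlex : ∀ k, k ≠ i → q k 1 = q i 1 → q i 0 ≤ q k 0) (b : Plane) :
    MyTurn (frameAt q ε i b) (snapshot q c ε i) := by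
  refine ⟨by rwa [frameAt_toAgreed_zero], ?_, ?_⟩
  · intro x hx
    obtain ⟨j, hj, -, rfl⟩ := mem_seen.1 hx
    rw [frameAt_toAgreed, frameAt_toAgreed_zero]
    rintro ⟨h1, h2⟩
    rcases hH j hj with h | h <;> linarith [h]
  · intro x hx
    obtain ⟨j, hj, -, rfl⟩ := mem_seen.1 hx
    rw [frameAt_toAgreed, frameAt_toAgreed_zero]
    exact hlex j hj

/-- While the points `(1,-2), ..., (k,-2)` are occupied and nobody is done, the lowest leftmost
robot above the leader's line moves to `(k+1,-2)`. -/
lemma steps_to_line (A : Arrangement q c l) (hi : c i = Color.off) (hi1 : -2 < q i 1)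
    (hH : Hanging q i) (hlex : ∀ k, k ≠ i → q k 1 = q i 1 → q i 0 ≤ q k 0)
    (hoff : ∀ j, c j ≠ Color.done) {k : ℕ} (hline : lineOthers q i = linePoints 1 k) :
    patternFormation P phase2 becomeLeader (snapshot q c ε i) =
      stepTo q c ε i (pt (k + 1) (-2)) := by
  obtain ⟨hil, hs⟩ := A.sees_leader hi1 hH
  have hF := A.frameOf_eq (ε := ε) hil hs (Or.inl ⟨i, Or.inl rfl, hi1⟩)
  have hL : lineRobots (frameAt q ε i (pt 0 (-2))) (snapshot q c ε i) = linePoints 1 k :=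
    (A.lineRobots_eq hi1 hH _).trans hline
  have hv : (snapshot q c ε i).light = Color.off := hi
  rw [A.stage2_of_sees hil hs]
  simp only [stage2, hv, stage2Off, hF, hL]
  rw [if_pos (hF.symm ▸ myTurn hi1 hH hlex _)]
  rcases Nat.eq_zero_or_pos k with rfl | hk
  · rw [if_pos (linePoints_eq_empty one_pos), if_neg, moveTo_frameAt A.disks]
    · simp
    · rintro ⟨x, hx, h⟩
      obtain ⟨j, -, -, rfl⟩ := mem_seen.1 hx
      exact hoff j h
  · have hcard : (linePoints 1 k).ncard = k := by rw [ncard_linePoints]; omega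
    rw [if_neg (linePoints_ne_empty hk), hcard, if_pos (linePoints_def 1 k), moveTo_frameAt A.disks]

/-- When the points `(j+1,-2), ..., (n-1,-2)` are occupied, a robot on its way from `(j,-2)` moves
on to `t_{j-1}`. -/
lemma steps_to_target (A : Arrangement q c l) (hi : c i = Color.off) (hi1 : -2 < q i 1)
    (hH : Hanging q i) (hlex : ∀ k, k ≠ i → q k 1 = q i 1 → q i 0 ≤ q k 0) {j : ℕ} (hj : 1 ≤ j)
    (hjn : j < n) (hline : lineOthers q i = linePoints (j + 1) (n - 1))
    (hdone : j + 1 = n → ∃ m, m ≠ i ∧ Sees q i m ∧ c m = Color.done) :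
    (q i = target P (j - 1) → patternFormation P phase2 becomeLeader (snapshot q c ε i) =
      recolor Color.done) ∧
    (q i ≠ target P (j - 1) → patternFormation P phase2 becomeLeader (snapshot q c ε i) =
      stepTo q c ε i (target P (j - 1))) := by
  obtain ⟨hil, hs⟩ := A.sees_leader hi1 hH
  have hF := A.frameOf_eq (ε := ε) hil hs (Or.inl ⟨i, Or.inl rfl, hi1⟩)
  have hL : lineRobots (frameAt q ε i (pt 0 (-2))) (snapshot q c ε i) =
      linePoints (j + 1) (n - 1) := (A.lineRobots_eq hi1 hH _).trans hline
  have hv : (snapshot q c ε i).light = Color.off := hi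
  have main : patternFormation P phase2 becomeLeader (snapshot q c ε i) =
      finishAt (frameAt q ε i (pt 0 (-2))) (snapshot q c ε i) (target P (j - 1)) := by
    rw [A.stage2_of_sees hil hs]
    simp only [stage2, hv, stage2Off, hF, hL]
    rw [if_pos (hF.symm ▸ myTurn hi1 hH hlex _)]
    rcases Nat.lt_or_ge (j + 1) n with hlt | hge
    · have hcard : (linePoints (j + 1) (n - 1)).ncard = n - (j + 1) := by
        rw [ncard_linePoints]; omega
      have e1 : n - (n - (j + 1)) = j + 1 := by omega
      have e2 : j + 1 - 2 = j - 1 := by omega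
      rw [if_neg (linePoints_ne_empty (by omega)), hcard, if_neg, e1, if_pos (linePoints_def _ _), e2]
      -- the point `(1,-2)` is not occupied
      intro h
      have : pt ((1 : ℕ) : ℝ) (-2) ∈ linePoints (j + 1) (n - 1) := by
        rw [h]; exact ⟨1, le_rfl, by omega, rfl⟩
      obtain ⟨k, h1, -, h2⟩ := this
      have := linePoints_injective h2
      omega
    · obtain ⟨m, hm, hsm, hcm⟩ := hdone (by omega)
      have e : n - 2 = j - 1 := by omega
      rw [if_pos (linePoints_eq_empty (by omega)), if_pos ⟨_, mem_seen.2 ⟨m, hm, hsm, rfl⟩, hcm⟩,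
        e]
  rw [main]
  exact finishAt_frameAt A.disks _ _

/-- A robot at `(j,-2)` that sees the leader and no robot with light `off` above the line moves to
`t_{j-1}`. -/
lemma steps_from_line (A : Arrangement q c l) (hi : c i = Color.off) {j : ℕ} (hj : 1 ≤ j)
    (hij : q i = pt j (-2)) (hs : Sees q i l) (hdone : ∀ k, -2 < q k 1 → c k = Color.done)
    (hup : (∃ k, (k = i ∨ (k ≠ i ∧ Sees q i k)) ∧ -2 < q k 1) ∨
      (ε = 1 ∧ ∀ k, (k = i ∨ (k ≠ i ∧ Sees q i k)) → q k 1 = -2)) :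
    patternFormation P phase2 becomeLeader (snapshot q c ε i) =
      stepTo q c ε i (target P (j - 1)) := by
  have hil := A.off_ne_leader hi
  have hF := A.frameOf_eq (ε := ε) hil hs hup
  have hv : (snapshot q c ε i).light = Color.off := hi
  have e0 : (frameAt q ε i (pt 0 (-2))).toAgreed 0 0 = j := by
    rw [frameAt_toAgreed_zero, hij, pt_zero]
  have e1 : (frameAt q ε i (pt 0 (-2))).toAgreed 0 1 = -2 := by
    rw [frameAt_toAgreed_zero, hij, pt_one]
  rw [A.stage2_of_sees hil hs]
  simp only [stage2, hv, stage2Off, hF]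
  rw [if_neg, if_pos, if_pos, e0, Nat.floor_natCast, moveTo_frameAt A.disks]
  · rw [e0, Nat.floor_natCast]; exact ⟨hj, rfl⟩
  · refine ⟨by rw [hF, e1], fun x hx h => ?_⟩
    obtain ⟨k, -, -, rfl⟩ := mem_seen.1 hx
    rw [hF, frameAt_toAgreed] at h
    have hk := hdone k h
    show c k ≠ Color.off
    rw [hk]
    exact fun h => by cases h
  · rintro ⟨h, -⟩
    rw [hF, e1] at h
    linarith

end Arrangement

section Leader

variable {n : ℕ} {P : Fin n → Plane} {phase2 becomeLeader : View → Decision}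
  {q : Fin n → Plane} {c : Fin n → Color} {ε : ℤˣ} {i l w : Fin n}

lemma lowestLeftmost_eq {up : ℝ} (hw : w ≠ i) (hs : Sees q i w)
    (h : ∀ k, k ≠ i → Sees q i k →
      up * (((ε : ℤ) : ℝ) * (q w 1 - q i 1)) < up * (((ε : ℤ) : ℝ) * (q k 1 - q i 1)) ∨
        (q w 1 = q k 1 ∧ q w 0 ≤ q k 0)) :
    lowestLeftmost (snapshot q c ε i) up = orient ε (q w - q i) := by
  have hex : ∃ x, (∃ b, (x, b) ∈ (snapshot q c ε i).seen) ∧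
      ∀ y ∈ (snapshot q c ε i).seen, up * x 1 < up * y.1 1 ∨ (x 1 = y.1 1 ∧ x 0 ≤ y.1 0) := by
    refine ⟨orient ε (q w - q i), ⟨c w, mem_seen.2 ⟨w, hw, hs, rfl⟩⟩, fun y hy => ?_⟩
    obtain ⟨k, hk, hsk, rfl⟩ := mem_seen.1 hy
    simp only [orient_zero, orient_one, PiLp.sub_apply]
    rcases h k hk hsk with h | ⟨h1, h2⟩
    · exact Or.inl h
    · exact Or.inr ⟨by rw [h1], by linarith⟩
  obtain ⟨⟨b, hb⟩, hmin⟩ := Classical.epsilon_spec hex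
  change lowestLeftmost (snapshot q c ε i) up = _
  obtain ⟨k, hk, hsk, hkx⟩ := mem_seen.1 hb
  rw [Prod.mk.injEq] at hkx
  have hx : lowestLeftmost (snapshot q c ε i) up = orient ε (q k - q i) := hkx.1
  have hm : up * (lowestLeftmost (snapshot q c ε i) up) 1 < up * (orient ε (q w - q i)) 1 ∨
      ((lowestLeftmost (snapshot q c ε i) up) 1 = (orient ε (q w - q i)) 1 ∧
        (lowestLeftmost (snapshot q c ε i) up) 0 ≤ (orient ε (q w - q i)) 0) :=
    hmin _ (mem_seen.2 ⟨w, hw, hs, rfl⟩)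
  rw [hx] at hm ⊢
  simp only [orient_zero, orient_one, PiLp.sub_apply] at hm
  rcases h k hk hsk with h1 | ⟨h1, h2⟩ <;> rcases hm with h3 | ⟨h3, h4⟩
  · exact absurd h1 (not_lt.2 h3.le)
  · rw [h3] at h1; exact absurd h1 (lt_irrefl _)
  · rw [h1] at h3; exact absurd h3 (lt_irrefl _)
  · exact plane_ext (by simp; linarith) (by simp [h1])

/-- When all other robots are done, the leader moves to the last target point, recovering the
agreed coordinates from the robot at `t_{n-2}`. -/
lemma leader_steps (hq : NonOverlapping q) (hl : c l = Color.leader)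
    (hdone : ∀ k, k ≠ l → c k = Color.done) (hwl : w ≠ l) (hw : q w = target P (n - 2))
    (hlow : ∀ k, k ≠ l → k ≠ w → q w 1 < q k 1 ∨ (q w 1 = q k 1 ∧ q w 0 ≤ q k 0))
    (hlw : q l 1 < q w 1 ∨ (q l 1 = q w 1 ∧ q l 0 ≤ q w 0))
    (hfin : q l 1 < q w 1 ∨ q l = target P (n - 1)) :
    (q l = target P (n - 1) → patternFormation P phase2 becomeLeader (snapshot q c ε l) =
      recolor Color.done) ∧
    (q l ≠ target P (n - 1) → patternFormation P phase2 becomeLeader (snapshot q c ε l) =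
      stepTo q c ε l (target P (n - 1))) := by
  have hsw : Sees q l w := sees_of_lowest hq hwl.symm hlw hlow
  have hv : (snapshot q c ε l).light = Color.leader := hl
  have main : patternFormation P phase2 becomeLeader (snapshot q c ε l) =
      finishAt (leaderFrame P (snapshot q c ε l)) (snapshot q c ε l) (target P (n - 1)) := by
    unfold patternFormation
    rw [if_pos ⟨_, mem_robots.2 ⟨l, Or.inl rfl, rfl⟩, hl⟩]
    simp only [stage2, hv, stage2Leader]
    rw [if_pos]
    intro x hx
    obtain ⟨k, hk, -, rfl⟩ := mem_seen.1 hx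
    show c k ≠ Color.off
    rw [hdone k hk]
    exact fun h => by cases h
  have hlow' : ∀ k, k ≠ l → q w 1 < q k 1 ∨ (q w 1 = q k 1 ∧ q w 0 ≤ q k 0) := by
    intro k hk
    by_cases hkw : k = w
    · subst hkw; exact Or.inr ⟨rfl, le_rfl⟩
    · exact hlow k hk hkw
  have hle : q l 1 ≤ q w 1 := by rcases hlw with h | h <;> linarith [h]
  have hall : ∀ k, q l 1 ≤ q k 1 := by
    intro k
    by_cases hk : k = l
    · rw [hk]
    · rcases hlow' k hk with h | h <;> linarith [h]
  have hzero : (0 : ℝ) = ((ε : ℤ) : ℝ) * (q l 1 - q l 1) := by ring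
  rw [main]
  by_cases hup : ∃ k, (k = l ∨ (k ≠ l ∧ Sees q l k)) ∧ q l 1 < q k 1
  · have hu : upSign (snapshot q c ε l) 0 = ((ε : ℤ) : ℝ) := by
      rw [hzero]; exact upSign_eq hall hup
    have hF : leaderFrame P (snapshot q c ε l) = frameAt q ε l (q w) := by
      rw [leaderFrame, hu, lowestLeftmost_eq hwl hsw, ← hw]
      · rfl
      · intro k hk _
        rw [← mul_assoc, ← mul_assoc, unit_cast_mul_self, one_mul, one_mul]
        rcases hlow' k hk with h | h
        · exact Or.inl (by linarith)
        · exact Or.inr h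
    rw [hF]
    exact finishAt_frameAt hq _ _
  · -- all visible robots are at the height of the leader, so the leader is at its target; the
    -- orientation is not determined by the snapshot, but it does not matter
    have hflat : ∀ k, (k = l ∨ (k ≠ l ∧ Sees q l k)) → q k 1 = q l 1 := by
      intro k hk
      refine le_antisymm ?_ (hall k)
      by_contra! h
      exact hup ⟨k, hk, h⟩
    have hu : upSign (snapshot q c ε l) 0 = 1 := by
      rw [hzero]; exact upSign_flat hflat
    have hw1 := hflat w (Or.inr ⟨hwl, hsw⟩)
    have hlt : q l = target P (n - 1) := by
      rcases hfin with h | h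
      · linarith
      · exact h
    refine ⟨fun _ => ?_, fun h => absurd hlt h⟩
    have hF : (leaderFrame P (snapshot q c ε l)).toAgreed 0 = q l := by
      rw [leaderFrame, hu, lowestLeftmost_eq hwl hsw, ← hw]
      · refine plane_ext (by simp [Frame.toAgreed]) ?_
        simp [Frame.toAgreed, hw1]
      · intro k hk hs
        have := hflat k (Or.inr ⟨hk, hs⟩)
        rcases hlow' k hk with h | h
        · linarith
        · exact Or.inr h
    rw [finishAt, if_pos (hF.trans hlt)]

end Leader

/-! ### The two formations -/

lemma convex_coord_lt (i : Fin 2) (h : ℝ) : Convex ℝ {z : Plane | h < z i} :=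
  convex_halfSpace_gt (EuclideanSpace.proj (𝕜 := ℝ) i).toLinearMap.isLinear h

lemma convex_coord_le (i : Fin 2) (h : ℝ) : Convex ℝ {z : Plane | h ≤ z i} :=
  convex_halfSpace_ge (EuclideanSpace.proj (𝕜 := ℝ) i).toLinearMap.isLinear h

lemma lt_of_mem_segment {h : ℝ} {x y w : Plane} (hx : h < x 1) (hy : h < y 1)
    (hw : w ∈ segment ℝ x y) : h < w 1 := (convex_coord_lt 1 h).segment_subset hx hy hw

lemma gt_of_mem_segment {h : ℝ} {x y w : Plane} (hx : x 1 < h) (hy : y 1 < h)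
    (hw : w ∈ segment ℝ x y) : w 1 < h :=
  (convex_halfSpace_lt (EuclideanSpace.proj (𝕜 := ℝ) (1 : Fin 2)).toLinearMap.isLinear
    h).segment_subset hx hy hw

/-- An open half-plane together with one point of its boundary is convex. -/
lemma convex_above_insert {a : Plane} : Convex ℝ {z : Plane | a 1 < z 1 ∨ z = a} := by
  rw [convex_iff_segment_subset]
  rintro x hx y hy w hw
  obtain ⟨t, h0, h1, e0, e1⟩ := exists_coord_of_mem_segment hw
  rcases hx with hx | rfl <;> rcases hy with hy | rfl
  · exact Or.inl (lt_of_mem_segment hx hy hw)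
  · rcases h1.lt_or_eq with h1 | rfl
    · left; rw [e1]; nlinarith
    · right; exact plane_ext (by linarith) (by linarith)
  · rcases h0.lt_or_eq with h0 | rfl
    · left; rw [e1]; nlinarith
    · right; exact plane_ext (by linarith) (by linarith)
  · right; exact plane_ext (by linarith) (by linarith)

lemma convex_below_insert {a : Plane} : Convex ℝ {z : Plane | z 1 < a 1 ∨ z = a} := by
  rw [convex_iff_segment_subset]
  rintro x hx y hy w hw
  obtain ⟨t, h0, h1, e0, e1⟩ := exists_coord_of_mem_segment hw
  rcases hx with hx | rfl <;> rcases hy with hy | rfl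
  · exact Or.inl (gt_of_mem_segment hx hy hw)
  · rcases h1.lt_or_eq with h1 | rfl
    · left; rw [e1]; nlinarith
    · right; exact plane_ext (by linarith) (by linarith)
  · rcases h0.lt_or_eq with h0 | rfl
    · left; rw [e1]; nlinarith
    · right; exact plane_ext (by linarith) (by linarith)
  · right; exact plane_ext (by linarith) (by linarith)

/-- `x` comes before `y` from bottom to top, and from left to right at the same height. -/
def Precedes (x y : Plane) : Prop := x 1 < y 1 ∨ (x 1 = y 1 ∧ x 0 ≤ y 0)

lemma Precedes.height_le {x y : Plane} (h : Precedes x y) : x 1 ≤ y 1 := by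
  rcases h with h | h <;> linarith [h]

lemma convex_precedes (y : Plane) : Convex ℝ {z : Plane | Precedes z y} := by
  rw [convex_iff_segment_subset]
  rintro x hx x' hx' w hw
  obtain ⟨t, h0, h1, e0, e1⟩ := exists_coord_of_mem_segment hw
  rcases hx with hx | hx <;> rcases hx' with hx' | hx'
  · exact Or.inl (gt_of_mem_segment hx hx' hw)
  · rcases h1.lt_or_eq with h1 | rfl
    · left; rw [e1]; nlinarith [hx'.1]
    · right; exact ⟨by linarith, by linarith⟩
  · rcases h0.lt_or_eq with h0 | rfl
    · left; rw [e1]; nlinarith [hx.1]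
    · right; exact ⟨by linarith, by linarith⟩
  · right
    exact ⟨by rw [e1, hx.1, hx'.1]; ring, by rw [e0]; nlinarith [hx.2, hx'.2]⟩

section Update

variable {n : ℕ} {q : Fin n → Plane} {i : Fin n} {z : Plane}

lemma others_update : others (Function.update q i z) i = others q i := by
  ext w
  constructor <;> rintro ⟨j, hj, rfl⟩ <;> exact ⟨j, hj, by simp [hj]⟩

lemma nonOverlapping_update (hq : NonOverlapping q) (hz : ∀ w ∈ others q i, 1 ≤ dist z w) :
    NonOverlapping (Function.update q i z) := by
  intro j k hjk
  by_cases hj : j = i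
  · subst hj
    rw [Function.update_self, Function.update_of_ne hjk.symm]
    exact hz _ ⟨k, hjk.symm, rfl⟩
  · by_cases hk : k = i
    · subst hk
      rw [Function.update_self, Function.update_of_ne hj, dist_comm]
      exact hz _ ⟨j, hj, rfl⟩
    · rw [Function.update_of_ne hj, Function.update_of_ne hk]
      exact hq j k hjk

lemma clear_of_nonOverlapping (hq : NonOverlapping q) {K : Set Plane} (h : q i ∈ K) :
    q i ∈ clear (others q i) K :=
  ⟨h, by rintro _ ⟨j, hj, rfl⟩; exact hq i j hj.symm⟩

lemma clear_nonOverlapping (hq : NonOverlapping q) {K : Set Plane}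
    (hz : z ∈ clear (others q i) K) : NonOverlapping (Function.update q i z) :=
  nonOverlapping_update hq hz.2

end Update

/-- The robots are numbered from `0` to `n - 1`, and the leader has the number `0`. -/
structure Ranking {n : ℕ} (ρ : Fin n → ℕ) (l : Fin n) : Prop where
  rank_zero : ∀ j, ρ j = 0 ↔ j = l
  rank_lt : ∀ j, ρ j < n
  rank_injective : Function.Injective ρ
  rank_surjective : ∀ k, k < n → ∃ j, ρ j = k

/-- A leader configuration in agreed coordinates, where `ρ` is the rank of the robots in the order
from bottom to top and from left to right. -/
structure Initial {n : ℕ} (q₀ : Fin n → Plane) (ρ : Fin n → ℕ) (l : Fin n) : Prop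
    extends Ranking ρ l where
  disks : NonOverlapping q₀
  leader_pos : q₀ l = pt 0 (-2)
  height_nonneg : ∀ j, j ≠ l → 0 ≤ q₀ j 1
  right : ∀ j, j ≠ l → 0 < q₀ j 0
  order : ∀ j k, j ≠ l → ρ j < ρ k → Precedes (q₀ j) (q₀ k)

/-- The robots of rank at most `k` have moved to the leader's line. -/
noncomputable def lineUp {n : ℕ} (q₀ : Fin n → Plane) (ρ : Fin n → ℕ) (k : ℕ) (j : Fin n) : Plane :=
  if ρ j ≤ k then pt (ρ j) (-2) else q₀ j

/-- The robots of rank from `1` to `k` have moved from the leader's line to the points `t 0`, ...,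
`t (k-1)`. -/
noncomputable def placed {n : ℕ} (t : ℕ → Plane) (ρ : Fin n → ℕ) (k : ℕ) (j : Fin n) : Plane :=
  if 1 ≤ ρ j ∧ ρ j ≤ k then t (ρ j - 1) else pt (ρ j) (-2)

/-- The lights when the robots of rank from `1` to `k` are done. -/
def lights {n : ℕ} (ρ : Fin n → ℕ) (k : ℕ) (j : Fin n) : Color :=
  if ρ j = 0 then Color.leader else if ρ j ≤ k then Color.done else Color.off

lemma dist_linePoints {a b : ℕ} (h : a ≠ b) : 1 ≤ dist (pt (a : ℝ) (-2)) (pt (b : ℝ) (-2)) := by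
  rw [one_le_dist_iff]
  simp only [pt_zero, pt_one]
  have : (1 : ℤ) ≤ ((a : ℤ) - b) ^ 2 := by
    have : (a : ℤ) - b ≠ 0 := by omega
    have := sq_pos_of_ne_zero this
    omega
  have h2 : (1 : ℝ) ≤ ((a : ℝ) - b) ^ 2 := by exact_mod_cast this
  linarith [sq_nonneg ((-2 : ℝ) - -2)]

lemma dist_of_heights {x y : Plane} (hx : x 1 = -2) (hy : 0 ≤ y 1) : 1 ≤ dist x y := by
  rw [one_le_dist_iff, hx]
  nlinarith [sq_nonneg (x 0 - y 0)]

section LineUp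

variable {n : ℕ} {q₀ : Fin n → Plane} {ρ : Fin n → ℕ} {l : Fin n} {k : ℕ}

lemma lineUp_of_le {j : Fin n} (h : ρ j ≤ k) : lineUp q₀ ρ k j = pt (ρ j) (-2) := if_pos h

lemma lineUp_of_lt {j : Fin n} (h : k < ρ j) : lineUp q₀ ρ k j = q₀ j := if_neg (not_le.2 h)

lemma Ranking.ne_leader (I : Ranking ρ l) {j : Fin n} (h : 1 ≤ ρ j) : j ≠ l := by
  intro hj
  have := (I.rank_zero j).2 hj
  omega

lemma Initial.lineUp_zero (I : Initial q₀ ρ l) : lineUp q₀ ρ 0 = q₀ := by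
  funext j
  rcases Nat.eq_zero_or_pos (ρ j) with h | h
  · rw [lineUp_of_le h.le, h, (I.rank_zero j).1 h, I.leader_pos]; simp
  · exact lineUp_of_lt h

lemma Initial.update_lineUp (I : Initial q₀ ρ l) {i : Fin n} (hi : ρ i = k + 1) :
    Function.update (lineUp q₀ ρ k) i (pt (k + 1) (-2)) = lineUp q₀ ρ (k + 1) := by
  funext j
  by_cases hj : j = i
  · subst hj
    rw [Function.update_self, lineUp_of_le hi.le, hi]; simp
  · rw [Function.update_of_ne hj]
    have : ρ j ≠ k + 1 := fun h => hj (I.rank_injective (h.trans hi.symm))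
    unfold lineUp
    have : ρ j ≤ k ↔ ρ j ≤ k + 1 := by omega
    simp only [this]

lemma Initial.lineUp_disks (I : Initial q₀ ρ l) (k : ℕ) : NonOverlapping (lineUp q₀ ρ k) := by
  intro i j hij
  have hne : ρ i ≠ ρ j := fun h => hij (I.rank_injective h)
  rcases le_or_gt (ρ i) k with h1 | h1 <;> rcases le_or_gt (ρ j) k with h2 | h2
  · rw [lineUp_of_le h1, lineUp_of_le h2]; exact dist_linePoints hne
  · rw [lineUp_of_le h1, lineUp_of_lt h2]
    exact dist_of_heights (by simp) (I.height_nonneg j (I.ne_leader (by omega)))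
  · rw [lineUp_of_lt h1, lineUp_of_le h2, dist_comm]
    exact dist_of_heights (by simp) (I.height_nonneg i (I.ne_leader (by omega)))
  · rw [lineUp_of_lt h1, lineUp_of_lt h2]; exact I.disks i j hij

/-- The region in which the robot of rank `k + 1` moves to the leader's line. -/
def lineRegion (q₀ : Fin n → Plane) (ρ : Fin n → ℕ) (k : ℕ) : Set Plane :=
  {z | 0 < z 0 ∧ (-2 < z 1 ∨ z = pt (k + 1) (-2)) ∧ ∀ y, k + 1 < ρ y → Precedes z (q₀ y)}

lemma Initial.lineCorridor (I : Initial q₀ ρ l) {i : Fin n} (hi : ρ i = k + 1) :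
    Corridor (others (lineUp q₀ ρ k) i) (lineRegion q₀ ρ k) (pt (k + 1) (-2)) := by
  have hrank : ∀ j, j ≠ i → ρ j ≤ k ∨ k + 1 < ρ j := by
    intro j hj
    have : ρ j ≠ k + 1 := fun h => hj (I.rank_injective (h.trans hi.symm))
    omega
  have hge : ∀ z ∈ lineRegion q₀ ρ k, -2 ≤ z 1 := by
    rintro z ⟨-, h | rfl, -⟩
    · exact h.le
    · simp
  refine ⟨?_, ⟨?_, Or.inr rfl, fun y hy => Or.inl ?_⟩, ?_, ?_, ?_⟩
  · have h2 := convex_above_insert (a := pt ((k : ℝ) + 1) (-2))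
    simp only [pt_one] at h2
    have h3 : Convex ℝ (⋂ y, ⋂ (_ : k + 1 < ρ y), {z : Plane | Precedes z (q₀ y)}) :=
      convex_iInter fun y => convex_iInter fun _ => convex_precedes _
    have := (convex_coord_lt 0 0).inter (h2.inter h3)
    convert this using 1
    ext z
    simp [lineRegion]
  · simp only [pt_zero]; positivity
  · have := I.height_nonneg y (I.ne_leader (by omega))
    simp only [pt_one]; linarith
  · rintro z ⟨h0, -, -⟩
    refine ⟨by simpa using h0, Or.inl (by simp), fun y hy => Or.inl ?_⟩
    have := I.height_nonneg y (I.ne_leader (by omega))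
    simp only [pt_one]; linarith
  · rintro z hz _ ⟨j, hj, rfl⟩
    rcases hrank j hj with h | h
    · left; rw [lineUp_of_le h]; exact ⟨by simp, hge z hz⟩
    · right; rw [lineUp_of_lt (by omega)]
      exact ⟨I.height_nonneg j (I.ne_leader (by omega)), (hz.2.2 j h).height_le⟩
  · rintro _ ⟨j, hj, rfl⟩
    rcases hrank j hj with h | h
    · rw [lineUp_of_le h]
      have := dist_linePoints (a := k + 1) (b := ρ j) (by omega)
      simpa using this
    · rw [lineUp_of_lt (by omega)]
      exact dist_of_heights (by simp) (I.height_nonneg j (I.ne_leader (by omega)))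

lemma Initial.start_mem_lineRegion (I : Initial q₀ ρ l) {i : Fin n} (hi : ρ i = k + 1) :
    lineUp q₀ ρ k i ∈ lineRegion q₀ ρ k := by
  have hil := I.ne_leader (j := i) (by omega)
  rw [lineUp_of_lt (by omega)]
  refine ⟨I.right i hil, Or.inl ?_, fun y hy => I.order i y hil (by omega)⟩
  have := I.height_nonneg i hil
  linarith

lemma Ranking.lights_leader (I : Ranking ρ l) : lights ρ k l = Color.leader :=
  if_pos ((I.rank_zero l).2 rfl)

lemma lights_off {j : Fin n} (h : k < ρ j) : lights ρ k j = Color.off := by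
  rw [lights, if_neg (by omega), if_neg (by omega)]

lemma lights_done {j : Fin n} (h1 : 1 ≤ ρ j) (h2 : ρ j ≤ k) : lights ρ k j = Color.done := by
  rw [lights, if_neg (by omega), if_pos h2]

lemma Ranking.lights_off_or_done (I : Ranking ρ l) {j : Fin n} (h : j ≠ l) :
    lights ρ k j = Color.off ∨ lights ρ k j = Color.done := by
  have : ρ j ≠ 0 := fun h' => h ((I.rank_zero j).1 h')
  rcases le_or_gt (ρ j) k with h' | h'
  · exact Or.inr (lights_done (by omega) h')
  · exact Or.inl (lights_off h')

variable {P : Fin n → Plane} {phase2 becomeLeader : View → Decision} {ε : ℤˣ} {i : Fin n}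
  {z : Plane}

/-- The configuration while the robot `i` of rank `k + 1` is at `z` on its way to the line. -/
lemma Initial.lineArrangement (I : Initial q₀ ρ l) (hi : ρ i = k + 1)
    (hz : z ∈ clear (others (lineUp q₀ ρ k) i) (lineRegion q₀ ρ k)) :
    Arrangement (Function.update (lineUp q₀ ρ k) i z) (lights ρ 0) l := by
  have hil : l ≠ i := (I.ne_leader (by omega)).symm
  have hl0 : ρ l = 0 := (I.rank_zero l).2 rfl
  refine ⟨clear_nonOverlapping (I.lineUp_disks k) hz, ?_, I.lights_leader,
    fun j hj => I.lights_off_or_done hj, fun j => ?_⟩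
  · rw [Function.update_of_ne hil, lineUp_of_le (by omega), hl0]; simp
  · by_cases hj : j = i
    · subst hj
      rw [Function.update_self]
      rcases hz.1.2.1 with h | rfl
      · exact h.le
      · simp
    · rw [Function.update_of_ne hj]
      rcases le_or_gt (ρ j) k with h | h
      · rw [lineUp_of_le h]; simp
      · rw [lineUp_of_lt h]
        linarith [I.height_nonneg j (I.ne_leader (by omega))]

lemma hanging_update {O : Set Plane} {K : Set Plane} {a : Plane} {q : Fin n → Plane}
    (C : Corridor O K a) (hO : O = others q i) (hz : z ∈ K) :
    Hanging (Function.update q i z) i := by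
  intro j hj
  rw [Function.update_self, Function.update_of_ne hj]
  rcases C.order z hz (q j) (hO ▸ ⟨j, hj, rfl⟩) with h | h
  · exact Or.inl h.1
  · exact Or.inr h

/-- While robot `i` is on its way to the leader's line, the others do nothing. -/
lemma Initial.line_others_stay (I : Initial q₀ ρ l) (hi : ρ i = k + 1)
    (hz : z ∈ clear (others (lineUp q₀ ρ k) i) (lineRegion q₀ ρ k)) (hza : z ≠ pt (k + 1) (-2))
    {j : Fin n} (hj : j ≠ i) :
    patternFormation P phase2 becomeLeader
      (snapshot (Function.update (lineUp q₀ ρ k) i z) (lights ρ 0) ε j) = ⟨lights ρ 0 j, 0⟩ := by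
  have A := I.lineArrangement hi hz
  have hH := hanging_update (I.lineCorridor hi) rfl hz.1
  have hz1 : -2 < z 1 := hz.1.2.1.resolve_right hza
  have hi1 : -2 < Function.update (lineUp q₀ ρ k) i z i 1 := by rwa [Function.update_self]
  have hioff : lights ρ 0 i = Color.off := lights_off (by omega)
  have hpos : Function.update (lineUp q₀ ρ k) i z j = lineUp q₀ ρ k j :=
    Function.update_of_ne hj _ _
  have hjk : ρ j ≠ k + 1 := fun h => hj (I.rank_injective (h.trans hi.symm))
  rcases Nat.eq_zero_or_pos (ρ j) with h0 | h0
  · obtain rfl := (I.rank_zero j).1 h0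
    refine A.stays_leader ⟨i, sees_of_hanging A.disks ?_ hi1 hH, hioff⟩
    rw [A.leader_pos]; simp
  have hjoff : lights ρ 0 j = Color.off := lights_off h0
  rcases le_or_gt (ρ j) k with h1 | h1
  · rw [lineUp_of_le h1] at hpos
    have hj1 : Function.update (lineUp q₀ ρ k) i z j 1 = -2 := by rw [hpos]; simp
    refine A.stays_on_line hjoff hj1 ?_ ⟨i, sees_of_hanging A.disks hj1 hi1 hH, hioff, hi1⟩
    rw [hpos, pt_zero]; exact Nat.cast_pos.2 h0
  · rw [lineUp_of_lt h1] at hpos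
    have hjl := I.ne_leader (j := j) (by omega)
    refine A.stays_above hjoff ?_ ?_ ⟨i, hi1, ?_⟩
    · rw [hpos]; exact I.height_nonneg j hjl
    · rw [hpos]; exact I.right j hjl
    · have hprec : Precedes z (q₀ j) := hz.1.2.2 j (by omega)
      rcases hprec with h | ⟨h, h'⟩
      · left; rw [hpos, Function.update_self]; exact h
      · right; rw [hpos, Function.update_self]
        refine ⟨h, h'.lt_of_ne fun h'' => hj ?_⟩
        refine (A.disks.eq_of_coord (i := i) (j := j) ?_ ?_).symm <;>
          rw [hpos, Function.update_self] <;> assumption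

/-- On its way to the leader's line, robot `i` keeps going there. -/
lemma Initial.line_active_moves (I : Initial q₀ ρ l) (hi : ρ i = k + 1)
    (hz : z ∈ clear (others (lineUp q₀ ρ k) i) (lineRegion q₀ ρ k)) (hza : z ≠ pt (k + 1) (-2)) :
    patternFormation P phase2 becomeLeader
      (snapshot (Function.update (lineUp q₀ ρ k) i z) (lights ρ 0) ε i) =
      stepTo (Function.update (lineUp q₀ ρ k) i z) (lights ρ 0) ε i (pt (k + 1) (-2)) := by
  have A := I.lineArrangement hi hz
  have hH := hanging_update (I.lineCorridor hi) rfl hz.1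
  have hz1 : -2 < z 1 := hz.1.2.1.resolve_right hza
  have hi1 : -2 < Function.update (lineUp q₀ ρ k) i z i 1 := by rwa [Function.update_self]
  have hioff : lights ρ 0 i = Color.off := lights_off (by omega)
  have hrank : ∀ j, j ≠ i → ρ j ≤ k ∨ k + 1 < ρ j := by
    intro j hj
    have : ρ j ≠ k + 1 := fun h => hj (I.rank_injective (h.trans hi.symm))
    omega
  refine A.steps_to_line hioff hi1 hH ?_ ?_ ?_
  · intro j hj
    rw [Function.update_self, Function.update_of_ne hj]
    rcases hrank j hj with h | h
    · rw [lineUp_of_le h, pt_one]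
      intro h'; linarith
    · rw [lineUp_of_lt (by omega)]
      intro h'
      rcases hz.1.2.2 j h with h'' | h''
      · linarith
      · exact h''.2
  · intro j
    rcases Nat.eq_zero_or_pos (ρ j) with h | h
    · rw [lights, if_pos h]; exact fun h => by cases h
    · rw [lights_off h]; exact fun h => by cases h
  · ext w
    constructor
    · rintro ⟨⟨j, hj, rfl⟩, h1, h2⟩
      rw [Function.update_of_ne hj] at h1 h2 ⊢
      rcases hrank j hj with h | h
      · rw [lineUp_of_le h] at h2 ⊢
        refine ⟨ρ j, ?_, h, rfl⟩
        rw [Nat.one_le_iff_ne_zero]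
        intro h0
        rw [h0] at h2; simp at h2
      · rw [lineUp_of_lt (by omega)] at h1
        linarith [I.height_nonneg j (I.ne_leader (by omega))]
    · rintro ⟨m, h1, h2, rfl⟩
      obtain ⟨j, rfl⟩ := I.rank_surjective m (by have := I.rank_lt i; omega)
      have hj : j ≠ i := by rintro rfl; omega
      refine ⟨⟨j, hj, by rw [Function.update_of_ne hj, lineUp_of_le h2]⟩, by simp, fun h => ?_⟩
      have := congrArg (fun z : Plane => z 0) h
      simp only [pt_zero, Nat.cast_eq_zero] at this
      omega

end LineUp

/-- What is needed of the target points: they are in the first quadrant, they have room for the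
robots, and they are ordered from top to bottom and from right to left. -/
structure Targets (n : ℕ) (t : ℕ → Plane) : Prop where
  nonneg : ∀ m, m < n → 0 ≤ t m 0 ∧ 0 ≤ t m 1
  room : ∀ m m', m < n → m' < n → m ≠ m' → 1 ≤ dist (t m) (t m')
  order : ∀ m m', m < m' → m' < n → Precedes (t m') (t m)

section Placed

variable {n : ℕ} {q₀ : Fin n → Plane} {ρ : Fin n → ℕ} {l : Fin n} {k : ℕ} {t : ℕ → Plane}

lemma placed_line {j : Fin n} (h : ρ j = 0 ∨ k < ρ j) : placed t ρ k j = pt (ρ j) (-2) :=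
  if_neg (by omega)

lemma placed_target {j : Fin n} (h1 : 1 ≤ ρ j) (h2 : ρ j ≤ k) : placed t ρ k j = t (ρ j - 1) :=
  if_pos ⟨h1, h2⟩

lemma Ranking.lineUp_last (R : Ranking ρ l) : lineUp q₀ ρ (n - 1) = placed t ρ 0 := by
  funext j
  have := R.rank_lt j
  rw [lineUp_of_le (by omega), placed_line (by omega)]

lemma Ranking.update_placed (R : Ranking ρ l) {i : Fin n} (hi : ρ i = k + 1) :
    Function.update (placed t ρ k) i (t k) = placed t ρ (k + 1) := by
  funext j
  by_cases hj : j = i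
  · subst hj
    rw [Function.update_self, placed_target (by omega) hi.le, hi]; simp
  · rw [Function.update_of_ne hj]
    have : ρ j ≠ k + 1 := fun h => hj (R.rank_injective (h.trans hi.symm))
    unfold placed
    have : ρ j ≤ k ↔ ρ j ≤ k + 1 := by omega
    simp only [this]

lemma Ranking.update_lights (R : Ranking ρ l) {i : Fin n} (hi : ρ i = k + 1) :
    Function.update (lights ρ k) i Color.done = lights ρ (k + 1) := by
  funext j
  by_cases hj : j = i
  · subst hj
    rw [Function.update_self, lights_done (by omega) hi.le]
  · rw [Function.update_of_ne hj]
    have : ρ j ≠ k + 1 := fun h => hj (R.rank_injective (h.trans hi.symm))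
    unfold lights
    have : ρ j ≤ k ↔ ρ j ≤ k + 1 := by omega
    simp only [this]

lemma placed_disks (R : Ranking ρ l) (T : Targets n t) (hk : k < n) :
    NonOverlapping (placed t ρ k) := by
  intro i j hij
  have hne : ρ i ≠ ρ j := fun h => hij (R.rank_injective h)
  by_cases h1 : 1 ≤ ρ i ∧ ρ i ≤ k <;> by_cases h2 : 1 ≤ ρ j ∧ ρ j ≤ k
  · rw [placed_target h1.1 h1.2, placed_target h2.1 h2.2]
    exact T.room _ _ (by omega) (by omega) (by omega)
  · rw [placed_target h1.1 h1.2, placed_line (by omega), dist_comm]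
    exact dist_of_heights (by simp) (T.nonneg _ (by omega)).2
  · rw [placed_line (by omega), placed_target h2.1 h2.2]
    exact dist_of_heights (by simp) (T.nonneg _ (by omega)).2
  · rw [placed_line (by omega), placed_line (by omega)]; exact dist_linePoints hne

/-- The region in which the robot of rank `k + 1` moves to the point `t k`. -/
def targetRegion (t : ℕ → Plane) (k : ℕ) : Set Plane :=
  {z | 0 ≤ z 0 ∧ (-2 < z 1 ∨ z = pt (k + 1) (-2)) ∧ ∀ m, m < k → Precedes z (t m)}

lemma targetRegion_height {z : Plane} (hz : z ∈ targetRegion t k) : -2 ≤ z 1 := by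
  rcases hz.2.1 with h | rfl
  · exact h.le
  · simp

lemma targetCorridor (R : Ranking ρ l) (T : Targets n t) {i : Fin n} (hi : ρ i = k + 1) :
    Corridor (others (placed t ρ k) i) (targetRegion t k) (t k) := by
  have hkn : k < n := by have := R.rank_lt i; omega
  refine ⟨?_, ⟨(T.nonneg k hkn).1, Or.inl ?_, fun m hm => T.order m k hm hkn⟩, ?_, ?_, ?_⟩
  · have h2 := convex_above_insert (a := pt ((k : ℝ) + 1) (-2))
    simp only [pt_one] at h2
    have h3 : Convex ℝ (⋂ m, ⋂ (_ : m < k), {z : Plane | Precedes z (t m)}) :=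
      convex_iInter fun m => convex_iInter fun _ => convex_precedes _
    have := (convex_coord_le 0 0).inter (h2.inter h3)
    convert this using 1
    ext z
    simp [targetRegion]
  · linarith [(T.nonneg k hkn).2]
  · rintro z ⟨h0, -, -⟩
    refine ⟨by simpa using h0, Or.inl (by simp), fun m hm => Or.inl ?_⟩
    have := (T.nonneg m (by omega)).2
    simp only [pt_one]; linarith
  · rintro z hz _ ⟨j, hj, rfl⟩
    by_cases h : 1 ≤ ρ j ∧ ρ j ≤ k
    · right; rw [placed_target h.1 h.2]
      exact ⟨(T.nonneg _ (by omega)).2, (hz.2.2 _ (by omega)).height_le⟩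
    · left; rw [placed_line (by omega)]
      exact ⟨by simp, targetRegion_height hz⟩
  · rintro _ ⟨j, hj, rfl⟩
    by_cases h : 1 ≤ ρ j ∧ ρ j ≤ k
    · rw [placed_target h.1 h.2]
      exact T.room _ _ hkn (by omega) (by omega)
    · rw [placed_line (by omega), dist_comm]
      exact dist_of_heights (by simp) (T.nonneg k hkn).2

lemma start_mem_targetRegion (T : Targets n t) {i : Fin n} (hi : ρ i = k + 1) (hk : k < n) :
    placed t ρ k i ∈ targetRegion t k := by
  rw [placed_line (by omega), hi]
  refine ⟨by simp; positivity, Or.inr (by simp), fun m hm => Or.inl ?_⟩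
  have := (T.nonneg m (by omega)).2
  simp only [pt_one]; linarith

variable {P : Fin n → Plane} {phase2 becomeLeader : View → Decision} {ε : ℤˣ} {i : Fin n}
  {z : Plane}

/-- The configuration while the robot `i` of rank `k + 1` is at `z` on its way to its target. -/
lemma targetArrangement (R : Ranking ρ l) (T : Targets n t) (hi : ρ i = k + 1)
    (hz : z ∈ clear (others (placed t ρ k) i) (targetRegion t k)) :
    Arrangement (Function.update (placed t ρ k) i z) (lights ρ k) l := by
  have hil : l ≠ i := (R.ne_leader (by omega)).symm
  have hl0 : ρ l = 0 := (R.rank_zero l).2 rfl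
  have hkn : k < n := by have := R.rank_lt i; omega
  refine ⟨clear_nonOverlapping (placed_disks R T hkn) hz, ?_, R.lights_leader,
    fun j hj => R.lights_off_or_done hj, fun j => ?_⟩
  · rw [Function.update_of_ne hil, placed_line (by omega), hl0]; simp
  · by_cases hj : j = i
    · subst hj
      rw [Function.update_self]
      exact targetRegion_height hz.1
    · rw [Function.update_of_ne hj]
      by_cases h : 1 ≤ ρ j ∧ ρ j ≤ k
      · rw [placed_target h.1 h.2]
        linarith [(T.nonneg (ρ j - 1) (by omega)).2]
      · rw [placed_line (by omega)]; simp

/-- While robot `i` is on its way to its target or has arrived there, the others do nothing. As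
long as it is still on the line, it hides the leader from the robots to the right. Afterwards it is
visible from everywhere on the line. -/
lemma target_others_stay (R : Ranking ρ l) (T : Targets n t) (hi : ρ i = k + 1)
    (hz : z ∈ clear (others (placed t ρ k) i) (targetRegion t k)) {j : Fin n} (hj : j ≠ i) :
    patternFormation P phase2 becomeLeader
      (snapshot (Function.update (placed t ρ k) i z) (lights ρ k) ε j) = ⟨lights ρ k j, 0⟩ := by
  have A := targetArrangement R T hi hz
  have hH := hanging_update (targetCorridor R T hi) rfl hz.1
  have hioff : lights ρ k i = Color.off := lights_off (by omega)
  have hpos : ∀ {j}, j ≠ i → Function.update (placed t ρ k) i z j = placed t ρ k j :=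
    fun hj => Function.update_of_ne hj _ _
  have hkn : k < n := by have := R.rank_lt i; omega
  have hne : ∀ {j}, j ≠ i → ρ j ≠ k + 1 := fun hj h => hj (R.rank_injective (h.trans hi.symm))
  by_cases hdone : 1 ≤ ρ j ∧ ρ j ≤ k
  · exact stays_of_done (lights_done hdone.1 hdone.2) A.calm
  have hjpos : Function.update (placed t ρ k) i z j = pt (ρ j) (-2) :=
    (hpos hj).trans (placed_line (by omega))
  have hj1 : Function.update (placed t ρ k) i z j 1 = -2 := by rw [hjpos, pt_one]
  have hleft : 1 ≤ ρ j → 0 < Function.update (placed t ρ k) i z j 0 := fun h => by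
    rw [hjpos, pt_zero]; exact Nat.cast_pos.2 h
  rcases hz.1.2.1 with hz1 | hz1
  · have hi1 : -2 < Function.update (placed t ρ k) i z i 1 := by rwa [Function.update_self]
    have hs := sees_of_hanging A.disks hj1 hi1 hH
    rcases Nat.eq_zero_or_pos (ρ j) with h0 | h0
    · obtain rfl := (R.rank_zero j).1 h0
      exact A.stays_leader ⟨i, hs, hioff⟩
    · exact A.stays_on_line (lights_off (by have := hne hj; omega)) hj1 (hleft h0)
        ⟨i, hs, hioff, hi1⟩
  · have hipos : Function.update (placed t ρ k) i z i = pt ((k : ℝ) + 1) (-2) := by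
      rw [Function.update_self, hz1]
    have hl0 : ρ l = 0 := (R.rank_zero l).2 rfl
    have hlpos := A.leader_pos
    rcases Nat.eq_zero_or_pos (ρ j) with h0 | h0
    · obtain rfl := (R.rank_zero j).1 h0
      refine A.stays_leader ⟨i, ?_, hioff⟩
      refine (sees_along_line A.disks hj.symm (by rw [hipos]; simp) hj1 ?_ ?_).symm
      · rw [hipos, hjpos, h0]; simp; positivity
      · intro m hmi hmj
        have hm0 : ρ m ≠ 0 := fun h => hmj (R.rank_injective (h.trans h0.symm))
        by_cases hm : 1 ≤ ρ m ∧ ρ m ≤ k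
        · left; rw [hpos hmi, placed_target hm.1 hm.2]
          exact (T.nonneg _ (by omega)).2
        · right; rw [hpos hmi, hipos, placed_line (by omega)]
          simp only [pt_zero]
          have := hne hmi
          have : k + 1 + 1 ≤ ρ m := by omega
          exact_mod_cast this
    · have hjk : k + 1 < ρ j := by have := hne hj; omega
      refine A.stays_unseeing (lights_off (by omega)) (hleft h0) ?_
      obtain ⟨b, hb⟩ := R.rank_surjective (ρ j - 1) (by have := R.rank_lt j; omega)
      have hbpos : Function.update (placed t ρ k) i z b = pt (ρ b) (-2) := by
        by_cases hbi : b = i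
        · subst hbi
          rw [hipos, hi]; simp
        · exact (hpos hbi).trans (placed_line (by omega))
      have hρ : (ρ j : ℝ) = ρ b + 1 := by
        have : ρ j = ρ b + 1 := by omega
        exact_mod_cast this
      have hρb : (1 : ℝ) ≤ ρ b := by
        have : 1 ≤ ρ b := by omega
        exact_mod_cast this
      refine not_sees_of_between (b := b) ?_ (R.ne_leader (by omega)) hj1
        (by rw [hbpos, pt_one]) (by rw [hlpos, pt_one]) ?_ ?_
      · rintro rfl; omega
      · rw [hbpos, hlpos]; simpa using hρb
      · rw [hbpos, hjpos]; simp only [pt_zero]; linarith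

/-- On its way to its target, robot `i` keeps going there; and when it is there, it sets its light
to `done`. Its own upward direction has to be the agreed one if it is the first robot to leave the
line. -/
lemma target_active_moves (hn : 3 ≤ n) (R : Ranking ρ l) (T : Targets n (target P))
    (hi : ρ i = k + 1) (hε : k = 0 → ε = 1)
    (hz : z ∈ clear (others (placed (target P) ρ k) i) (targetRegion (target P) k)) :
    (z = target P k → patternFormation P phase2 becomeLeader
      (snapshot (Function.update (placed (target P) ρ k) i z) (lights ρ k) ε i) =
        recolor Color.done) ∧
    (z ≠ target P k → patternFormation P phase2 becomeLeader
      (snapshot (Function.update (placed (target P) ρ k) i z) (lights ρ k) ε i) =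
        stepTo (Function.update (placed (target P) ρ k) i z) (lights ρ k) ε i (target P k)) := by
  have A := targetArrangement R T hi hz
  have hH := hanging_update (targetCorridor R T hi) rfl hz.1
  have hioff : lights ρ k i = Color.off := lights_off (by omega)
  have hpos : ∀ {j}, j ≠ i →
      Function.update (placed (target P) ρ k) i z j = placed (target P) ρ k j :=
    fun hj => Function.update_of_ne hj _ _
  have hkn : k + 1 < n := by have := R.rank_lt i; omega
  have hne : ∀ {j}, j ≠ i → ρ j ≠ k + 1 := fun hj h => hj (R.rank_injective (h.trans hi.symm))
  have hl0 : ρ l = 0 := (R.rank_zero l).2 rfl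
  have hil : i ≠ l := R.ne_leader (by omega)
  have htarget : target P (k + 1 - 1) = target P k := by simp
  rcases hz.1.2.1 with hz1 | hz1
  · have hi1 : -2 < Function.update (placed (target P) ρ k) i z i 1 := by
      rwa [Function.update_self]
    have hstep := A.steps_to_target (P := P) (phase2 := phase2) (becomeLeader := becomeLeader)
      (ε := ε) hioff hi1 hH ?_ (j := k + 1) (by omega) hkn ?_ ?_
    · rwa [htarget, Function.update_self] at hstep
    · intro j hj
      rw [Function.update_self, hpos hj]
      by_cases h : 1 ≤ ρ j ∧ ρ j ≤ k
      · rw [placed_target h.1 h.2]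
        intro h'
        rcases hz.1.2.2 (ρ j - 1) (by omega) with h'' | h''
        · linarith
        · exact h''.2
      · rw [placed_line (by omega), pt_one]
        intro h'; linarith
    · ext w
      constructor
      · rintro ⟨⟨j, hj, rfl⟩, h1, h2⟩
        rw [hpos hj] at h1 h2 ⊢
        by_cases h : 1 ≤ ρ j ∧ ρ j ≤ k
        · rw [placed_target h.1 h.2] at h1
          linarith [(T.nonneg (ρ j - 1) (by omega)).2]
        · rw [placed_line (by omega)] at h2 ⊢
          refine ⟨ρ j, ?_, by have := R.rank_lt j; omega, rfl⟩
          have h0 : ρ j ≠ 0 := by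
            intro h0
            rw [h0] at h2; simp at h2
          have := hne hj
          omega
      · rintro ⟨m, h1, h2, rfl⟩
        obtain ⟨j, rfl⟩ := R.rank_surjective m (by omega)
        have hj : j ≠ i := by rintro rfl; omega
        refine ⟨⟨j, hj, by rw [hpos hj, placed_line (by omega)]⟩, by simp, fun h => ?_⟩
        have := congrArg (fun z : Plane => z 0) h
        simp only [pt_zero, Nat.cast_eq_zero] at this
        omega
    · -- the last robot on its way sees a robot that is done, above it or to the right
      intro hk
      have hdone : ∀ j, j ≠ i → j ≠ l → lights ρ k j = Color.done := by
        intro j hj hjl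
        have h0 : ρ j ≠ 0 := fun h => hjl ((R.rank_zero j).1 h)
        have := R.rank_lt j
        have := hne hj
        exact lights_done (by omega) (by omega)
      obtain ⟨m, hm⟩ := R.rank_surjective 1 (by omega)
      have hmi : m ≠ i := by rintro rfl; omega
      have hmpos := (hpos hmi).trans (placed_target (t := target P) hm.ge (by omega))
      have hprec : Precedes z (target P (ρ m - 1)) := hz.1.2.2 _ (by omega)
      have hlpos := A.leader_pos
      rcases hprec with h | ⟨h, h'⟩
      · obtain ⟨j, hj, hlt, hs⟩ := exists_sees_in_direction A.disks (i := i) (m := m) 0 1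
          (by norm_num) (by rw [hmpos, Function.update_self]; linarith)
        refine ⟨j, hj, hs, hdone j hj ?_⟩
        rintro rfl
        rw [hlpos, Function.update_self] at hlt
        simp only [pt_zero, pt_one] at hlt; linarith
      · have h'' : z 0 ≠ target P (ρ m - 1) 0 := by
          intro h''
          refine hmi (A.disks.eq_of_coord (i := m) (j := i) ?_ ?_) <;>
            rw [hmpos, Function.update_self]
          · exact h''.symm
          · exact h.symm
        have hlt := lt_of_le_of_ne h' h''
        obtain ⟨j, hj, hlt, hs⟩ := exists_sees_in_direction A.disks (i := i) (m := m) 1 0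
          (by norm_num) (by rw [hmpos, Function.update_self]; linarith)
        refine ⟨j, hj, hs, hdone j hj ?_⟩
        rintro rfl
        rw [hlpos, Function.update_self] at hlt
        simp only [pt_zero, pt_one] at hlt
        linarith [hz.1.1]
  · have hipos : Function.update (placed (target P) ρ k) i z i =
        pt ((k + 1 : ℕ) : ℝ) (-2) := by rw [Function.update_self, hz1]; simp
    refine ⟨fun h => ?_, fun _ => ?_⟩
    · have := (T.nonneg k (by omega)).2
      rw [← h, hz1, pt_one] at this
      linarith
    rw [← htarget]
    refine A.steps_from_line hioff (j := k + 1) (by omega) hipos ?_ ?_ ?_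
    · refine sees_along_line A.disks hil (by rw [hipos, pt_one]) (by rw [A.leader_pos, pt_one]) ?_ ?_
      · rw [hipos, A.leader_pos]; simp only [pt_zero]; positivity
      · intro m hmi hml
        have hm0 : ρ m ≠ 0 := fun h => hml ((R.rank_zero m).1 h)
        by_cases hm : 1 ≤ ρ m ∧ ρ m ≤ k
        · left; rw [hpos hmi, placed_target hm.1 hm.2]
          exact (T.nonneg _ (by omega)).2
        · right; rw [hpos hmi, hipos, placed_line (by omega)]
          simp only [pt_zero]
          have := hne hmi
          have : k + 1 + 1 ≤ ρ m := by omega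
          exact_mod_cast this
    · intro j hj1
      have hji : j ≠ i := by rintro rfl; rw [hipos, pt_one] at hj1; linarith
      by_cases hj : 1 ≤ ρ j ∧ ρ j ≤ k
      · exact lights_done hj.1 hj.2
      · rw [hpos hji, placed_line (by omega), pt_one] at hj1
        linarith
    · rcases Nat.eq_zero_or_pos k with rfl | hk
      · refine Or.inr ⟨hε rfl, fun j _ => ?_⟩
        by_cases hji : j = i
        · rw [hji, hipos, pt_one]
        · rw [hpos hji, placed_line (by omega), pt_one]
      · left
        obtain ⟨m, hm⟩ := R.rank_surjective 1 (by omega)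
        have hmi : m ≠ i := by rintro rfl; omega
        have hmpos := (hpos hmi).trans (placed_target (t := target P) hm.ge (by omega))
        have hm1 := (T.nonneg (ρ m - 1) (by omega)).2
        obtain ⟨j, hj, hlt, hs⟩ := exists_sees_in_direction A.disks (i := i) (m := m) 0 1
          (by norm_num) (by rw [hmpos, hipos, pt_one]; linarith)
        refine ⟨j, Or.inr ⟨hj, hs⟩, ?_⟩
        rw [hipos, pt_one] at hlt
        linarith

/-! ### The last movement -/

/-- The region in which the leader moves to its target `a`. -/
def leaderRegion (a : Plane) : Set Plane := {z | -2 ≤ z 1 ∧ (z 1 < a 1 ∨ z = a)}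

lemma leaderRegion_height {a : Plane} (hz : z ∈ leaderRegion a) : z 1 ≤ a 1 := by
  rcases hz.2 with h | rfl
  · exact h.le
  · exact le_rfl

lemma leaderCorridor (hn : 3 ≤ n) (R : Ranking ρ l) (T : Targets n t) :
    Corridor (others (placed t ρ (n - 1)) l) (leaderRegion (t (n - 1))) (t (n - 1)) := by
  have h1 := (T.nonneg (n - 1) (by omega)).2
  have hpos : ∀ j, j ≠ l → 1 ≤ ρ j ∧ ρ j < n := fun j hj =>
    ⟨Nat.one_le_iff_ne_zero.2 fun h => hj ((R.rank_zero j).1 h), R.rank_lt j⟩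
  refine ⟨?_, ⟨by linarith, Or.inr rfl⟩, ?_, ?_, ?_⟩
  · exact (convex_coord_le 1 (-2)).inter convex_below_insert
  · rintro z -
    exact ⟨by simp, Or.inl (by simp only [pt_one]; linarith)⟩
  · rintro z hz _ ⟨j, hj, rfl⟩
    obtain ⟨h2, h3⟩ := hpos j hj
    right; rw [placed_target h2 (by omega)]
    exact ⟨(T.nonneg _ (by omega)).2, (leaderRegion_height hz).trans
      (T.order _ (n - 1) (by omega) (by omega)).height_le⟩
  · rintro _ ⟨j, hj, rfl⟩
    obtain ⟨h2, h3⟩ := hpos j hj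
    rw [placed_target h2 (by omega)]
    exact T.room _ _ (by omega) (by omega) (by omega)

lemma start_mem_leaderRegion (hn : 3 ≤ n) (R : Ranking ρ l) (T : Targets n t) :
    placed t ρ (n - 1) l ∈ leaderRegion (t (n - 1)) := by
  have h1 := (T.nonneg (n - 1) (by omega)).2
  rw [placed_line (Or.inl ((R.rank_zero l).2 rfl))]
  exact ⟨by simp, Or.inl (by simp only [pt_one]; linarith)⟩

lemma Ranking.lights_last (R : Ranking ρ l) {j : Fin n} (hj : j ≠ l) :
    lights ρ (n - 1) j = Color.done :=
  lights_done (Nat.one_le_iff_ne_zero.2 fun h => hj ((R.rank_zero j).1 h))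
    (by have := R.rank_lt j; omega)

/-- On its way to its target, the leader keeps going there; and when it is there, it sets its light
to `done`. -/
lemma leader_active_moves (hn : 3 ≤ n) (R : Ranking ρ l) (T : Targets n (target P))
    (hz : z ∈ clear (others (placed (target P) ρ (n - 1)) l)
      (leaderRegion (target P (n - 1)))) :
    (z = target P (n - 1) → patternFormation P phase2 becomeLeader
      (snapshot (Function.update (placed (target P) ρ (n - 1)) l z) (lights ρ (n - 1)) ε l) =
        recolor Color.done) ∧
    (z ≠ target P (n - 1) → patternFormation P phase2 becomeLeader
      (snapshot (Function.update (placed (target P) ρ (n - 1)) l z) (lights ρ (n - 1)) ε l) =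
        stepTo (Function.update (placed (target P) ρ (n - 1)) l z) (lights ρ (n - 1)) ε l
          (target P (n - 1))) := by
  obtain ⟨w, hw⟩ := R.rank_surjective (n - 1) (by omega)
  have hwl : w ≠ l := R.ne_leader (by omega)
  have hpos : ∀ {j}, j ≠ l → Function.update (placed (target P) ρ (n - 1)) l z j =
      target P (ρ j - 1) := fun {j} hj =>
    (Function.update_of_ne hj _ _).trans (placed_target
      (Nat.one_le_iff_ne_zero.2 fun h => hj ((R.rank_zero j).1 h))
      (by have := R.rank_lt j; omega))
  have e : ρ w - 1 = n - 2 := by omega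
  have hprec : Precedes z (target P (n - 2)) := by
    have h := T.order (n - 2) (n - 1) (by omega) (by omega)
    rcases hz.1.2 with h' | rfl
    · exact Or.inl (h'.trans_le h.height_le)
    · exact h
  have main := leader_steps (P := P) (phase2 := phase2) (becomeLeader := becomeLeader) (ε := ε)
    (q := Function.update (placed (target P) ρ (n - 1)) l z) (c := lights ρ (n - 1)) (l := l)
    (w := w) (clear_nonOverlapping (placed_disks R T (by omega)) hz) R.lights_leader
    (fun j hj => R.lights_last hj) hwl ((hpos hwl).trans (by rw [e])) ?_ ?_ ?_
  · rwa [Function.update_self] at main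
  · intro j hjl hjw
    rw [hpos hwl, hpos hjl]
    have h0 : ρ j ≠ 0 := fun h => hjl ((R.rank_zero j).1 h)
    have h1 : ρ j ≠ ρ w := fun h => hjw (R.rank_injective h)
    have := R.rank_lt j
    exact T.order _ _ (by omega) (by omega)
  · rw [hpos hwl, Function.update_self, e]
    exact hprec
  · rw [hpos hwl, Function.update_self, e]
    rcases hz.1.2 with h' | h'
    · exact Or.inl (h'.trans_le (T.order (n - 2) (n - 1) (by omega) (by omega)).height_le)
    · exact Or.inr h'

end Placed

/-! ### The target points -/

section TargetPoints

variable {n : ℕ} {P : Fin n → Plane}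

lemma one_le_patternScale : 1 ≤ patternScale P := le_max_left _ _

lemma one_le_patternScale_mul_dist (hP : Function.Injective P) {a b : Fin n} (h : a ≠ b) :
    1 ≤ patternScale P * dist (P a) (P b) := by
  have hpos : 0 < dist (P a) (P b) := dist_pos.2 (hP.ne h)
  have hle : (dist (P a) (P b))⁻¹ ≤ patternScale P :=
    (le_ciSup (f := fun k : Fin n × Fin n => (dist (P k.1) (P k.2))⁻¹)
      (Set.finite_range _).bddAbove (a, b)).trans (le_max_right _ _)
  calc (1 : ℝ) = (dist (P a) (P b))⁻¹ * dist (P a) (P b) := (inv_mul_cancel₀ hpos.ne').symm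
    _ ≤ _ := by gcongr

lemma target_of_lt {k : ℕ} (h : k < n) :
    target P k = patternScale P • P (Tuple.sort (targetKey P) ⟨k, h⟩) := dif_pos h

lemma dist_patternScale (a b : Fin n) :
    dist (patternScale P • P a) (patternScale P • P b) = patternScale P * dist (P a) (P b) := by
  rw [dist_smul₀, Real.norm_of_nonneg (zero_le_one.trans one_le_patternScale)]

lemma targets (hP : Function.Injective P) (hP0 : ∀ k, 0 ≤ P k 0 ∧ 0 ≤ P k 1) :
    Targets n (target P) := by
  have hs : 0 < patternScale P := zero_lt_one.trans_le one_le_patternScale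
  refine ⟨fun m hm => ?_, fun m m' hm hm' hne => ?_, fun m m' hlt hm' => ?_⟩
  · rw [target_of_lt hm]
    exact ⟨mul_nonneg hs.le (hP0 _).1, mul_nonneg hs.le (hP0 _).2⟩
  · rw [target_of_lt hm, target_of_lt hm', dist_patternScale]
    refine one_le_patternScale_mul_dist hP fun h => hne ?_
    simpa using (Tuple.sort (targetKey P)).injective h
  · have hm : m < n := hlt.trans hm'
    have hmono := Tuple.monotone_sort (targetKey P)
      (show (⟨m, hm⟩ : Fin n) ≤ ⟨m', hm'⟩ from hlt.le)
    rw [target_of_lt hm, target_of_lt hm']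
    simp only [Function.comp_apply, targetKey, Prod.Lex.toLex_le_toLex] at hmono
    unfold Precedes
    simp only [PiLp.smul_apply, smul_eq_mul]
    rcases hmono with h | ⟨h, h'⟩
    · left; gcongr; linarith
    · right; exact ⟨by rw [neg_inj.1 h], by gcongr; linarith⟩

end TargetPoints

/-! ### Executions from a leader configuration on -/

section Course

variable {n : ℕ} {P : Fin n → Plane} {phase2 becomeLeader : View → Decision}
  {σ : Fin n → ℤˣ} {δ : ℝ} (E : Execution n (patternFormation P phase2 becomeLeader) σ δ)
  {T : ℝ} {L : Plane} {s : ℤˣ}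

/-- The configuration with the positions `q` in the coordinates in which the leader was at
`(0,-2)` when it was at the point `L` of the plane, and upwards is the direction `s`. -/
noncomputable def inPlane (L : Plane) (s : ℤˣ) (q : Fin n → Plane) : Fin n → Plane :=
  fun j => agreedPoint L s (q j)

lemma inPlane_update (q : Fin n → Plane) (i : Fin n) (z : Plane) :
    inPlane L s (Function.update q i z) =
      Function.update (inPlane L s q) i (agreedPoint L s z) := by
  funext j
  by_cases hj : j = i
  · subst hj; simp [inPlane]
  · simp [inPlane, hj]

lemma nonOverlapping_inPlane {q : Fin n → Plane} (hq : NonOverlapping q) :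
    NonOverlapping (inPlane L s q) := fun i j hij => by
  simpa only [inPlane, dist_agreedPoint] using hq i j hij

/-- The decision `stepTo` in the plane. -/
lemma agreedPoint_add_orient (L : Plane) (s t : ℤˣ) (z w : Plane) :
    agreedPoint L s z + orient t (orient (t * s) (w - z)) = agreedPoint L s w := by
  refine plane_ext (by simp) ?_
  simp only [PiLp.add_apply, agreedPoint_one, orient_one, PiLp.sub_apply, Units.val_mul,
    Int.cast_mul]
  linear_combination ((s : ℤ) : ℝ) * (w 1 - z 1) * unit_cast_mul_self t

/-- One robot moves to `a` along a corridor, while the others do nothing. -/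
lemma exists_arrival_in_corridor (hδ : 0 < δ) (hT : 0 ≤ T) (hst : E.Stable T)
    {q : Fin n → Plane} {c : Fin n → Color} (hpos : E.pos T = inPlane L s q)
    (hlight : E.light T = c) (hq : NonOverlapping q) {i : Fin n} {a : Plane} {K : Set Plane}
    (C : Corridor (others q i) K a) (h0 : q i ∈ K) (hne : q i ≠ a)
    (hothers : ∀ z ∈ clear (others q i) K, z ≠ a → ∀ j, j ≠ i →
      patternFormation P phase2 becomeLeader
        (snapshot (Function.update q i z) c (σ j * s) j) = ⟨c j, 0⟩)
    (hact : ∀ z ∈ clear (others q i) K, z ≠ a →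
      patternFormation P phase2 becomeLeader
        (snapshot (Function.update q i z) c (σ i * s) i) =
          stepTo (Function.update q i z) c (σ i * s) i a) :
    ∃ T', T < T' ∧ E.Stable T' ∧ E.pos T' = inPlane L s (Function.update q i a) ∧
      E.light T' = c ∧
      ∀ t ∈ Icc T T', E.light t = c ∧ NonOverlapping (E.pos t) ∧
        ∀ j, j ≠ i → E.pos t j = E.pos T j := by
  let inv : Plane → Plane := agreedPoint (inverseBase L s) s
  have hinv : ∀ z, inv (agreedPoint L s z) = z := agreedPoint_inverse L s
  have hinj : ∀ z, agreedPoint L s z ≠ agreedPoint L s a → z ≠ a := fun z h h' => h (h' ▸ rfl)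
  have hsnap : ∀ z j, snapshot (Function.update (E.pos T) i (agreedPoint L s z)) (E.light T)
      (σ j) j = snapshot (Function.update q i z) c (σ j * s) j := by
    intro z j
    rw [hpos, hlight, ← inPlane_update]
    exact snapshot_agreed L s (σ j)
  have hact' : ∀ z ∈ clear (others q i) K, z ≠ a →
      patternFormation P phase2 becomeLeader (snapshot
        (Function.update (E.pos T) i (agreedPoint L s z)) (E.light T) (σ i) i) =
        ⟨c i, orient (σ i * s) (nextStop (others q i) z a - z)⟩ := by
    intro z hz hza
    rw [hsnap, hact z hz hza, stepTo, others_update, Function.update_self]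
  obtain ⟨T', h1, h2, h3, h4, h5⟩ := E.exists_arrival hT hst i (agreedPoint L s a)
    (agreedPoint L s '' clear (others q i) K)
    (fun w => agreedPoint L s (nextStop (others q i) (inv w) a))
    (fun w => effort δ (others q i) a (inv w))
    ⟨q i, clear_of_nonOverlapping hq h0, by rw [hpos]; rfl⟩
    (fun h => hne (by rw [← hinv (q i), ← hinv a, ← h, hpos]; rfl))
    (by
      rintro _ ⟨z, hz, rfl⟩ hza j hj
      rw [hsnap, hothers z hz (hinj z hza) j hj, hlight])
    (by
      rintro _ ⟨z, hz, rfl⟩ hza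
      rw [hact' z hz (hinj z hza), hlight])
    (by
      rintro _ ⟨z, hz, rfl⟩ hza
      rw [hact' z hz (hinj z hza), hinv]
      exact agreedPoint_add_orient L s (σ i) z _)
    (by
      rintro _ ⟨z, hz, rfl⟩ -
      rw [hinv, agreedPoint_image_segment]
      exact Set.image_mono (C.segment_subset_clear hz))
    (by
      rintro _ ⟨z, hz, rfl⟩ - h
      rw [hinv, agreedPoint_image_segment] at h
      obtain ⟨w, hw, hwa⟩ := h
      have : w = a := by rw [← hinv w, hwa, hinv]
      rw [hinv, C.nextStop_eq hz (this ▸ hw)])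
    (by
      rintro _ ⟨z, hz, rfl⟩ - w hw hd hwa
      rw [hinv, agreedPoint_image_segment] at hw
      obtain ⟨v, hv, rfl⟩ := hw
      rw [hinv, dist_agreedPoint, dist_agreedPoint] at hd
      rw [hinv, hinv]
      exact C.effort_lt hδ hz hv hd (hinj v hwa))
  refine ⟨T', h1, h2, ?_, h4.trans hlight, fun t ht => ?_⟩
  · rw [h3, hpos, inPlane_update]
  · obtain ⟨_, ⟨z, hz, rfl⟩, g1, g2⟩ := h5 t ht
    refine ⟨g2.trans hlight, ?_, fun j hj => by rw [g1, Function.update_of_ne hj]⟩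
    rw [g1, hpos, ← inPlane_update]
    exact nonOverlapping_inPlane (clear_nonOverlapping hq hz)

/-- One robot at rest sets its light to `done`, while the others do nothing. -/
lemma exists_done (hT : 0 ≤ T) (hst : E.Stable T)
    {q : Fin n → Plane} {c : Fin n → Color} (hpos : E.pos T = inPlane L s q)
    (hlight : E.light T = c) {i : Fin n}
    (hothers : ∀ j, j ≠ i → patternFormation P phase2 becomeLeader
      (snapshot q c (σ j * s) j) = ⟨c j, 0⟩)
    (hact : patternFormation P phase2 becomeLeader (snapshot q c (σ i * s) i) =
      recolor Color.done) :
    ∃ T', T < T' ∧ E.Stable T' ∧ E.pos T' = inPlane L s q ∧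
      E.light T' = Function.update c i Color.done ∧
      ∀ t ∈ Icc T T', E.pos t = E.pos T ∧ ∀ j, j ≠ i → E.light t j = c j := by
  have hsnap : ∀ j, snapshot (E.pos T) (E.light T) (σ j) j = snapshot q c (σ j * s) j := by
    intro j
    rw [hpos, hlight]
    exact snapshot_agreed L s (σ j)
  obtain ⟨T', h1, h2, h3, h4, h5⟩ := E.exists_recolor hT hst i Color.done
    (fun j hj => by rw [hsnap, hothers j hj, hlight]) (by rw [hsnap, hact])
  exact ⟨T', h1, h2, h3.trans hpos, by rw [h4, hlight],
    fun t ht => ⟨(h5 t ht).1, fun j hj => by rw [(h5 t ht).2 j hj, hlight]⟩⟩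

variable {q₀ : Fin n → Plane} {ρ : Fin n → ℕ} {l i : Fin n} {k : ℕ}

/-- The robot of rank `k + 1` moves to the leader's line. -/
lemma exists_line_step (I : Initial q₀ ρ l) (hδ : 0 < δ) (hi : ρ i = k + 1) (hT : 0 ≤ T)
    (hst : E.Stable T) (hpos : E.pos T = inPlane L s (lineUp q₀ ρ k))
    (hlight : E.light T = lights ρ 0) :
    ∃ T', T < T' ∧ E.Stable T' ∧ E.pos T' = inPlane L s (lineUp q₀ ρ (k + 1)) ∧
      E.light T' = lights ρ 0 ∧
      ∀ t ∈ Icc T T', E.light t = lights ρ 0 ∧ NonOverlapping (E.pos t) ∧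
        ∀ j, j ≠ i → E.pos t j = E.pos T j := by
  have hne : lineUp q₀ ρ k i ≠ pt (k + 1) (-2) := by
    rw [lineUp_of_lt (by omega)]
    intro h
    have := I.height_nonneg i (I.ne_leader (by omega))
    rw [h, pt_one] at this
    linarith
  obtain ⟨T', h1, h2, h3, h4, h5⟩ := exists_arrival_in_corridor E hδ hT hst hpos hlight
    (I.lineUp_disks k) (I.lineCorridor hi) (I.start_mem_lineRegion hi) hne
    (fun z hz hza j hj => I.line_others_stay hi hz hza hj)
    (fun z hz hza => I.line_active_moves hi hz hza)
  exact ⟨T', h1, h2, by rw [h3, I.update_lineUp hi], h4, h5⟩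

/-- The robot of rank `k + 1` moves from the leader's line to its target and sets its light to
`done`. -/
lemma exists_target_step (hn : 3 ≤ n) (R : Ranking ρ l) (Tg : Targets n (target P)) (hδ : 0 < δ)
    (hi : ρ i = k + 1) (hs : k = 0 → s = σ i) (hT : 0 ≤ T) (hst : E.Stable T)
    (hpos : E.pos T = inPlane L s (placed (target P) ρ k)) (hlight : E.light T = lights ρ k) :
    ∃ T', T < T' ∧ E.Stable T' ∧ E.pos T' = inPlane L s (placed (target P) ρ (k + 1)) ∧
      E.light T' = lights ρ (k + 1) ∧
      ∀ t ∈ Icc T T', NonOverlapping (E.pos t) ∧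
        ∀ j, j ≠ i → E.pos t j = E.pos T j ∧ E.light t j = E.light T j := by
  have hkn : k < n := by have := R.rank_lt i; omega
  have hne : placed (target P) ρ k i ≠ target P k := by
    rw [placed_line (by omega)]
    intro h
    have := (Tg.nonneg k hkn).2
    rw [← h, pt_one] at this
    linarith
  have hε : k = 0 → σ i * s = 1 := fun h => by rw [hs h, Int.units_mul_self]
  have C := targetCorridor R Tg hi
  have hdisks := placed_disks R Tg hkn
  obtain ⟨T', h1, h2, h3, h4, h5⟩ := exists_arrival_in_corridor E hδ hT hst hpos hlight
    hdisks C (start_mem_targetRegion Tg hi hkn) hne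
    (fun z hz _ j hj => target_others_stay R Tg hi hz hj)
    (fun z hz hza => (target_active_moves hn R Tg hi hε hz).2 hza)
  obtain ⟨T'', g1, g2, g3, g4, g5⟩ := exists_done E (hT.trans h1.le) h2 h3 h4
    (fun j hj => target_others_stay R Tg hi C.target_clear hj)
    ((target_active_moves hn R Tg hi hε C.target_clear).1 rfl)
  refine ⟨T'', h1.trans g1, g2, by rw [g3, R.update_placed hi], by rw [g4, R.update_lights hi],
    fun t ht => ?_⟩
  rcases le_total t T' with h | h
  · obtain ⟨e1, e2, e3⟩ := h5 t ⟨ht.1, h⟩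
    exact ⟨e2, fun j hj => ⟨e3 j hj, by rw [e1, hlight]⟩⟩
  · obtain ⟨e1, e2⟩ := g5 t ⟨h, ht.2⟩
    obtain ⟨f1, f2, f3⟩ := h5 T' ⟨h1.le, le_rfl⟩
    exact ⟨by rw [e1]; exact f2,
      fun j hj => ⟨by rw [e1]; exact f3 j hj, by rw [e2 j hj, hlight]⟩⟩

/-- The leader moves to its target and sets its light to `done`. -/
lemma exists_leader_step (hn : 3 ≤ n) (R : Ranking ρ l) (Tg : Targets n (target P)) (hδ : 0 < δ)
    (hT : 0 ≤ T) (hst : E.Stable T)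
    (hpos : E.pos T = inPlane L s (placed (target P) ρ (n - 1)))
    (hlight : E.light T = lights ρ (n - 1)) :
    ∃ T', T < T' ∧ E.Stable T' ∧
      E.pos T' = inPlane L s
        (Function.update (placed (target P) ρ (n - 1)) l (target P (n - 1))) ∧
      (∀ j, E.light T' j = Color.done) ∧
      ∀ t ∈ Icc T T', NonOverlapping (E.pos t) ∧
        ∀ j, j ≠ l → E.pos t j = E.pos T j ∧ E.light t j = E.light T j := by
  have hne : placed (target P) ρ (n - 1) l ≠ target P (n - 1) := by
    rw [placed_line (Or.inl ((R.rank_zero l).2 rfl))]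
    intro h
    have := (Tg.nonneg (n - 1) (by omega)).2
    rw [← h, pt_one] at this
    linarith
  have C := leaderCorridor hn R Tg
  have hdisks := placed_disks R Tg (k := n - 1) (by omega)
  have hcalm : ∀ j, lights ρ (n - 1) j = Color.off ∨ lights ρ (n - 1) j = Color.leader ∨
      lights ρ (n - 1) j = Color.done := by
    intro j
    by_cases hj : j = l
    · subst hj; exact Or.inr (Or.inl R.lights_leader)
    · exact Or.inr (Or.inr (R.lights_last hj))
  obtain ⟨T', h1, h2, h3, h4, h5⟩ := exists_arrival_in_corridor E hδ hT hst hpos hlight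
    hdisks C (start_mem_leaderRegion hn R Tg) hne
    (fun z _ _ j hj => stays_of_done (R.lights_last hj) hcalm)
    (fun z hz hza => (leader_active_moves hn R Tg hz).2 hza)
  obtain ⟨T'', g1, g2, g3, g4, g5⟩ := exists_done E (hT.trans h1.le) h2 h3 h4
    (fun j hj => stays_of_done (R.lights_last hj) hcalm)
    ((leader_active_moves hn R Tg C.target_clear).1 rfl)
  refine ⟨T'', h1.trans g1, g2, g3, fun j => ?_, fun t ht => ?_⟩
  · rw [g4]
    by_cases hj : j = l
    · subst hj; rw [Function.update_self]
    · rw [Function.update_of_ne hj]; exact R.lights_last hj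
  rcases le_total t T' with h | h
  · obtain ⟨e1, e2, e3⟩ := h5 t ⟨ht.1, h⟩
    exact ⟨e2, fun j hj => ⟨e3 j hj, by rw [e1, hlight]⟩⟩
  · obtain ⟨e1, e2⟩ := g5 t ⟨h, ht.2⟩
    obtain ⟨f1, f2, f3⟩ := h5 T' ⟨h1.le, le_rfl⟩
    exact ⟨by rw [e1]; exact f2,
      fun j hj => ⟨by rw [e1]; exact f3 j hj, by rw [e2 j hj, hlight]⟩⟩

/-- Finitely many steps, one after the other. -/
lemma exists_chain {Q : ℕ → ℝ → Prop} {S : ℕ → ℝ → ℝ → Prop} {N : ℕ} {T : ℝ} (h0 : Q 0 T)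
    (hstep : ∀ k, k < N → ∀ t, Q k t → ∃ t', Q (k + 1) t' ∧ S k t t') :
    ∃ f : ℕ → ℝ, f 0 = T ∧ (∀ k, k ≤ N → Q k (f k)) ∧ ∀ k, k < N → S k (f k) (f (k + 1)) := by
  choose! g hg1 hg2 using hstep
  let f : ℕ → ℝ := fun k => Nat.rec T (fun k t => g k t) k
  have hQ : ∀ k, k ≤ N → Q k (f k) := by
    intro k
    induction k with
    | zero => exact fun _ => h0
    | succ k ih => exact fun hk => hg1 k (by omega) _ (ih (by omega))
  exact ⟨f, rfl, hQ, fun k hk => hg2 k hk _ (hQ k hk.le)⟩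

/-- A property that holds during every step holds from the beginning to the end. -/
lemma forall_of_chain {f : ℕ → ℝ} {A : ℝ → Prop} {N : ℕ} (h0 : A (f 0))
    (h : ∀ k, k < N → ∀ t ∈ Icc (f k) (f (k + 1)), A t) : ∀ t ∈ Icc (f 0) (f N), A t := by
  induction N with
  | zero => intro t ht; rwa [le_antisymm ht.2 ht.1]
  | succ N ih =>
    intro t ht
    rcases le_total t (f N) with h' | h'
    · exact ih (fun k hk => h k (by omega)) t ⟨ht.1, h'⟩
    · exact h N (Nat.lt_succ_self N) t ⟨h', ht.2⟩

/-- The order from bottom to top and from left to right of the robots of a leader configuration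
starts with the leader. -/
lemma exists_ranking (hn : 3 ≤ n) {p : Fin n → Plane} (hp : NonOverlapping p) (τ : ℤˣ)
    (hside : ∀ i, i ≠ l → 0 < ((τ : ℤ) : ℝ) * (p i 1 - p l 1)) :
    ∃ r : Equiv.Perm (Fin n),
      StrictMono (fun k => (toLex (((τ : ℤ) : ℝ) * p (r k) 1, p (r k) 0) : ℝ ×ₗ ℝ)) ∧
      r ⟨0, by omega⟩ = l := by
  let key : Fin n → ℝ ×ₗ ℝ := fun j => toLex (((τ : ℤ) : ℝ) * p j 1, p j 0)
  have hinj : Function.Injective key := by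
    intro i j h
    have h' : ((τ : ℤ) : ℝ) * p i 1 = ((τ : ℤ) : ℝ) * p j 1 ∧ p i 0 = p j 0 := by
      simpa [key] using h
    refine hp.eq_of_coord h'.2 ?_
    have hτ := unit_cast_mul_self τ
    calc p i 1 = ((τ : ℤ) : ℝ) * (((τ : ℤ) : ℝ) * p i 1) := by rw [← mul_assoc, hτ, one_mul]
      _ = p j 1 := by rw [h'.1, ← mul_assoc, hτ, one_mul]
  have hmono : StrictMono (key ∘ Tuple.sort key) :=
    (Tuple.monotone_sort key).strictMono_of_injective (hinj.comp (Tuple.sort key).injective)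
  refine ⟨Tuple.sort key, hmono, ?_⟩
  by_contra hne
  have h1 := hside _ hne
  have h2 : key (Tuple.sort key ⟨0, by omega⟩) ≤ key l := by
    have := hmono.monotone (show (⟨0, by omega⟩ : Fin n) ≤ (Tuple.sort key).symm l from
      Nat.zero_le _)
    simpa using this
  have h3 : ((τ : ℤ) : ℝ) * p (Tuple.sort key ⟨0, by omega⟩) 1 ≤ ((τ : ℤ) : ℝ) * p l 1 := by
    rcases Prod.Lex.toLex_le_toLex.1 h2 with h | h
    · exact h.le
    · exact h.1.le
  linarith

/-- A configuration in which the robots are at the target points is similar to the pattern. -/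
lemma similar_of_targets (hn : 3 ≤ n) (R : Ranking ρ l) :
    ∃ e : Equiv.Perm (Fin n), Similar (fun k => inPlane L s
      (Function.update (placed (target P) ρ (n - 1)) l (target P (n - 1))) (e k)) P := by
  let m : Fin n → Fin n := fun j => ⟨if ρ j = 0 then n - 1 else ρ j - 1, by
    have := R.rank_lt j; split_ifs <;> omega⟩
  have hm : Function.Injective m := by
    intro i j h
    have h1 := R.rank_lt i
    have h2 := R.rank_lt j
    simp only [m, Fin.mk.injEq] at h
    refine R.rank_injective ?_
    split_ifs at h <;> omega
  let g : Fin n ≃ Fin n := Equiv.ofBijective (fun j => Tuple.sort (targetKey P) (m j))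
    (Finite.injective_iff_bijective.1 ((Tuple.sort (targetKey P)).injective.comp hm))
  have hpos : ∀ j, Function.update (placed (target P) ρ (n - 1)) l (target P (n - 1)) j =
      patternScale P • P (g j) := by
    intro j
    have hjn := R.rank_lt j
    have hg : patternScale P • P (g j) = target P (m j) := by
      rw [target_of_lt (m j).isLt]; rfl
    rw [hg]
    by_cases hj : j = l
    · subst hj
      rw [Function.update_self]
      simp only [m, (R.rank_zero j).2 rfl, if_true]
    · have h0 : ρ j ≠ 0 := fun h => hj ((R.rank_zero j).1 h)
      rw [Function.update_of_ne hj, placed_target (by omega) (by omega)]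
      simp only [m, h0, if_false]
  have hs : 0 < patternScale P := zero_lt_one.trans_le one_le_patternScale
  refine ⟨g.symm, ⟨patternScale P, hs.le⟩, fun h => hs.ne' (congrArg Subtype.val h),
    fun a b => ?_⟩
  simp only [inPlane]
  rw [edist_dist, edist_dist, dist_agreedPoint, hpos, hpos, dist_patternScale,
    Equiv.apply_symm_apply, Equiv.apply_symm_apply, ENNReal.ofReal_mul hs.le]
  congr 1
  exact ENNReal.ofReal_eq_coe_nnreal hs.le

end Course

end FatRobots

theorem theorem7 (n : ℕ) (hn : 3 ≤ n)
    (P : Fin n → Plane) (hP : Function.Injective P) (hP0 : ∀ k, 0 ≤ P k 0 ∧ 0 ≤ P k 1)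
    (phase2 becomeLeader : View → Decision)
    (σ : Fin n → ℤˣ) (δ : ℝ) (hδ : 0 < δ)
    (E : Execution n (patternFormation P phase2 becomeLeader) σ δ)
    (T₁ : ℝ) (hT₁ : 0 ≤ T₁) (hdisks : NonOverlapping (E.pos T₁))
    (l : Fin n) (τ : ℤˣ) (hl : E.IsLeaderConfiguration T₁ l τ) :
    ∃ T₂, T₁ < T₂ ∧ E.IsFinal T₂ ∧
      (∃ e : Equiv.Perm (Fin n), Similar (fun k => E.pos T₂ (e k)) P) ∧
      (∀ t ∈ Set.Icc T₁ T₂, NonOverlapping (E.pos t)) ∧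
      E.Course P T₁ T₂ l τ := by
  obtain ⟨r, hr, hr0⟩ := exists_ranking hn hdisks τ hl.side
  have hn0 : 0 < n := by omega
  set L := E.pos T₁ l with hL
  -- ranks, and the initial positions in agreed coordinates
  obtain ⟨ρ, hρ⟩ : ∃ ρ : Fin n → ℕ, ∀ j, ρ j = (r.symm j).val := ⟨_, fun _ => rfl⟩
  have hρr : ∀ k, ρ (r k) = k.val := fun k => by rw [hρ, Equiv.symm_apply_apply]
  have R : Ranking ρ l := by
    refine ⟨fun j => ?_, fun j => by rw [hρ]; exact (r.symm j).isLt, fun i j h => ?_,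
      fun k hk => ⟨r ⟨k, hk⟩, hρr _⟩⟩
    · rw [hρ, ← hr0]
      constructor
      · intro h
        rw [← r.apply_symm_apply j]
        congr 1
        exact Fin.ext h
      · rintro rfl; simp
    · rw [hρ, hρ] at h
      exact r.symm.injective (Fin.ext h)
  let q₀ : Fin n → Plane := fun j => agreedPoint (inverseBase L τ) τ (E.pos T₁ j)
  have hτ := unit_cast_mul_self τ
  have hq1 : ∀ j, q₀ j 1 = -2 + ((τ : ℤ) : ℝ) * (E.pos T₁ j 1 - L 1) := by
    intro j
    simp only [q₀, agreedPoint_one, inverseBase, pt_one]; ring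
  have hq0 : ∀ j, q₀ j 0 = E.pos T₁ j 0 - L 0 := by
    intro j
    simp only [q₀, agreedPoint_zero, inverseBase, pt_zero]; ring
  have hpos₀ : E.pos T₁ = inPlane L τ q₀ :=
    funext fun j => (agreedPoint_inverse' L τ (E.pos T₁ j)).symm
  have I : Initial q₀ ρ l := by
    refine ⟨R, nonOverlapping_inPlane hdisks, plane_ext ?_ ?_, fun j hj => ?_, fun j hj => ?_,
      fun j k hj hjk => ?_⟩
    · rw [hq0, hL]; simp
    · rw [hq1, hL]; simp
    · have h1 := hl.side j hj
      have h2 := hl.far j hj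
      rw [hq1]
      have h3 : |((τ : ℤ) : ℝ) * (E.pos T₁ j 1 - L 1)| = |E.pos T₁ j 1 - L 1| := by
        rw [abs_mul]
        rcases unit_cast_cases τ with h | h <;> rw [h] <;> simp
      rw [abs_of_pos h1] at h3
      linarith
    · rw [hq0]; linarith [hl.right j hj]
    · have hlt : r.symm j < r.symm k := by rw [hρ, hρ] at hjk; exact hjk
      have := hr hlt
      simp only [Equiv.apply_symm_apply] at this
      unfold Precedes
      rw [hq1, hq1, hq0, hq0]
      rcases Prod.Lex.toLex_lt_toLex.1 this with h | ⟨h, h'⟩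
      · left; simp only at h; linarith
      · right; simp only at h h'; exact ⟨by linarith, by linarith⟩
  have hlight₀ : E.light T₁ = lights ρ 0 := by
    funext j
    by_cases hj : j = l
    · subst hj; rw [hl.leader, R.lights_leader]
    · rw [hl.off j hj, lights_off]
      exact Nat.pos_of_ne_zero fun h => hj ((R.rank_zero j).1 h)
  have Tg := targets hP hP0
  have hrank : ∀ k, k < n - 1 → ∃ i, ρ i = k + 1 := fun k hk => R.rank_surjective _ (by omega)
  -- the robots move to the leader's line
  obtain ⟨s, hs0, hsQ, hsS⟩ := exists_chain (N := n - 1) (T := T₁)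
    (Q := fun k t => 0 ≤ t ∧ E.Stable t ∧ E.pos t = inPlane L τ (lineUp q₀ ρ k) ∧
      E.light t = lights ρ 0)
    (S := fun k t t' => t < t' ∧ ∀ x ∈ Set.Icc t t', E.light x = lights ρ 0 ∧
      NonOverlapping (E.pos x) ∧ ∀ j, ρ j ≠ k + 1 → E.pos x j = E.pos t j)
    ⟨hT₁, hl.stable, by rw [I.lineUp_zero]; exact hpos₀, hlight₀⟩
    (by
      rintro k hk t ⟨h1, h2, h3, h4⟩
      obtain ⟨i, hi⟩ := hrank k hk
      obtain ⟨t', g1, g2, g3, g4, g5⟩ := exists_line_step E I hδ hi h1 h2 h3 h4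
      exact ⟨t', ⟨h1.trans g1.le, g2, g3, g4⟩, g1, fun x hx => ⟨(g5 x hx).1, (g5 x hx).2.1,
        fun j hj => (g5 x hx).2.2 j fun h => hj (h ▸ hi)⟩⟩)
  -- on the line, the orientation of the coordinates does not matter
  let τ' : ℤˣ := σ (r ⟨1, by omega⟩)
  obtain ⟨hsn0, hsn1, hsn2, hsn3⟩ := hsQ (n - 1) le_rfl
  have hturn : E.pos (s (n - 1)) = inPlane L τ' (placed (target P) ρ 0) := by
    rw [hsn2, R.lineUp_last (t := target P)]
    funext j
    have : placed (target P) ρ 0 j = pt (ρ j) (-2) := placed_line (by omega)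
    refine plane_ext ?_ ?_ <;> simp [inPlane, this]
  -- the robots move to their targets
  obtain ⟨u, hu0, huQ, huS⟩ := exists_chain (N := n - 1) (T := s (n - 1))
    (Q := fun k t => 0 ≤ t ∧ E.Stable t ∧ E.pos t = inPlane L τ' (placed (target P) ρ k) ∧
      E.light t = lights ρ k)
    (S := fun k t t' => t < t' ∧ ∀ x ∈ Set.Icc t t', NonOverlapping (E.pos x) ∧
      ∀ j, ρ j ≠ k + 1 → E.pos x j = E.pos t j ∧ E.light x j = E.light t j)
    ⟨hsn0, hsn1, hturn, hsn3⟩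
    (by
      rintro k hk t ⟨h1, h2, h3, h4⟩
      obtain ⟨i, hi⟩ := hrank k hk
      have hτ' : k = 0 → τ' = σ i := by
        rintro rfl
        exact congrArg σ (R.rank_injective ((hρr _).trans hi.symm))
      obtain ⟨t', g1, g2, g3, g4, g5⟩ := exists_target_step E hn R Tg hδ hi hτ' h1 h2 h3 h4
      exact ⟨t', ⟨h1.trans g1.le, g2, g3, g4⟩, g1, fun x hx => ⟨(g5 x hx).1,
        fun j hj => (g5 x hx).2 j fun h => hj (h ▸ hi)⟩⟩)
  obtain ⟨hun0, hun1, hun2, hun3⟩ := huQ (n - 1) le_rfl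
  -- the leader moves to its target
  obtain ⟨T₂, v1, v2, v3, v4, v5⟩ := exists_leader_step E hn R Tg hδ hun0 hun1 hun2 hun3
  have hdisks1 : ∀ t ∈ Set.Icc (s 0) (s (n - 1)), NonOverlapping (E.pos t) :=
    forall_of_chain (by rw [hs0]; exact hdisks) fun k hk t ht => ((hsS k hk).2 t ht).2.1
  have hsle : s 0 ≤ s (n - 1) := by
    have : ∀ k, k ≤ n - 1 → s 0 ≤ s k := by
      intro k
      induction k with
      | zero => exact fun _ => le_rfl
      | succ k ih => exact fun hk => (ih (by omega)).trans (hsS k (by omega)).1.le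
    exact this _ le_rfl
  have hule : u 0 ≤ u (n - 1) := by
    have : ∀ k, k ≤ n - 1 → u 0 ≤ u k := by
      intro k
      induction k with
      | zero => exact fun _ => le_rfl
      | succ k ih => exact fun hk => (ih (by omega)).trans (huS k (by omega)).1.le
    exact this _ le_rfl
  have hdisks2 : ∀ t ∈ Set.Icc (u 0) (u (n - 1)), NonOverlapping (E.pos t) :=
    forall_of_chain (by rw [hu0]; exact hdisks1 _ ⟨hsle, le_rfl⟩)
      fun k hk t ht => ((huS k hk).2 t ht).1
  have hne : ∀ (k j : Fin n), j ≠ r k → ρ j ≠ k.val := by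
    intro k j hj h
    exact hj (R.rank_injective (h.trans (hρr k).symm))
  refine ⟨T₂, ?_, ⟨v2, fun i => ?_⟩, ?_, fun t ht => ?_, r, τ', s, u, hr, ?_, ?_, hs0, ?_, hu0,
    ?_, v1, fun j hj t ht => (v5 t ht).2 j hj, v4 l, ?_⟩
  · rw [← hs0]; linarith
  · rw [v4 i, stays_of_done (v4 i) fun j => Or.inr (Or.inr (v4 j)), v4 i]
  · rw [v3]; exact similar_of_targets hn R
  · rcases le_total t (s (n - 1)) with h | h
    · exact hdisks1 t ⟨by rw [hs0]; exact ht.1, h⟩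
    rcases le_total t (u (n - 1)) with h' | h'
    · exact hdisks2 t ⟨by rw [hu0]; exact h, h'⟩
    · exact (v5 t ⟨h', ht.2⟩).1
  · intro k hk
    rw [← hr0]; congr 1; exact Fin.ext hk
  · intro k hk
    have : k = ⟨1, by omega⟩ := Fin.ext hk
    rw [this]
  · intro k hk
    obtain ⟨m, hm⟩ : ∃ m, k.val = m + 1 := ⟨k.val - 1, by omega⟩
    have hmn : m < n - 1 := by omega
    have e : k.val - 1 = m := by omega
    obtain ⟨h1, h2⟩ := hsS m hmn
    obtain ⟨-, -, h3, -⟩ := hsQ (m + 1) (by omega)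
    have hlt := (hsQ m hmn.le).2.2.2
    rw [e, hm]
    refine ⟨h1, fun j hj t ht => ⟨(h2 t ht).2.2 j (hm ▸ hne k j hj), by rw [(h2 t ht).1, hlt]⟩,
      fun t ht => ?_, ?_⟩
    · rw [(h2 t ht).1]
      exact lights_off (by rw [hρr]; omega)
    · rw [h3, inPlane, lineUp_of_le (by rw [hρr]; omega), hρr, hm]
  · intro k hk
    obtain ⟨m, hm⟩ : ∃ m, k.val = m + 1 := ⟨k.val - 1, by omega⟩
    have hmn : m < n - 1 := by omega
    have e : k.val - 1 = m := by omega
    obtain ⟨h1, h2⟩ := huS m hmn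
    obtain ⟨-, -, h3, h4⟩ := huQ (m + 1) (by omega)
    rw [e, hm]
    refine ⟨h1, fun j hj t ht => (h2 t ht).2 j (hm ▸ hne k j hj), ?_, ?_⟩
    · rw [h4]
      exact lights_done (by rw [hρr]; omega) (by rw [hρr]; omega)
    · rw [h3, inPlane, placed_target (by rw [hρr]; omega) (by rw [hρr]; omega), hρr, e]
  · rw [v3, inPlane, Function.update_self]
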